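/- A sequential model with $N\ge 1$ time steps consists of sets $S_1,\dots,S_{N+1}$, $H_1,\dots,H_N$, $\Lambda$, each a bounded subset of some $\mathbb R^m$ described by finitely many polynomial constraints $g\ge 0$ and $\tilde g=0$, with $H_k$ and $\Lambda$ non-empty; polynomial equations of motion $s_{k+1}=f_k(s_k,h_k,\lambda)$ with $f_k(S_k\times H_k\times\Lambda)\subseteq S_{k+1}$; polynomial rewards $r_k(s_k,h_k,\lambda)$, $k=1,\dots,N$; and a known initial state $s_1\in S_1$. (If no state follows step $N$, take $S_{N+1}$ to be a point.) Let $$\nu^\star=\max\Big\{\sum_{k=1}^N r_k(s_k,h_k,\lambda):\ \lambda\in\Lambda,\ h_k\in H_k,\ s_{k+1}=f_k(s_k,h_k,\lambda)\ \text{for all } k\Big\}.$$ For $n\in\mathbb N$ let $\nu^n$ be the infimum of $\nu$ over all $\nu\in\mathbb R$ and all polynomials $V_k(s_k,\lambda)$, $k=1,\dots,N$, of degree at most $n$ such that, with $V_{N+1}:=0$, $$V_k(s_k,\lambda)-r_k(s_k,h_k,\lambda)-V_{k+1}(f_k(s_k,h_k,\lambda),\lambda)\ge 0\quad(1\le k\le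 N),\qquad \nu-V_1(s_1,\lambda)\ge 0$$ for all $s_k\in S_k$, $h_k\in H_k$, $\lambda\in\Lambda$. For each $j\in\{1,\dots,N\}$ let $(g^j,\tilde g^j)$ be the list of all inequality and equality constraints, in the variables $z=(s_j,h_j,\lambda,s_{j+1})$, that describe $S_j$, $H_j$, $\Lambda$, $S_{j+1}$, together with the equations $s_{j+1}=f_j(s_j,h_j,\lambda)$. A polynomial $p(z)$ satisfies the level-$k$ criterion of Putinar for $(g,\tilde g)$ if it is a finite sum of terms $\tilde f\,\tilde g_i$, $f^2$ and $f^2g_i$, with polynomials $f,\tilde f$, each term being of degree at most $k$. It satisfies the level-$k$ criterion of Schmüdgen if it is a finite sum of terms $\tilde f\,\tilde g_i$ and $f^2\prod_{i\in I}g_i$ ($I$ any, possibly empty, set of indices), each term being of degree at most $k$. Let $\nu^n_k\in(-\infty,+\infty]$ be the infimum of $\nu$ over all $\nu$ and $V_1,\dots,V_N$ of degree at most $n$ such that the $j$-th inequality above is certified by the level-$k$ criterion for $(g^j,\tilde g^j)$, $1\le j\le N$, and $\nu-V_1(s_1,\lambda)$ (with the known $s_1$ inserted) by the level-$k$ criterion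 for $(g^1,\tilde g^1)$; set $\nu^n_k=+\infty$ if there is no such choice. Then: 1. The maximum $\nu^\star$ is attained. 2. For both criteria and all $n,k$, the set of feasible $(\nu,V_1,\dots,V_N)$ of the problem that defines $\nu^n_k$ is the projection of the solution set of a linear matrix inequality, so that $\nu^n_k$ is the optimal value of a semidefinite program; and $\nu^\star\le\nu^n\le\nu^n_k$. 3. For Schmüdgen's criterion, and for Putinar's criterion provided that, for each $j$, there is $K>0$ such that $K-\sum_i z_i^2$ satisfies Putinar's criterion for $(g^j,\tilde g^j)$ at some level, one has $$\lim_{k\to\infty}\nu^n_k=\nu^n\ \text{ for every } n,\qquad \lim_{n\to\infty}\nu^n=\nu^\star,\qquad \lim_{n\to\infty}\nu^n_n=\nu^\star .$$ In particular $\lim_{n\to\infty}\lim_{k\to\infty}\nu^n_k=\nu^\star$. -/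

import Mathlib

open Filter Topology MvPolynomial

noncomputable section

/-- A finite system of polynomial constraints `g ≥ 0` (`g ∈ ineqs`), `g' = 0` (`g' ∈ eqs`). -/
structure PolySystem (σ : Type) where
  ineqs : List (MvPolynomial σ ℝ)
  eqs : List (MvPolynomial σ ℝ)

namespace PolySystem

variable {σ τ : Type}

/-- The basic closed semialgebraic set that the system describes. -/
def region (G : PolySystem σ) : Set (σ → ℝ) :=
  {z | (∀ g ∈ G.ineqs, 0 ≤ eval z g) ∧ ∀ g ∈ G.eqs, eval z g = 0}

/-- The same constraints, imposed on some of the variables of a larger family. -/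
def rename (φ : σ → τ) (G : PolySystem σ) : PolySystem τ where
  ineqs := G.ineqs.map (MvPolynomial.rename φ)
  eqs := G.eqs.map (MvPolynomial.rename φ)

/-- The conjunction of two systems. -/
def append (G G' : PolySystem σ) : PolySystem σ where
  ineqs := G.ineqs ++ G'.ineqs
  eqs := G.eqs ++ G'.eqs

end PolySystem

/-- The two positivstellensätze. -/
inductive Positivstellensatz
  | putinar
  | schmudgen

/-- The polynomials that may multiply a square in a certificate: `1` and the single inequality
constraints (Putinar), or all products of distinct inequality constraints, the empty
product `1` included (Schmüdgen). -/
def Positivstellensatz.multipliers {σ : Type} :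
    Positivstellensatz → PolySystem σ → Set (MvPolynomial σ ℝ)
  | .putinar, G => {m | m = 1 ∨ m ∈ G.ineqs}
  | .schmudgen, G => {m | ∃ l : List (MvPolynomial σ ℝ), l.Sublist G.ineqs ∧ m = l.prod}

/-- Level `d` of the hierarchy: the polynomials that are finite sums of terms `f ^ 2 * m`
(`m` a multiplier) and `f * g` (`g` an equality constraint), every term of degree at most `d`. -/
def sosLevel {σ : Type} (P : Positivstellensatz) (G : PolySystem σ) (d : ℕ) :
    AddSubmonoid (MvPolynomial σ ℝ) :=
  AddSubmonoid.closure
    ({t | ∃ f, ∃ m ∈ P.multipliers G, t = f ^ 2 * m ∧ t.totalDegree ≤ d} ∪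
      {t | ∃ f, ∃ g ∈ G.eqs, t = f * g ∧ t.totalDegree ≤ d})

/-- For some `K > 0`, the polynomial `K - ∑ zᵢ²` admits a Putinar decomposition. -/
def PolySystem.IsArchimedean {σ : Type} [Fintype σ] (G : PolySystem σ) : Prop :=
  ∃ K : ℝ, 0 < K ∧ ∃ d : ℕ, C K - ∑ i, X i ^ 2 ∈ sosLevel .putinar G d

/-- A set is SDP-representable if it is the projection of the solution set of a linear matrix
inequality. -/
def IsSDPRepresentable {E : Type} [AddCommGroup E] [Module ℝ E] (A : Set E) : Prop :=
  ∃ (m d : ℕ) (L : (E × (Fin m → ℝ)) →ᵃ[ℝ] Matrix (Fin d) (Fin d) ℝ),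
    A = {x | ∃ y, (L (x, y)).PosSemidef}

/-- The data of a sequential model with time steps `k : Fin N`: systems describing the state sets
`S_k`, the sets `H_k` of uncontrolled variables and the set `Λ` of evolution parameters; the
equations of motion `s_{k+1} = f_k(s_k, h_k, λ)`, the rewards `r_k(s_k, h_k, λ)`, and the known
initial state. The state set with index `Fin.last N` contains the state after the last step,
which is never rewarded. -/
structure SequentialModel (N : ℕ) [NeZero N] where
  dimS : Fin (N + 1) → ℕ
  dimH : Fin N → ℕ
  dimΛ : ℕ
  S : ∀ k, PolySystem (Fin (dimS k))
  H : ∀ k, PolySystem (Fin (dimH k))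
  Λ : PolySystem (Fin dimΛ)
  f : ∀ k : Fin N, Fin (dimS k.succ) →
    MvPolynomial (Fin (dimS k.castSucc) ⊕ (Fin (dimH k) ⊕ Fin dimΛ)) ℝ
  r : ∀ k : Fin N, MvPolynomial (Fin (dimS k.castSucc) ⊕ (Fin (dimH k) ⊕ Fin dimΛ)) ℝ
  s₁ : Fin (dimS (0 : Fin N).castSucc) → ℝ

namespace SequentialModel

variable {N : ℕ} [NeZero N] (M : SequentialModel N)

/-- The value of `f_k(s, h, l)`. -/
def step (k : Fin N) (s : Fin (M.dimS k.castSucc) → ℝ) (h : Fin (M.dimH k) → ℝ)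
    (l : Fin M.dimΛ → ℝ) : Fin (M.dimS k.succ) → ℝ :=
  fun i => eval (Sum.elim s (Sum.elim h l)) (M.f k i)

/-- The value of `r_k(s, h, l)`. -/
def reward (k : Fin N) (s : Fin (M.dimS k.castSucc) → ℝ) (h : Fin (M.dimH k) → ℝ)
    (l : Fin M.dimΛ → ℝ) : ℝ :=
  eval (Sum.elim s (Sum.elim h l)) (M.r k)

/-- The standing assumptions on a sequential model. -/
structure WellPosed : Prop where
  bounded_S : ∀ k, Bornology.IsBounded (M.S k).region
  bounded_H : ∀ k, Bornology.IsBounded (M.H k).region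
  bounded_Λ : Bornology.IsBounded M.Λ.region
  nonempty_H : ∀ k, (M.H k).region.Nonempty
  nonempty_Λ : M.Λ.region.Nonempty
  initial_mem : M.s₁ ∈ (M.S (0 : Fin N).castSucc).region
  step_mem : ∀ k : Fin N, ∀ s ∈ (M.S k.castSucc).region, ∀ h ∈ (M.H k).region,
    ∀ l ∈ M.Λ.region, M.step k s h l ∈ (M.S k.succ).region

/-- The total rewards of all evolutions of the model. -/
def totalRewards : Set ℝ :=
  {R | ∃ l ∈ M.Λ.region, ∃ h : ∀ k, Fin (M.dimH k) → ℝ, (∀ k, h k ∈ (M.H k).region) ∧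
    ∃ s : ∀ k, Fin (M.dimS k) → ℝ, s (0 : Fin N).castSucc = M.s₁ ∧
      (∀ k : Fin N, s k.succ = M.step k (s k.castSucc) (h k) l) ∧
      R = ∑ k : Fin N, M.reward k (s k.castSucc) (h k) l}

/-- `ν*`, the maximal total reward. -/
def nuStar : ℝ := sSup M.totalRewards

/-- Pairs of a number `ν` and a family `V_k(s_k, λ)`, `k : Fin N`, of polynomials of degree at
most `n`. -/
abbrev Candidate (n : ℕ) : Type :=
  ℝ × (∀ k : Fin N, restrictTotalDegree (Fin (M.dimS k.castSucc) ⊕ Fin M.dimΛ) ℝ n)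

variable {M} in
/-- The value functions of a candidate, extended by zero to the time after the last step. -/
def Candidate.V {n : ℕ} (x : M.Candidate n) :
    ∀ k : Fin (N + 1), MvPolynomial (Fin (M.dimS k) ⊕ Fin M.dimΛ) ℝ :=
  Fin.lastCases 0 (fun k => (x.2 k : MvPolynomial (Fin (M.dimS k.castSucc) ⊕ Fin M.dimΛ) ℝ))

/-- The candidates of degree `n` that satisfy the dynamic programming inequalities pointwise. -/
def feasible (n : ℕ) : Set (M.Candidate n) :=
  {x | (∀ k : Fin N, ∀ s ∈ (M.S k.castSucc).region, ∀ h ∈ (M.H k).region, ∀ l ∈ M.Λ.region,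
      M.reward k s h l + eval (Sum.elim (M.step k s h l) l) (x.V k.succ) ≤
        eval (Sum.elim s l) (x.V k.castSucc)) ∧
    ∀ l ∈ M.Λ.region, eval (Sum.elim M.s₁ l) (x.V (0 : Fin N).castSucc) ≤ x.1}

/-- `ν^n`, the optimal value over value functions of degree `n`. -/
def nuDeg (n : ℕ) : EReal := ⨅ x ∈ M.feasible n, (x.1 : EReal)

/-- The variables `(s_k, h_k, λ, s_{k+1})` of step `k`. -/
abbrev StepVar (k : Fin N) : Type :=
  (Fin (M.dimS k.castSucc) ⊕ (Fin (M.dimH k) ⊕ Fin M.dimΛ)) ⊕ Fin (M.dimS k.succ)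

/-- The state variables among those of step `k`. -/
def stateVar (k : Fin N) (i : Fin (M.dimS k.castSucc)) : M.StepVar k := .inl (.inl i)

/-- The uncontrolled variables among those of step `k`. -/
def actionVar (k : Fin N) (i : Fin (M.dimH k)) : M.StepVar k := .inl (.inr (.inl i))

/-- The evolution parameters among the variables of step `k`. -/
def paramVar (k : Fin N) (i : Fin M.dimΛ) : M.StepVar k := .inl (.inr (.inr i))

/-- The next-state variables among those of step `k`. -/
def nextVar (k : Fin N) (i : Fin (M.dimS k.succ)) : M.StepVar k := .inr i

/-- The equation of motion `s_{k+1} = f_k(s_k, h_k, λ)` as a system of polynomial equations. -/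
def motionSystem (k : Fin N) : PolySystem (M.StepVar k) where
  ineqs := []
  eqs := List.ofFn fun i => X (M.nextVar k i) - rename Sum.inl (M.f k i)

/-- The constraints of step `k`: those of `S_k`, `H_k`, `Λ`, `S_{k+1}` and the equation of
motion. -/
def stepSystem (k : Fin N) : PolySystem (M.StepVar k) :=
  (((((M.S k.castSucc).rename (M.stateVar k)).append ((M.H k).rename (M.actionVar k))).append
    (M.Λ.rename (M.paramVar k))).append ((M.S k.succ).rename (M.nextVar k))).append
      (M.motionSystem k)

variable {M} in
/-- `V_k(s_k, λ) - r_k(s_k, h_k, λ) - V_{k+1}(f_k(s_k, h_k, λ), λ)`. -/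
def Candidate.stepSlack {n : ℕ} (x : M.Candidate n) (k : Fin N) : MvPolynomial (M.StepVar k) ℝ :=
  rename (Sum.elim (M.stateVar k) (M.paramVar k)) (x.V k.castSucc) - rename Sum.inl (M.r k) -
    bind₁ (Sum.elim (fun i => rename Sum.inl (M.f k i)) (fun j => X (M.paramVar k j)))
      (x.V k.succ)

variable {M} in
/-- `ν - V_1(s₁, λ)`, with the known initial state `s₁` inserted. -/
def Candidate.initialSlack {n : ℕ} (x : M.Candidate n) : MvPolynomial (M.StepVar 0) ℝ :=
  C x.1 - bind₁ (Sum.elim (fun i => C (M.s₁ i)) (fun j => X (M.paramVar 0 j)))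
    (x.V (0 : Fin N).castSucc)

/-- The candidates of degree `n` for which all inequalities are certified at level `d`. -/
def feasibleSOS (P : Positivstellensatz) (n d : ℕ) : Set (M.Candidate n) :=
  {x | (∀ k, x.stepSlack k ∈ sosLevel P (M.stepSystem k) d) ∧
    x.initialSlack ∈ sosLevel P (M.stepSystem 0) d}

/-- `ν^n_d`, the optimal value of the level-`d` relaxation of the degree-`n` problem (`⊤` if
the relaxation is infeasible). -/
def nuSOS (P : Positivstellensatz) (n d : ℕ) : EReal :=
  ⨅ x ∈ M.feasibleSOS P n d, (x.1 : EReal)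

end SequentialModel

end

/-!
The proof has three ingredients.

*Certificates.* A polynomial that is strictly positive on a bounded basic closed semialgebraic set
has a Schmüdgen certificate, and a Putinar certificate if the system is archimedean
(`exists_mem_sosLevel_of_pos`). If a preordering of a real polynomial ring does not contain `-1`,
it is nonnegative under some homomorphism to a real closed field
(`exists_realClosed_of_preordering`). Real closed fields enter only through the intermediate value
property of their polynomials: signs at their points of finitely many real polynomials are also
signs at real points (`MvPolynomial.exists_real_sign_eq`), by induction on the number of variables,
since the ordering of the roots of finitely many univariate polynomials, and their signs on the
gaps, are determined by the signs of finitely many polynomials in the coefficients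
(`exists_sign_determining`). This gives a point at which the constraints hold, hence
Stengle's theorem (`exists_mul_eq_one_add`), and from it a certificate of `K - ∑ zᵢ²` on a bounded
set (`exists_ball_mem_certificates`). Hence in both cases the certificates form an archimedean
quadratic module, and such a module contains every polynomial that is positive at all points at
which its elements are nonnegative (`IsQuadraticModule.mem_of_pos`): a state that separates a
polynomial from the module can be chosen extreme, and an extreme state is multiplicative, thus the
evaluation at a point.

*Semidefinite programming.* The polynomials with a certificate of level `d` form a finite sum of
cones. Each of them is a linear image of a cone of positive semidefinite Gram matrices, or a space
of multiples of an equality constraint (`isSpectrahedralImage_sosLevel`), and the slacks depend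
affinely on the candidate.

*Dynamic programming.* Bellman's recursion gives continuous value functions `value`, whose
maximizing policy attains `ν*`; summed along an evolution, the inequalities of the relaxations
bound its total reward by `ν`. Conversely, the value functions are uniformly approximated by
polynomials, and adding constants that decrease along the time steps makes all inequalities strict
at a small cost in `ν` (`exists_mem_almostFeasible_neg`), so that they are certified at some level.
The same perturbation of any feasible polynomials gives `ν^n_k → ν^n`.
-/

noncomputable section

/-! ### Real closed fields -/

namespace Polynomial.RealClosure

open IntermediateField

variable {k Ω : Type*} [Field k] [Field Ω] [Algebra k Ω]

/-- The sums of elements `t * x ^ 2` with `t ∈ T` and `x` in the intermediate field `K`. -/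
def cone (T : Submonoid Ω) (K : IntermediateField k Ω) : AddSubmonoid Ω :=
  AddSubmonoid.closure {y | ∃ t ∈ T, ∃ x ∈ K, y = t * x ^ 2}

lemma cone_mono (T : Submonoid Ω) {K K' : IntermediateField k Ω} (h : K ≤ K') :
    cone T K ≤ cone T K' :=
  AddSubmonoid.closure_mono fun _ ⟨t, ht, x, hx, e⟩ => ⟨t, ht, x, h hx, e⟩

lemma mul_sq_mem_cone {T : Submonoid Ω} {K : IntermediateField k Ω} {t x : Ω} (ht : t ∈ T)
    (hx : x ∈ K) : t * x ^ 2 ∈ cone T K :=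
  AddSubmonoid.subset_closure ⟨t, ht, x, hx, rfl⟩

lemma sq_mem_cone {T : Submonoid Ω} {K : IntermediateField k Ω} {x : Ω}
    (hx : x ∈ K) : x ^ 2 ∈ cone T K := by
  simpa using mul_sq_mem_cone (one_mem T) hx

lemma mem_cone_of_mem {T : Submonoid Ω} {K : IntermediateField k Ω} {t : Ω} (ht : t ∈ T) :
    t ∈ cone T K := by
  simpa using mul_sq_mem_cone ht (one_mem K)

lemma one_mem_cone (T : Submonoid Ω) (K : IntermediateField k Ω) : 1 ∈ cone T K :=
  mem_cone_of_mem (one_mem T)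

lemma mul_mem_cone {T : Submonoid Ω} {K : IntermediateField k Ω} {a b : Ω} (ha : a ∈ cone T K)
    (hb : b ∈ cone T K) : a * b ∈ cone T K := by
  induction ha using AddSubmonoid.closure_induction with
  | zero => simp
  | add x y _ _ hx hy => rw [add_mul]; exact add_mem hx hy
  | mem x hx =>
    obtain ⟨t, ht, u, hu, rfl⟩ := hx
    induction hb using AddSubmonoid.closure_induction with
    | zero => simp
    | add x y _ _ hx hy => rw [mul_add]; exact add_mem hx hy
    | mem x hx =>
      obtain ⟨t', ht', u', hu', rfl⟩ := hx
      have := mul_sq_mem_cone (mul_mem ht ht') (mul_mem hu hu')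
      rwa [show t * u ^ 2 * (t' * u' ^ 2) = t * t' * (u * u') ^ 2 by ring]

lemma mem_of_mem_cone {T : Submonoid Ω} (hT : ∀ t ∈ T, t ∈ (⊥ : IntermediateField k Ω))
    {K : IntermediateField k Ω} {y : Ω} (hy : y ∈ cone T K) : y ∈ K := by
  induction hy using AddSubmonoid.closure_induction with
  | zero => exact zero_mem K
  | add x y _ _ hx hy => exact add_mem hx hy
  | mem x hx =>
    obtain ⟨t, ht, u, hu, rfl⟩ := hx
    exact mul_mem ((bot_le : ⊥ ≤ K) (hT t ht)) (pow_mem hu 2)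

/-- Among the intermediate fields over which `-1` is not a sum of elements `t * x ^ 2`, there is
a maximal one. -/
lemma exists_maximal (T : Submonoid Ω) (h : (-1 : Ω) ∉ cone T (⊥ : IntermediateField k Ω)) :
    ∃ K : IntermediateField k Ω, Maximal (fun K => (-1 : Ω) ∉ cone T K) K := by
  obtain ⟨K, -, hK⟩ := zorn_le_nonempty₀ {K : IntermediateField k Ω | (-1 : Ω) ∉ cone T K}
    (fun c hc hchain y hy => by
      have : Nonempty c := ⟨⟨y, hy⟩⟩
      have hdir : Directed (· ≤ ·) (fun i : c => (i : IntermediateField k Ω)) :=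
        hchain.directed
      refine ⟨⨆ i : c, (i : IntermediateField k Ω), ?_, fun z hz =>
        le_iSup (fun i : c => (i : IntermediateField k Ω)) ⟨z, hz⟩⟩
      intro hneg
      have hsub : cone T (⨆ i : c, (i : IntermediateField k Ω)) ≤
          ⨆ i : c, cone T (i : IntermediateField k Ω) := by
        refine AddSubmonoid.closure_le.2 ?_
        rintro _ ⟨t, ht, x, hx, rfl⟩
        rw [← SetLike.mem_coe, IntermediateField.coe_iSup_of_directed hdir] at hx
        obtain ⟨i, hi⟩ := Set.mem_iUnion.1 hx
        exact (le_iSup (fun i : c => cone T (i : IntermediateField k Ω)) i)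
          (mul_sq_mem_cone ht hi)
      have hdir' : Directed (· ≤ ·) (fun i : c => cone T (i : IntermediateField k Ω)) :=
        fun i j => (hdir i j).imp fun _ hl => ⟨cone_mono T hl.1, cone_mono T hl.2⟩
      obtain ⟨i, hi⟩ := (AddSubmonoid.mem_iSup_of_directed hdir').1 (hsub hneg)
      exact hc i.2 hi) ⊥ h
  exact ⟨K, hK⟩

variable {T : Submonoid Ω} {K : IntermediateField k Ω}

lemma inv_mem_cone {x : Ω} (hK : x ∈ K) (hx : x ∈ cone T K) : x⁻¹ ∈ cone T K := by
  by_cases h0 : x = 0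
  · simp [h0]
  · have := mul_mem_cone hx (sq_mem_cone (inv_mem hK) : x⁻¹ ^ 2 ∈ cone T K)
    rwa [show x * x⁻¹ ^ 2 = x⁻¹ by field_simp] at this

/-- Every element of a simple algebraic extension of `K` is a polynomial in the generator. -/
lemma exists_aeval_of_mem_adjoin [Algebra.IsAlgebraic k Ω] {α x : Ω}
    (hx : x ∈ (K⟮α⟯).restrictScalars k) : ∃ h : K[X], aeval α h = x := by
  have hα : IsAlgebraic K α := (Algebra.IsAlgebraic.isAlgebraic (R := k) α).extendScalars
    (algebraMap k K).injective
  have h1 : x ∈ (K⟮α⟯).toSubalgebra := hx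
  rw [IntermediateField.adjoin_simple_toSubalgebra_of_isAlgebraic hα,
    Algebra.adjoin_singleton_eq_range_aeval] at h1
  exact h1

lemma neg_one_mem_cone_adjoin
    (hK : Maximal (fun K : IntermediateField k Ω => (-1 : Ω) ∉ cone T K) K)
    {α : Ω} (hα : α ∉ K) : (-1 : Ω) ∈ cone T ((K⟮α⟯).restrictScalars k) := by
  by_contra hcon
  have hle : K ≤ (K⟮α⟯).restrictScalars k := fun x hx =>
    (K⟮α⟯).algebraMap_mem (⟨x, hx⟩ : K)
  exact hα (hK.2 hcon hle (IntermediateField.mem_adjoin_simple_self K α))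

/-- Over a maximal field `K`, an element without a square root in `K` is the negative of an
element of the cone: `-1` becomes an element of the cone once the root is adjoined. -/
lemma neg_mem_cone_of_not_square [IsAlgClosed Ω] [Algebra.IsAlgebraic k Ω]
    (hT : ∀ t ∈ T, t ∈ (⊥ : IntermediateField k Ω))
    (hK : Maximal (fun K : IntermediateField k Ω => (-1 : Ω) ∉ cone T K) K)
    {x : Ω} (hx : x ∈ K) (hsq : ¬ ∃ y ∈ K, y ^ 2 = x) : -x ∈ cone T K := by
  obtain ⟨α, hα⟩ := IsAlgClosed.exists_pow_nat_eq x (n := 2) (by norm_num)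
  have hαK : α ∉ K := fun h => hsq ⟨α, h, hα⟩
  -- the cone of `K⟮α⟯`, written in the basis `1, α` of this extension
  have key : ∀ y ∈ cone T ((K⟮α⟯).restrictScalars k), ∃ s ∈ cone T K, ∃ t ∈ cone T K, ∃ u ∈ K,
      y = s + t * x + u * α := by
    intro y hy
    induction hy using AddSubmonoid.closure_induction with
    | zero => exact ⟨0, zero_mem _, 0, zero_mem _, 0, zero_mem _, by simp⟩
    | add y z _ _ hy hz =>
      obtain ⟨s, hs, t, ht, u, hu, rfl⟩ := hy
      obtain ⟨s', hs', t', ht', u', hu', rfl⟩ := hz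
      exact ⟨s + s', add_mem hs hs', t + t', add_mem ht ht', u + u', add_mem hu hu', by ring⟩
    | mem y hy =>
      obtain ⟨τ, hτ, z, hz, rfl⟩ := hy
      obtain ⟨h, rfl⟩ := exists_aeval_of_mem_adjoin hz
      set q : K[X] := X ^ 2 - C ⟨x, hx⟩ with hq
      have hqm : q.Monic := monic_X_pow_sub_C _ (by norm_num)
      have hq0 : aeval α q = 0 := by
        simp only [hq, map_sub, map_pow, aeval_X, aeval_C, hα]
        exact sub_self _
      have hdeg : (h %ₘ q).natDegree ≤ 1 := by
        have := natDegree_modByMonic_lt h hqm (by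
          intro h1
          have h2 : q.natDegree = 2 := natDegree_X_pow_sub_C
          rw [h1] at h2; simp at h2)
        rw [natDegree_X_pow_sub_C] at this; omega
      obtain ⟨b, a, hab⟩ := exists_eq_X_add_C_of_natDegree_le_one hdeg
      have e : aeval α h = a + b * α := by
        have h1 := congrArg (aeval α) (modByMonic_add_div h q)
        rw [map_add, map_mul, hq0, zero_mul, add_zero, hab] at h1
        rw [← h1]
        simp only [map_add, map_mul, aeval_C, aeval_X]
        rw [add_comm]; rfl
      refine ⟨τ * a ^ 2, mul_sq_mem_cone hτ a.2, τ * b ^ 2, mul_sq_mem_cone hτ b.2,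
        2 * (τ * a * b), ?_, ?_⟩
      · have := (bot_le : ⊥ ≤ K) (hT τ hτ)
        exact mul_mem (ofNat_mem K 2) (mul_mem (mul_mem this a.2) b.2)
      · rw [e, ← hα]; ring
  -- `-1 = s + t * x`, hence `-x = (1 + s) / t`
  obtain ⟨s, hs, t, ht, u, hu, e⟩ := key _ (neg_one_mem_cone_adjoin hK hαK)
  have hsK := mem_of_mem_cone hT hs
  have htK := mem_of_mem_cone hT ht
  have hu0 : u = 0 := by
    by_contra hu0
    apply hαK
    have : α = (-1 - s - t * x) * u⁻¹ := by
      field_simp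
      rw [e]; ring
    rw [this]
    exact mul_mem (sub_mem (sub_mem (neg_mem (one_mem K)) hsK) (mul_mem htK hx)) (inv_mem hu)
  rw [hu0, zero_mul, add_zero] at e
  have ht0 : t ≠ 0 := by
    rintro rfl
    rw [zero_mul, add_zero] at e
    exact hK.1 (e ▸ hs)
  have : -x = (1 + s) * t⁻¹ := by
    field_simp
    linear_combination e
  rw [this]
  exact mul_mem_cone (add_mem (one_mem_cone T K) hs) (inv_mem_cone htK ht)

/-- The cone of a maximal field is the set of nonnegative elements of a field ordering. -/
lemma mem_or_neg_mem_cone [IsAlgClosed Ω] [Algebra.IsAlgebraic k Ω]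
    (hT : ∀ t ∈ T, t ∈ (⊥ : IntermediateField k Ω))
    (hK : Maximal (fun K : IntermediateField k Ω => (-1 : Ω) ∉ cone T K) K)
    {x : Ω} (hx : x ∈ K) : x ∈ cone T K ∨ -x ∈ cone T K := by
  by_cases h : ∃ y ∈ K, y ^ 2 = x
  · obtain ⟨y, hy, rfl⟩ := h
    exact .inl (sq_mem_cone hy)
  · exact .inr (neg_mem_cone_of_not_square hT hK hx h)

lemma eq_zero_of_mem_cone (hT : ∀ t ∈ T, t ∈ (⊥ : IntermediateField k Ω))
    (hK : (-1 : Ω) ∉ cone T K) {x : Ω} (h1 : x ∈ cone T K) (h2 : -x ∈ cone T K) : x = 0 := by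
  by_contra h0
  apply hK
  have := mul_mem_cone h2 (inv_mem_cone (mem_of_mem_cone hT h1) h1)
  rwa [show -x * x⁻¹ = -1 by field_simp] at this

end Polynomial.RealClosure

/-- The intermediate value property for polynomials, which characterises real closed fields among
the ordered fields. -/
def PolyIVT (R : Type*) [Field R] [LinearOrder R] : Prop :=
  ∀ (p : Polynomial R) (a b : R), a < b → p.eval a * p.eval b < 0 →
    ∃ c ∈ Set.Ioo a b, p.eval c = 0

namespace Polynomial.RealClosure

open IntermediateField

variable {k Ω : Type*} [Field k] [Field Ω] [Algebra k Ω] {T : Submonoid Ω}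
  {K : IntermediateField k Ω}

/-- The elements of the cone of a simple algebraic extension are the values at the generator of
polynomials that are nonnegative on `K` and have low degree. -/
lemma exists_natDegree_le_of_mem_cone_adjoin [Algebra.IsAlgebraic k Ω]
    [LinearOrder K] [IsStrictOrderedRing K] (hord : ∀ x : K, 0 ≤ x ↔ (x : Ω) ∈ cone T K)
    (hT : ∀ t ∈ T, t ∈ (⊥ : IntermediateField k Ω)) {f : K[X]} {α : Ω} (hα : aeval α f = 0)
    (hf : 0 < f.natDegree) {y : Ω} (hy : y ∈ cone T ((K⟮α⟯).restrictScalars k)) :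
    ∃ S : K[X], S.natDegree ≤ 2 * (f.natDegree - 1) ∧ (∀ c, 0 ≤ S.eval c) ∧ aeval α S = y := by
  induction hy using AddSubmonoid.closure_induction with
  | zero => exact ⟨0, by simp, by simp, by simp⟩
  | add y z _ _ hy hz =>
    obtain ⟨S, h1, h2, h3⟩ := hy
    obtain ⟨S', h1', h2', h3'⟩ := hz
    exact ⟨S + S', natDegree_add_le_of_degree_le h1 h1',
      fun c => by rw [eval_add]; exact add_nonneg (h2 c) (h2' c), by rw [map_add, h3, h3']⟩
  | mem y hy =>
    obtain ⟨τ, hτ, z, hz, rfl⟩ := hy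
    obtain ⟨h, hh⟩ := exists_aeval_of_mem_adjoin hz
    have hτK : τ ∈ K := (bot_le : ⊥ ≤ K) (hT τ hτ)
    have h1 : aeval α (h % f) = z := by
      have h1 := congrArg (aeval α) (EuclideanDomain.mod_add_div h f)
      rwa [map_add, map_mul, hα, zero_mul, add_zero, hh] at h1
    refine ⟨C ⟨τ, hτK⟩ * (h % f) ^ 2, ?_, fun c => ?_, ?_⟩
    · have h2 : (h % f).natDegree < f.natDegree := natDegree_mod_lt h hf.ne'
      have h3 : ((h % f) ^ 2).natDegree ≤ 2 * (h % f).natDegree := natDegree_pow_le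
      have h4 := natDegree_C_mul_le (⟨τ, hτK⟩ : K) ((h % f) ^ 2)
      omega
    · rw [eval_mul, eval_C, eval_pow]
      exact mul_nonneg ((hord _).2 (mem_cone_of_mem hτ)) (sq_nonneg _)
    · rw [map_mul, map_pow, h1, aeval_C]
      rfl

set_option maxHeartbeats 1000000 in
/-- The intermediate value property of a maximal field. If `f` is irreducible, changes sign and
has a root outside of the field, then `f` divides `1 + S` for a nonnegative polynomial `S` of
smaller degree than `f ^ 2`; the quotient changes sign as well and has lower degree than `f`. -/
lemma polyIVT [IsAlgClosed Ω] [Algebra.IsAlgebraic k Ω]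
    (hK : Maximal (fun K : IntermediateField k Ω => (-1 : Ω) ∉ cone T K) K)
    [LinearOrder K] [IsStrictOrderedRing K] (hord : ∀ x : K, 0 ≤ x ↔ (x : Ω) ∈ cone T K)
    (hT : ∀ t ∈ T, t ∈ (⊥ : IntermediateField k Ω)) : PolyIVT K := by
  suffices H : ∀ (n : ℕ) (f : K[X]), f.natDegree ≤ n → ∀ a b : K, a < b →
      f.eval a * f.eval b < 0 → ∃ c ∈ Set.Ioo a b, f.eval c = 0 from
    fun f a b hab h => H _ f le_rfl a b hab h
  intro n
  induction n using Nat.strong_induction_on with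
  | _ n ih =>
  intro f hfn a b hab hf
  have hf0 : f ≠ 0 := by rintro rfl; simp at hf
  have hunit : ¬ IsUnit f := by
    intro hu
    obtain ⟨c, -, rfl⟩ := Polynomial.isUnit_iff.1 hu
    simp only [eval_C] at hf
    exact absurd hf (not_lt.2 (mul_self_nonneg c))
  by_cases hirr : Irreducible f
  · obtain ⟨α, hα⟩ := IsAlgClosed.exists_aeval_eq_zero Ω f (by
      intro h; exact hunit (Polynomial.isUnit_iff_degree_eq_zero.2 h))
    by_cases hαK : α ∈ K
    · -- a root in the field makes `f` linear
      have hroot : f.eval ⟨α, hαK⟩ = 0 := by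
        apply Subtype.ext
        have := aeval_algebraMap_apply Ω (⟨α, hαK⟩ : K) f
        rw [show algebraMap K Ω ⟨α, hαK⟩ = α from rfl, hα] at this
        simpa [aeval_def] using this.symm
      obtain ⟨g, hg⟩ := dvd_iff_isRoot.2 hroot
      rcases hirr.isUnit_or_isUnit hg with hu | hu
      · exact absurd hu (not_isUnit_X_sub_C _)
      · obtain ⟨c, -, rfl⟩ := Polynomial.isUnit_iff.1 hu
        refine ⟨⟨α, hαK⟩, ?_, hroot⟩
        rw [hg] at hf
        simp only [eval_mul, eval_sub, eval_X, eval_C] at hf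
        set r : K := ⟨α, hαK⟩
        have h1 : (a - r) * (b - r) < 0 := by
          by_contra h
          have := mul_nonneg (not_lt.1 h) (mul_self_nonneg c)
          nlinarith
        rcases mul_neg_iff.1 h1 with h2 | h2
        · exact absurd h2 (by intro h; linarith [h.1, h.2])
        · exact ⟨by linarith [h2.1], by linarith [h2.2]⟩
    · obtain ⟨S, hSdeg, hSpos, hS⟩ := exists_natDegree_le_of_mem_cone_adjoin hord hT hα
        (Nat.pos_of_ne_zero fun h0 => hunit (Polynomial.isUnit_iff_degree_eq_zero.2
          (by rw [degree_eq_natDegree hf0, h0]; rfl))) (neg_one_mem_cone_adjoin hK hαK)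
      have hdvd : f ∣ 1 + S := by
        have h1 : minpoly K α ∣ 1 + S := minpoly.dvd K α (by
          rw [map_add, hS, map_one, add_neg_cancel])
        have h2 : minpoly K α ∣ f := minpoly.dvd K α hα
        have hint : IsIntegral K α := ((Algebra.IsAlgebraic.isAlgebraic (R := k) α).extendScalars
          (algebraMap k K).injective).isIntegral
        exact ((minpoly.irreducible hint).dvd_symm hirr h2).trans h1
      obtain ⟨g, hg⟩ := hdvd
      -- a zero of `g`, which has lower degree than `f`, contradicts `f * g = 1 + S`
      have hpos : ∀ c, 0 < f.eval c * g.eval c := by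
        intro c
        have h1 := congrArg (eval c) hg
        rw [eval_add, eval_one, eval_mul] at h1
        rw [← h1]; linarith [hSpos c]
      have hg0 : g ≠ 0 := by
        rintro rfl
        simpa using hpos a
      have hgdeg : g.natDegree + f.natDegree ≤ 2 * (f.natDegree - 1) := by
        rw [add_comm, ← natDegree_mul hf0 hg0, ← hg]
        exact natDegree_add_le_of_degree_le (by simp) hSdeg
      have hfpos : 0 < f.natDegree := by
        rw [Nat.pos_iff_ne_zero]
        intro h0
        exact hunit (Polynomial.isUnit_iff_degree_eq_zero.2
          (by rw [degree_eq_natDegree hf0, h0]; rfl))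
      obtain ⟨c, -, hc⟩ := ih g.natDegree (by omega) g le_rfl a b hab (by
        have h1 := mul_pos (hpos a) (hpos b)
        by_contra h2
        nlinarith [not_lt.1 h2])
      have := hpos c
      rw [hc, mul_zero] at this
      exact absurd this (lt_irrefl _)
  · -- a proper factor changes sign
    rw [irreducible_iff] at hirr
    push Not at hirr
    obtain ⟨g, h, rfl, hgu, hhu⟩ := hirr hunit
    obtain ⟨hg0, hh0⟩ := mul_ne_zero_iff.1 hf0
    have hdeg := natDegree_mul hg0 hh0
    have hgpos : 0 < g.natDegree := by
      rw [Nat.pos_iff_ne_zero]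
      intro h0
      exact hgu (Polynomial.isUnit_iff_degree_eq_zero.2
        (by rw [degree_eq_natDegree hg0, h0]; rfl))
    have hhpos : 0 < h.natDegree := by
      rw [Nat.pos_iff_ne_zero]
      intro h0
      exact hhu (Polynomial.isUnit_iff_degree_eq_zero.2
        (by rw [degree_eq_natDegree hh0, h0]; rfl))
    simp only [eval_mul] at hf ⊢
    rcases lt_or_ge (g.eval a * g.eval b) 0 with hg | hg
    · obtain ⟨c, hc, hc0⟩ := ih g.natDegree (by omega) g le_rfl a b hab hg
      exact ⟨c, hc, by rw [hc0, zero_mul]⟩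
    · rcases lt_or_ge (h.eval a * h.eval b) 0 with hh | hh
      · obtain ⟨c, hc, hc0⟩ := ih h.natDegree (by omega) h le_rfl a b hab hh
        exact ⟨c, hc, by rw [hc0, mul_zero]⟩
      · exact absurd hf (not_lt.2 (by nlinarith [mul_nonneg hg hh]))

/-- A field in which `-1` is not a sum of elements `t * x ^ 2`, `t ∈ T`, maps to a real closed
field in such a way that `T` becomes nonnegative. -/
theorem exists_realClosed {k : Type} [Field k] (T : Submonoid k)
    (h : (-1 : k) ∉ AddSubmonoid.closure {y | ∃ t ∈ T, ∃ x, y = t * x ^ 2}) :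
    ∃ (R : Type) (_ : Field R) (_ : LinearOrder R) (_ : IsStrictOrderedRing R) (φ : k →+* R),
      PolyIVT R ∧ ∀ t ∈ T, 0 ≤ φ t := by
  classical
  let Ω := AlgebraicClosure k
  let T' : Submonoid Ω := T.map (algebraMap k Ω)
  have hT' : ∀ t ∈ T', t ∈ (⊥ : IntermediateField k Ω) := by
    rintro _ ⟨t, -, rfl⟩
    exact IntermediateField.algebraMap_mem _ t
  have hbot : (-1 : Ω) ∉ cone T' (⊥ : IntermediateField k Ω) := by
    intro hneg
    apply h
    have key : ∀ y ∈ cone T' (⊥ : IntermediateField k Ω), ∃ z ∈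
        AddSubmonoid.closure {y : k | ∃ t ∈ T, ∃ x, y = t * x ^ 2}, algebraMap k Ω z = y := by
      intro y hy
      induction hy using AddSubmonoid.closure_induction with
      | zero => exact ⟨0, zero_mem _, map_zero _⟩
      | add y z _ _ hy hz =>
        obtain ⟨u, hu, rfl⟩ := hy
        obtain ⟨v, hv, rfl⟩ := hz
        exact ⟨u + v, add_mem hu hv, map_add _ _ _⟩
      | mem y hy =>
        obtain ⟨_, ⟨t, ht, rfl⟩, x, hx, rfl⟩ := hy
        obtain ⟨x, rfl⟩ := IntermediateField.mem_bot.1 hx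
        exact ⟨t * x ^ 2, AddSubmonoid.subset_closure ⟨t, ht, x, rfl⟩, by simp⟩
    obtain ⟨z, hz, hz'⟩ := key _ hneg
    have : z = -1 := (algebraMap k Ω).injective (by simpa using hz')
    exact this ▸ hz
  obtain ⟨K, hK⟩ := exists_maximal T' hbot
  -- the cone of the maximal field orders it
  let C : RingCone K :=
    { carrier := {x | (x : Ω) ∈ cone T' K}
      zero_mem' := zero_mem (cone T' K)
      one_mem' := one_mem_cone T' K
      add_mem' := fun {a b} hx hy => (cone T' K).add_mem hx hy
      mul_mem' := fun hx hy => mul_mem_cone hx hy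
      eq_zero_of_mem_of_neg_mem' := fun hx hy =>
        Subtype.ext (eq_zero_of_mem_cone hT' hK.1 hx hy) }
  have : HasMemOrNegMem C := ⟨fun x => mem_or_neg_mem_cone hT' hK x.2⟩
  let _ : LinearOrder K := .mkOfAddGroupCone C
  have : IsOrderedRing K := .mkOfCone C
  have : IsStrictOrderedRing K := IsOrderedRing.toIsStrictOrderedRing K
  have hord : ∀ x : K, 0 ≤ x ↔ (x : Ω) ∈ cone T' K := by
    intro x
    have : 0 ≤ x ↔ x - 0 ∈ C := Iff.rfl
    rw [this, sub_zero]
    rfl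
  refine ⟨K, inferInstance, inferInstance, inferInstance, algebraMap k K,
    polyIVT hK hord hT', fun t ht => (hord _).2 ?_⟩
  exact mem_cone_of_mem ⟨t, ht, rfl⟩

end Polynomial.RealClosure

/-- A ring with a preordering `T` maps to a real closed field in such a way that `T` becomes
nonnegative. The multiplicative set `1 + T` does not contain `0`; every residue field of the
localization at this set inherits a preordering from `T`. -/
theorem exists_realClosed_of_preordering {A : Type} [CommRing A] (T : Subsemiring A)
    (hsq : ∀ a, a ^ 2 ∈ T) (hneg : (-1 : A) ∉ T) :
    ∃ (R : Type) (_ : Field R) (_ : LinearOrder R) (_ : IsStrictOrderedRing R) (φ : A →+* R),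
      PolyIVT R ∧ ∀ t ∈ T, 0 ≤ φ t := by
  let S : Submonoid A :=
    { carrier := {s | ∃ t ∈ T, s = 1 + t}
      one_mem' := ⟨0, zero_mem T, by simp⟩
      mul_mem' := by
        rintro _ _ ⟨t, ht, rfl⟩ ⟨t', ht', rfl⟩
        exact ⟨t + t' + t * t', add_mem (add_mem ht ht') (mul_mem ht ht'), by ring⟩ }
  have h0 : (0 : A) ∉ S := by
    rintro ⟨t, ht, e⟩
    exact hneg (by rwa [show (-1 : A) = t by linear_combination e])
  have : Nontrivial (Localization S) := by
    refine ⟨0, 1, fun h => ?_⟩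
    obtain ⟨c, hc⟩ := (IsLocalization.eq_iff_exists S (Localization S)
      (x := (0 : A)) (y := 1)).1 (by simpa using h)
    apply h0
    have h1 : (c : A) = 0 := by simpa using hc.symm
    exact h1 ▸ c.2
  obtain ⟨m, hm⟩ := Ideal.exists_maximal (Localization S)
  let _ : Field (Localization S ⧸ m) := Ideal.Quotient.field m
  set ψ : A →+* Localization S ⧸ m := (Ideal.Quotient.mk m).comp (algebraMap A (Localization S))
    with hψ
  have hS : ∀ s ∈ S, ψ s ≠ 0 := fun s hs =>
    ((IsLocalization.map_units (Localization S) ⟨s, hs⟩).map (Ideal.Quotient.mk m)).ne_zero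
  -- elements of the residue field have representatives with denominators in `S`
  have hfrac : ∀ x, ∃ a, ∃ s ∈ S, ψ s * x = ψ a := by
    intro x
    obtain ⟨x, rfl⟩ := Ideal.Quotient.mk_surjective x
    obtain ⟨⟨a, s⟩, h⟩ := IsLocalization.surj S x
    refine ⟨a, s, s.2, ?_⟩
    rw [hψ, RingHom.comp_apply, RingHom.comp_apply, ← map_mul, mul_comm, h]
  -- hence weighted sums of squares there come from `T`, up to the square of a denominator
  have key : ∀ y ∈ AddSubmonoid.closure {y | ∃ t ∈ T.toSubmonoid.map ψ, ∃ x, y = t * x ^ 2},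
      ∃ s ∈ S, ∃ t ∈ T, ψ (s ^ 2) * y = ψ t := by
    intro y hy
    induction hy using AddSubmonoid.closure_induction with
    | zero => exact ⟨1, one_mem S, 0, zero_mem T, by simp⟩
    | add y z _ _ hy hz =>
      obtain ⟨s, hs, t, ht, e⟩ := hy
      obtain ⟨s', hs', t', ht', e'⟩ := hz
      refine ⟨s * s', mul_mem hs hs', s' ^ 2 * t + s ^ 2 * t',
        add_mem (mul_mem (hsq _) ht) (mul_mem (hsq _) ht'), ?_⟩
      rw [map_add, map_mul, map_mul, ← e, ← e', mul_pow, map_mul]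
      ring
    | mem y hy =>
      obtain ⟨_, ⟨t, ht, rfl⟩, x, rfl⟩ := hy
      obtain ⟨a, s, hs, e⟩ := hfrac x
      refine ⟨s, hs, t * a ^ 2, mul_mem ht (hsq a), ?_⟩
      rw [map_mul, map_pow, map_pow, ← e]
      ring
  obtain ⟨R, i₁, i₂, i₃, φ, hR, hφ⟩ := Polynomial.RealClosure.exists_realClosed
    (T.toSubmonoid.map ψ) (by
      intro h
      obtain ⟨s, hs, t, ht, e⟩ := key _ h
      obtain ⟨u, hu, rfl⟩ := hs
      refine hS ((1 + u) ^ 2 + t) ⟨2 * u + u ^ 2 + t, ?_, by ring⟩ ?_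
      · exact add_mem (add_mem (by rw [two_mul]; exact add_mem hu hu) (hsq u)) ht
      · rw [map_add, ← e]; ring)
  exact ⟨R, i₁, i₂, i₃, φ.comp ψ, hR, fun t ht => hφ _ ⟨t, ht, rfl⟩⟩

/-! ### Polynomials over real closed fields -/

namespace Polynomial

variable {R : Type*} [Field R] [LinearOrder R] [IsStrictOrderedRing R]

lemma _root_.PolyIVT.sign_eq (hR : PolyIVT R) {p : R[X]} {a b : R}
    (hab : a ≤ b) (h : ∀ c ∈ Set.Icc a b, p.eval c ≠ 0) :
    SignType.sign (p.eval a) = SignType.sign (p.eval b) := by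
  rcases hab.eq_or_lt with rfl | hab
  · rfl
  have ha := h a ⟨le_rfl, hab.le⟩
  have hb := h b ⟨hab.le, le_rfl⟩
  have hnn : 0 ≤ p.eval a * p.eval b := by
    by_contra hlt
    obtain ⟨c, hc, hc0⟩ := hR p a b hab (not_le.1 hlt)
    exact h c ⟨hc.1.le, hc.2.le⟩ hc0
  rcases lt_or_gt_of_ne ha with ha | ha <;> rcases lt_or_gt_of_ne hb with hb | hb
  · rw [sign_neg ha, sign_neg hb]
  · exact absurd hnn (not_le.2 (mul_neg_of_neg_of_pos ha hb))
  · exact absurd hnn (not_le.2 (mul_neg_of_pos_of_neg ha hb))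
  · rw [sign_pos ha, sign_pos hb]

/-- Rolle's theorem between two consecutive roots. -/
lemma _root_.PolyIVT.rolle_of_consecutive (hR : PolyIVT R) {p : R[X]} {a b : R}
    (hab : a < b) (hp : p ≠ 0) (ha : p.eval a = 0) (hb : p.eval b = 0)
    (h : ∀ c ∈ Set.Ioo a b, p.eval c ≠ 0) :
    ∃ c ∈ Set.Ioo a b, p.derivative.eval c = 0 := by
  obtain ⟨q, hq, hqa⟩ := exists_eq_pow_rootMultiplicity_mul_and_not_dvd p hp a
  have hq0 : q ≠ 0 := by rintro rfl; exact hqa (dvd_zero _)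
  obtain ⟨g, hg, hgb⟩ := exists_eq_pow_rootMultiplicity_mul_and_not_dvd q hq0 b
  rw [dvd_iff_isRoot, IsRoot.def] at hqa hgb
  have hm : rootMultiplicity a p ≠ 0 := by
    rw [← Nat.pos_iff_ne_zero, rootMultiplicity_pos hp]; exact ha
  have hn : rootMultiplicity b q ≠ 0 := by
    rw [← Nat.pos_iff_ne_zero, rootMultiplicity_pos hq0, IsRoot.def]
    have h1 := congrArg (eval b) hq
    rw [hb, eval_mul, eval_pow, eval_sub, eval_X, eval_C] at h1
    exact (mul_eq_zero.1 h1.symm).resolve_left (pow_ne_zero _ (sub_ne_zero.2 hab.ne'))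
  obtain ⟨m, hm'⟩ := Nat.exists_eq_succ_of_ne_zero hm
  obtain ⟨n, hn'⟩ := Nat.exists_eq_succ_of_ne_zero hn
  rw [hm'] at hq
  rw [hn'] at hg
  have hga : g.eval a ≠ 0 := by
    intro h0
    apply hqa
    rw [hg, eval_mul, h0, mul_zero]
  have hgi : ∀ c ∈ Set.Icc a b, g.eval c ≠ 0 := by
    intro c hc h0
    rcases hc.1.eq_or_lt with rfl | h1
    · exact hga h0
    rcases hc.2.eq_or_lt with rfl | h2
    · exact hgb h0
    · exact h c ⟨h1, h2⟩ (by rw [hq, hg, eval_mul, eval_mul, h0, mul_zero, mul_zero])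
  have hsign := hR.sign_eq hab.le hgi
  have hgg : 0 < g.eval a * g.eval b := by
    rcases lt_or_gt_of_ne hga with h1 | h1
    · rw [sign_neg h1] at hsign
      exact mul_pos_of_neg_of_neg h1 (sign_eq_neg_one_iff.1 hsign.symm)
    · rw [sign_pos h1] at hsign
      exact mul_pos h1 (sign_eq_one_iff.1 hsign.symm)
  set u : R[X] := C ((m : R) + 1) * (X - C b) * g + C ((n : R) + 1) * (X - C a) * g +
    (X - C a) * (X - C b) * derivative g with hu
  have hder : derivative p = (X - C a) ^ m * (X - C b) ^ n * u := by
    rw [hq, hg, hu]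
    simp only [derivative_mul, derivative_pow, derivative_sub, derivative_X, derivative_C,
      Nat.succ_eq_add_one, Nat.add_sub_cancel, Nat.cast_add, Nat.cast_one, map_add, map_one,
      map_natCast]
    ring
  obtain ⟨c, hc, hc0⟩ := hR u a b hab (by
    have h1 : u.eval a = -(((m : R) + 1) * (b - a)) * g.eval a := by simp [hu]; ring
    have h2 : u.eval b = ((n : R) + 1) * (b - a) * g.eval b := by simp [hu]
    have h3 : 0 < ((m : R) + 1) * (b - a) * (((n : R) + 1) * (b - a)) := by
      have := sub_pos.2 hab
      positivity
    rw [h1, h2]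
    have := mul_pos h3 hgg
    linarith)
  exact ⟨c, hc, by rw [hder, eval_mul, hc0, mul_zero]⟩

lemma _root_.PolyIVT.rolle (hR : PolyIVT R) {p : R[X]} {a b : R}
    (hab : a < b) (ha : p.eval a = 0) (hb : p.eval b = 0) :
    ∃ c ∈ Set.Ioo a b, p.derivative.eval c = 0 := by
  by_cases hp : p = 0
  · obtain ⟨c, hc⟩ := exists_between hab
    exact ⟨c, hc, by simp [hp]⟩
  classical
  obtain ⟨d, hd, hmin⟩ := Finset.exists_min_image {c ∈ p.roots.toFinset | a < c} id
    ⟨b, by simp [hp, hab, hb]⟩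
  simp only [Finset.mem_filter, Multiset.mem_toFinset, mem_roots hp, IsRoot.def, id] at hd hmin
  obtain ⟨c, hc, hc0⟩ := hR.rolle_of_consecutive hd.2 hp ha hd.1 (fun c hc h0 =>
    absurd (hmin c ⟨h0, hc.1⟩) (not_le.2 hc.2))
  exact ⟨c, ⟨hc.1, hc.2.trans_le (hmin b ⟨hb, hab⟩)⟩, hc0⟩

lemma _root_.PolyIVT.exists_eval_sub (hR : PolyIVT R) (p : R[X]) {a b : R} (hab : a < b) :
    ∃ c ∈ Set.Ioo a b, p.eval b - p.eval a = p.derivative.eval c * (b - a) := by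
  obtain ⟨c, hc, h⟩ := hR.rolle (a := a) (b := b)
    (p := C (b - a) * (p - C (p.eval a)) - C (p.eval b - p.eval a) * (X - C a)) hab
    (by simp) (by simp; ring)
  refine ⟨c, hc, ?_⟩
  simp only [derivative_sub, derivative_mul, derivative_C, derivative_X, eval_sub, eval_mul,
    eval_C, zero_mul, zero_add, sub_zero, mul_one] at h
  linear_combination -h

end Polynomial

/-- The intermediate value property of the field of real numbers. -/
lemma polyIVT_real : PolyIVT ℝ := by
  intro p a b hab h
  rcases mul_neg_iff.1 h with ⟨h1, h2⟩ | ⟨h1, h2⟩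
  · obtain ⟨c, hc, h0⟩ := intermediate_value_Ioo' hab.le p.continuous.continuousOn ⟨h2, h1⟩
    exact ⟨c, hc, h0⟩
  · obtain ⟨c, hc, h0⟩ := intermediate_value_Ioo hab.le p.continuous.continuousOn ⟨h1, h2⟩
    exact ⟨c, hc, h0⟩

/-! ### Transfer of signs between real closed fields -/

set_option linter.unusedSectionVars false

namespace Polynomial.SignTransfer

section Order

variable {R₁ R₂ : Type*} [LinearOrder R₁] [LinearOrder R₂]

/-- `x` lies relative to the first entries of the pairs in `L` as `y` lies relative to the second
entries. -/
def Compat (L : Set (R₁ × R₂)) (x : R₁) (y : R₂) : Prop :=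
  ∀ e ∈ L, (e.1 < x ↔ e.2 < y) ∧ (x < e.1 ↔ y < e.2)

/-- `L` is the graph of an order isomorphism between two subsets. -/
def IsPartialIso (L : Set (R₁ × R₂)) : Prop := ∀ e ∈ L, Compat L e.1 e.2

variable {L : Set (R₁ × R₂)} {x x' : R₁} {y y' : R₂}

lemma Compat.mono {L' : Set (R₁ × R₂)} (hL : L ⊆ L') (h : Compat L' x y) : Compat L x y :=
  fun e he => h e (hL he)

lemma Compat.swap (h : Compat L x y) : Compat (Prod.swap ⁻¹' L) y x :=
  fun _ he => ⟨(h _ he).1.symm, (h _ he).2.symm⟩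

lemma IsPartialIso.swap (h : IsPartialIso L) : IsPartialIso (Prod.swap ⁻¹' L) :=
  fun _ he => (h _ he).swap

lemma Compat.eq_iff (h : Compat L x y) {e : R₁ × R₂} (he : e ∈ L) : e.1 = x ↔ e.2 = y := by
  have := h e he
  rcases lt_trichotomy e.1 x with h1 | h1 | h1 <;> rcases lt_trichotomy e.2 y with h2 | h2 | h2 <;>
    grind

/-- A finite partial isomorphism extends to a further point, as the target is a dense order without
end points. -/
lemma IsPartialIso.exists_compat [DenselyOrdered R₂] [NoMinOrder R₂] [NoMaxOrder R₂]
    [Nonempty R₂] (hL : IsPartialIso L) (hfin : L.Finite) (x : R₁) : ∃ y, Compat L x y := by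
  classical
  by_cases hx : ∃ e ∈ L, e.1 = x
  · obtain ⟨e, he, rfl⟩ := hx
    exact ⟨e.2, hL e he⟩
  push Not at hx
  obtain ⟨y, h1, h2⟩ := Order.exists_between_finsets
    ({e ∈ hfin.toFinset | e.1 < x}.image Prod.snd) ({e ∈ hfin.toFinset | x < e.1}.image Prod.snd)
    (by
      intro a ha b hb
      simp only [Finset.mem_image, Finset.mem_filter, Set.Finite.mem_toFinset] at ha hb
      obtain ⟨e, ⟨he, hex⟩, rfl⟩ := ha
      obtain ⟨e', ⟨he', hex'⟩, rfl⟩ := hb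
      exact ((hL e' he') e he).1.1 (hex.trans hex'))
  refine ⟨y, fun e he => ?_⟩
  have h1' : e.1 < x → e.2 < y := fun h => h1 _ (by
    simp only [Finset.mem_image, Finset.mem_filter, Set.Finite.mem_toFinset]
    exact ⟨e, ⟨he, h⟩, rfl⟩)
  have h2' : x < e.1 → y < e.2 := fun h => h2 _ (by
    simp only [Finset.mem_image, Finset.mem_filter, Set.Finite.mem_toFinset]
    exact ⟨e, ⟨he, h⟩, rfl⟩)
  rcases lt_or_gt_of_ne (hx e he) with h | h
  · exact ⟨⟨h1', fun _ => h⟩, ⟨fun h' => absurd h (not_lt.2 h'.le),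
      fun h' => absurd (h1' h) (not_lt.2 h'.le)⟩⟩
  · exact ⟨⟨fun h' => absurd h (not_lt.2 h'.le), fun h' => absurd (h2' h) (not_lt.2 h'.le)⟩,
      ⟨h2', fun _ => h⟩⟩

/-- The points `x` and `x'` lie in the same position relative to the first entries of `L`. -/
def SameGap (L : Set (R₁ × R₂)) (x x' : R₁) : Prop :=
  ∀ e ∈ L, (e.1 < x ↔ e.1 < x') ∧ (x < e.1 ↔ x' < e.1)

lemma SameGap.compat (h : SameGap L x x') (hx : Compat L x y) : Compat L x' y :=
  fun e he => ⟨(h e he).1.symm.trans (hx e he).1, (h e he).2.symm.trans (hx e he).2⟩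

lemma SameGap.symm (h : SameGap L x x') : SameGap L x' x :=
  fun e he => ⟨(h e he).1.symm, (h e he).2.symm⟩

lemma Compat.sameGap (h : Compat L x y) (h' : Compat L x' y) : SameGap L x x' :=
  fun e he => ⟨(h e he).1.trans (h' e he).1.symm, (h e he).2.trans (h' e he).2.symm⟩

lemma SameGap.of_between (h : SameGap L x x') {c : R₁} (h1 : x < c) (h2 : c < x') :
    SameGap L x c := by
  intro e he
  have := h e he
  grind

end Order

section Insert

variable {R₁ R₂ : Type*} [Field R₁] [LinearOrder R₁] [IsStrictOrderedRing R₁]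
  [Field R₂] [LinearOrder R₂] [IsStrictOrderedRing R₂]

open SignType

/-- A pair of polynomials over two ordered fields whose derivatives have the same signs at
corresponding points, and that have the same signs at the points of `L` and near infinity. -/
structure SignData (L : Set (R₁ × R₂)) (p₁ : R₁[X]) (p₂ : R₂[X]) : Prop where
  finite : L.Finite
  iso : IsPartialIso L
  der : ∀ x y, Compat L x y →
    sign (p₁.derivative.eval x) = sign (p₂.derivative.eval y)
  val : ∀ e ∈ L, sign (p₁.eval e.1) = sign (p₂.eval e.2)
  der_ne₁ : p₁.derivative ≠ 0
  der_ne₂ : p₂.derivative ≠ 0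
  low : ∃ l ∈ L, ∀ x y, x ≤ l.1 → y ≤ l.2 →
    p₁.eval x ≠ 0 ∧ p₂.eval y ≠ 0 ∧ sign (p₁.eval x) = sign (p₂.eval y)
  high : ∃ u ∈ L, ∀ x y, u.1 ≤ x → u.2 ≤ y →
    p₁.eval x ≠ 0 ∧ p₂.eval y ≠ 0 ∧ sign (p₁.eval x) = sign (p₂.eval y)

variable {L : Set (R₁ × R₂)} {p₁ : R₁[X]} {p₂ : R₂[X]}

lemma SignData.swap (h : SignData L p₁ p₂) : SignData (Prod.swap ⁻¹' L) p₂ p₁ where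
  finite := h.finite.preimage Prod.swap_injective.injOn
  iso := h.iso.swap
  der y x hyx := (h.der x y hyx.swap).symm
  val e he := (h.val _ he).symm
  der_ne₁ := h.der_ne₂
  der_ne₂ := h.der_ne₁
  low := by
    obtain ⟨l, hl, H⟩ := h.low
    exact ⟨l.swap, hl, fun y x hy hx =>
      ⟨(H x y hx hy).2.1, (H x y hx hy).1, (H x y hx hy).2.2.symm⟩⟩
  high := by
    obtain ⟨l, hl, H⟩ := h.high
    exact ⟨l.swap, hl, fun y x hy hx =>
      ⟨(H x y hx hy).2.1, (H x y hx hy).1, (H x y hx hy).2.2.symm⟩⟩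

lemma SignData.sign_der_eq (h : SignData L p₁ p₂) {x x' : R₁} (hx : SameGap L x x') :
    sign (p₁.derivative.eval x) = sign (p₁.derivative.eval x') := by
  obtain ⟨y, hy⟩ := h.iso.exists_compat h.finite x
  rw [h.der x y hy, h.der x' y (hx.compat hy)]

lemma SignData.der_ne_zero_of_sameGap (h : SignData L p₁ p₂) {x x' : R₁} (hlt : x < x')
    (hx : SameGap L x x') : p₁.derivative.eval x ≠ 0 := by
  intro h0
  refine h.der_ne₁ (Polynomial.eq_zero_of_infinite_isRoot _ ((Set.Ioo_infinite hlt).mono ?_))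
  intro c hc
  have := h.sign_der_eq (hx.of_between hc.1 hc.2)
  rw [h0, sign_zero] at this
  exact sign_eq_zero_iff.1 this.symm

lemma SignData.root_unique (h : SignData L p₁ p₂) (hR : PolyIVT R₁) {x x' : R₁}
    (hx : SameGap L x x') (h1 : p₁.eval x = 0) (h2 : p₁.eval x' = 0) : x = x' := by
  by_contra hne
  wlog hlt : x < x' generalizing x x'
  · exact this hx.symm h2 h1 (Ne.symm hne) (lt_of_le_of_ne (not_lt.1 hlt) (Ne.symm hne))
  obtain ⟨c, hc, hc0⟩ := hR.rolle hlt h1 h2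
  refine h.der_ne_zero_of_sameGap hlt hx ?_
  rw [← sign_eq_zero_iff, h.sign_der_eq (hx.of_between hc.1 hc.2), hc0, sign_zero]

/-- A root of the first polynomial has a counterpart among the roots of the second one: between
two consecutive points of `L` both polynomials are monotone, and their signs at these points
agree. -/
lemma SignData.exists_root (h : SignData L p₁ p₂) (hR₁ : PolyIVT R₁) (hR₂ : PolyIVT R₂)
    {x : R₁} (hx : p₁.eval x = 0) : ∃ y, Compat L x y ∧ p₂.eval y = 0 := by
  by_cases hxL : ∃ e ∈ L, e.1 = x
  · obtain ⟨e, he, rfl⟩ := hxL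
    refine ⟨e.2, h.iso e he, ?_⟩
    rw [← sign_eq_zero_iff, ← h.val e he, hx, sign_zero]
  push Not at hxL
  obtain ⟨l, hl, hlow⟩ := h.low
  obtain ⟨u, hu, hhigh⟩ := h.high
  have hlx : l.1 < x := by
    by_contra hc
    exact (hlow x l.2 (not_lt.1 hc) le_rfl).1 hx
  have hux : x < u.1 := by
    by_contra hc
    exact (hhigh x u.2 (not_lt.1 hc) le_rfl).1 hx
  -- `a` and `b` are the ends of the gap of `L` that contains `x`
  obtain ⟨a, ⟨haL, hax⟩, hamax⟩ := Set.exists_max_image {e ∈ L | e.1 < x} Prod.fst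
    (h.finite.subset (Set.sep_subset _ _)) ⟨l, hl, hlx⟩
  obtain ⟨b, ⟨hbL, hbx⟩, hbmin⟩ := Set.exists_min_image {e ∈ L | x < e.1} Prod.fst
    (h.finite.subset (Set.sep_subset _ _)) ⟨u, hu, hux⟩
  have hgap : ∀ c, a.1 < c → c < b.1 → SameGap L x c := by
    intro c h1 h2 e he
    rcases lt_or_gt_of_ne (hxL e he) with h3 | h3
    · have := hamax e ⟨he, h3⟩
      grind
    · have := hbmin e ⟨he, h3⟩
      grind
  -- by the mean value theorem, `p₁` has opposite signs at the two ends; hence so has `p₂`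
  obtain ⟨c, hc, hc1⟩ := hR₁.exists_eval_sub p₁ hax
  obtain ⟨d, hd, hd1⟩ := hR₁.exists_eval_sub p₁ hbx
  rw [hx] at hc1 hd1
  have hca := h.sign_der_eq (hgap c hc.1 (hc.2.trans hbx))
  have hdb := h.sign_der_eq (hgap d (hax.trans hd.1) hd.2)
  have hne : p₁.derivative.eval x ≠ 0 :=
    h.der_ne_zero_of_sameGap hd.1 (hgap d (hax.trans hd.1) hd.2)
  have hsa : sign (p₁.eval a.1) = -sign (p₁.derivative.eval x) := by
    rw [show p₁.eval a.1 = -(p₁.derivative.eval c * (x - a.1)) by linear_combination -hc1,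
      Left.sign_neg, sign_mul, sign_pos (sub_pos.2 hax), mul_one, hca]
  have hsb : sign (p₁.eval b.1) = sign (p₁.derivative.eval x) := by
    rw [show p₁.eval b.1 = p₁.derivative.eval d * (b.1 - x) by linear_combination hd1,
      sign_mul, sign_pos (sub_pos.2 hbx), mul_one, hdb]
  rw [h.val a haL] at hsa
  rw [h.val b hbL] at hsb
  have hab : a.2 < b.2 := (h.iso b hbL a haL).1.1 (hax.trans hbx)
  obtain ⟨y, hy, hy0⟩ := hR₂ p₂ a.2 b.2 hab (by
    rw [← sign_eq_neg_one_iff, sign_mul, hsa, hsb]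
    rcases lt_or_gt_of_ne hne with h1 | h1
    · rw [sign_neg h1]; rfl
    · rw [sign_pos h1]; rfl)
  refine ⟨y, fun e he => ?_, hy0⟩
  have h1 := h.iso a haL e he
  have h2 := h.iso b hbL e he
  rcases lt_or_gt_of_ne (hxL e he) with h3 | h3
  · have := hamax e ⟨he, h3⟩
    grind
  · have := hbmin e ⟨he, h3⟩
    grind

/-- The set `L`, enlarged by the pairs of corresponding roots of two polynomials. -/
def insertRoots (L : Set (R₁ × R₂)) (p₁ : R₁[X]) (p₂ : R₂[X]) : Set (R₁ × R₂) :=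
  L ∪ {e | p₁.eval e.1 = 0 ∧ p₂.eval e.2 = 0 ∧ Compat L e.1 e.2}

lemma SignData.finite_insertRoots (h : SignData L p₁ p₂) : (insertRoots L p₁ p₂).Finite := by
  have h1 : p₁ ≠ 0 := by rintro rfl; exact h.der_ne₁ derivative_zero
  have h2 : p₂ ≠ 0 := by rintro rfl; exact h.der_ne₂ derivative_zero
  refine h.finite.union (((finite_setOfPred_isRoot h1).prod (finite_setOfPred_isRoot h2)).subset ?_)
  exact fun e he => ⟨he.1, he.2.1⟩

lemma SignData.isPartialIso_insertRoots (h : SignData L p₁ p₂) (hR₁ : PolyIVT R₁)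
    (hR₂ : PolyIVT R₂) : IsPartialIso (insertRoots L p₁ p₂) := by
  rintro e (he | ⟨he1, he2, hec⟩) e' (he' | ⟨he1', he2', hec'⟩)
  · exact h.iso e he e' he'
  · have := hec' e he
    exact ⟨this.2.symm.symm, this.1⟩
  · exact hec e' he'
  · by_cases hgap : SameGap L e.1 e'.1
    · have e1 := h.root_unique hR₁ hgap he1 he1'
      have hgap' : SameGap (Prod.swap ⁻¹' L) e.2 e'.2 :=
        hec.swap.sameGap (hgap.symm.compat hec').swap
      have e2 := h.swap.root_unique hR₂ hgap' he2 he2'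
      simp [e1, e2]
    · unfold SameGap at hgap
      push Not at hgap
      obtain ⟨a, ha, hsep⟩ := hgap
      have h1 := hec a ha
      have h2 := hec' a ha
      grind

/-- The sign of a polynomial on a gap without roots is its sign at the left end point `a` of the
gap or, if `a` is a root, the sign of its derivative on the gap. -/
lemma SignData.sign_eq_of_lower (h : SignData L p₁ p₂) (hR : PolyIVT R₁) {a x : R₁} (hax : a < x)
    (hgap : ∀ c, a < c → c < x → SameGap L x c) (hroot : ∀ c, a < c → c ≤ x → p₁.eval c ≠ 0) :
    sign (p₁.eval x) =
      if sign (p₁.eval a) = 0 then sign (p₁.derivative.eval x) else sign (p₁.eval a) := by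
  split_ifs with h0
  · rw [sign_eq_zero_iff] at h0
    obtain ⟨c, hc, hc1⟩ := hR.exists_eval_sub p₁ hax
    rw [h0, sub_zero] at hc1
    rw [hc1, sign_mul, sign_pos (sub_pos.2 hax), mul_one, h.sign_der_eq (hgap c hc.1 hc.2)]
  · refine (hR.sign_eq hax.le fun c hc => ?_).symm
    rcases hc.1.eq_or_lt with rfl | h1
    · rwa [ne_eq, ← sign_eq_zero_iff]
    · exact hroot c h1 hc.2

/-- After the roots have been inserted, the signs of the two polynomials agree at all
corresponding points. -/
lemma SignData.sign_eq (h : SignData L p₁ p₂) (hR₁ : PolyIVT R₁) (hR₂ : PolyIVT R₂) {x : R₁}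
    {y : R₂} (hxy : Compat (insertRoots L p₁ p₂) x y) : sign (p₁.eval x) = sign (p₂.eval y) := by
  have hsub : L ⊆ insertRoots L p₁ p₂ := Set.subset_union_left
  have hxyL := hxy.mono hsub
  -- every root of either polynomial occurs in the enlarged set
  have hr1 : ∀ c, p₁.eval c = 0 → ∃ d, (c, d) ∈ insertRoots L p₁ p₂ := by
    intro c hc
    obtain ⟨d, hd, hd0⟩ := h.exists_root hR₁ hR₂ hc
    exact ⟨d, .inr ⟨hc, hd0, hd⟩⟩
  have hr2 : ∀ d, p₂.eval d = 0 → ∃ c, (c, d) ∈ insertRoots L p₁ p₂ := by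
    intro d hd
    obtain ⟨c, hc, hc0⟩ := h.swap.exists_root hR₂ hR₁ hd
    exact ⟨c, .inr ⟨hc0, hd, hc.swap⟩⟩
  have hval : ∀ e ∈ insertRoots L p₁ p₂, sign (p₁.eval e.1) = sign (p₂.eval e.2) := by
    rintro e (he | ⟨h1, h2, -⟩)
    · exact h.val e he
    · rw [h1, h2, sign_zero, sign_zero]
  by_cases hmem : ∃ e ∈ insertRoots L p₁ p₂, e.1 = x
  · obtain ⟨e, he, rfl⟩ := hmem
    rw [hval e he, (hxy.eq_iff he).1 rfl]
  push Not at hmem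
  obtain ⟨l, hl, hlow⟩ := h.low
  rcases le_or_gt x l.1 with hxl | hxl
  · exact (hlow x y hxl (not_lt.1 fun h' => absurd ((hxyL l hl).1.2 h') (not_lt.2 hxl))).2.2
  -- the signs at `x` and `y` are read off at the largest point `a` below them
  obtain ⟨a, ⟨haL, hax⟩, hamax⟩ := Set.exists_max_image {e ∈ insertRoots L p₁ p₂ | e.1 < x}
    Prod.fst (h.finite_insertRoots.subset (Set.sep_subset _ _)) ⟨l, hsub hl, hxl⟩
  have hay : a.2 < y := (hxy a haL).1.1 hax
  have hiso := h.isPartialIso_insertRoots hR₁ hR₂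
  have hno1 : ∀ e ∈ insertRoots L p₁ p₂, e.1 ≤ a.1 ∨ x < e.1 := by
    intro e he
    rcases lt_or_gt_of_ne (hmem e he) with h1 | h1
    · exact .inl (hamax e ⟨he, h1⟩)
    · exact .inr h1
  have hno2 : ∀ e ∈ insertRoots L p₁ p₂, e.2 ≤ a.2 ∨ y < e.2 := by
    intro e he
    rcases hno1 e he with h1 | h1
    · exact .inl (not_lt.1 fun h' => absurd ((hiso e he a haL).1.2 h') (not_lt.2 h1))
    · exact .inr ((hxy e he).2.1 h1)
  rw [h.sign_eq_of_lower hR₁ hax, h.swap.sign_eq_of_lower hR₂ hay, hval a haL, h.der x y hxyL]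
  · intro c h1 h2 e he
    have := hno2 _ (hsub he)
    simp only [Prod.snd_swap] at this
    grind
  · intro c h1 h2 h0
    obtain ⟨d, hd⟩ := hr2 c h0
    have := hno2 _ hd
    grind
  · intro c h1 h2 e he
    have := hno1 _ (hsub he)
    grind
  · intro c h1 h2 h0
    obtain ⟨d, hd⟩ := hr1 c h0
    have := hno1 _ hd
    grind

end Insert

end Polynomial.SignTransfer

set_option linter.unusedSectionVars false

namespace Polynomial.SignTransfer

open SignType

section Closure

/-- A finite set has a finite superset that is closed under operations that decrease a
size function. -/
lemma exists_finset_closed {α : Type*} [DecidableEq α] (sz : α → ℕ) (o : α → α → Finset α)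
    (h : ∀ p q, ∀ r ∈ o p q, sz r < sz p ∧ sz r < sz q) (Q : Finset α) :
    ∃ Q' : Finset α, Q ⊆ Q' ∧ ∀ p ∈ Q', ∀ q ∈ Q', o p q ⊆ Q' := by
  -- the closure under the results of size at least `d - j`, by induction on `j`
  set d := Q.sup sz
  have H : ∀ j : ℕ, ∃ Q' : Finset α, Q ⊆ Q' ∧ (∀ p ∈ Q', sz p ≤ d) ∧
      ∀ p ∈ Q', ∀ q ∈ Q', ∀ r ∈ o p q, d ≤ sz r + j → r ∈ Q' := by
    intro j
    induction j with
    | zero =>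
      refine ⟨Q, subset_rfl, fun p hp => Finset.le_sup hp, fun p hp q hq r hr hd => ?_⟩
      have := (h p q r hr).1
      have : sz p ≤ d := Finset.le_sup hp
      omega
    | succ j ih =>
      obtain ⟨Q', hQ, hd, hcl⟩ := ih
      have hmem : ∀ p ∈ Q' ∪ Q'.biUnion (fun p => Q'.biUnion (o p)), d ≤ sz p + j → p ∈ Q' := by
        intro p hp hpd
        rcases Finset.mem_union.1 hp with hp | hp
        · exact hp
        · obtain ⟨a, ha, hp⟩ := Finset.mem_biUnion.1 hp
          obtain ⟨b, hb, hp⟩ := Finset.mem_biUnion.1 hp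
          exact hcl a ha b hb p hp hpd
      refine ⟨Q' ∪ Q'.biUnion (fun p => Q'.biUnion (o p)), hQ.trans Finset.subset_union_left,
        fun p hp => ?_, fun p hp q hq r hr hrd => ?_⟩
      · rcases Finset.mem_union.1 hp with hp | hp
        · exact hd p hp
        · obtain ⟨a, ha, hp⟩ := Finset.mem_biUnion.1 hp
          obtain ⟨b, hb, hp⟩ := Finset.mem_biUnion.1 hp
          exact (h a b p hp).1.le.trans (hd a ha)
      · obtain ⟨h1, h2⟩ := h p q r hr
        exact Finset.mem_union_right _ (Finset.mem_biUnion.2 ⟨p, hmem p hp (by omega),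
          Finset.mem_biUnion.2 ⟨q, hmem q hq (by omega), hr⟩⟩)
  obtain ⟨Q', hQ, -, hcl⟩ := H d
  exact ⟨Q', hQ, fun p hp q hq r hr => hcl p hp q hq r hr (by omega)⟩

variable {B : Type*} [CommRing B] [IsDomain B]

/-- Division with remainder after multiplication with a power of the leading coefficient. -/
lemma exists_pseudoRemainder (p : B[X]) {q : B[X]} (hq : q ≠ 0) :
    ∃ r : B[X], r.degree < q.degree ∧
      ∃ (k : ℕ) (u : B[X]), C q.leadingCoeff ^ k * p = q * u + r := by
  suffices H : ∀ (n : ℕ) (p : B[X]), p.degree < n → ∃ r : B[X], r.degree < q.degree ∧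
      ∃ (k : ℕ) (u : B[X]), C q.leadingCoeff ^ k * p = q * u + r from
    H (p.natDegree + 1) p (degree_le_natDegree.trans_lt (by exact_mod_cast Nat.lt_succ_self _))
  intro n
  induction n with
  | zero =>
    intro p hp
    have : p = 0 := by simpa using hp
    exact ⟨0, by simpa [bot_lt_iff_ne_bot] using hq, 0, 0, by simp [this]⟩
  | succ n ih =>
    intro p hp
    by_cases hpq : p.degree < q.degree
    · exact ⟨p, hpq, 0, 0, by simp⟩
    have hp0 : p ≠ 0 := by
      rintro rfl
      exact hpq (by simpa [bot_lt_iff_ne_bot] using hq)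
    have hlp : p.leadingCoeff ≠ 0 := leadingCoeff_ne_zero.2 hp0
    have hlq : q.leadingCoeff ≠ 0 := leadingCoeff_ne_zero.2 hq
    have hle : q.natDegree ≤ p.natDegree := natDegree_le_natDegree (not_lt.1 hpq)
    set m := C p.leadingCoeff * X ^ (p.natDegree - q.natDegree) * q with hm
    have hd1 : (C q.leadingCoeff * p).degree = p.degree := degree_C_mul hlq
    have hd2 : m.degree = p.degree := by
      rw [hm, degree_mul, degree_C_mul_X_pow _ hlp, degree_eq_natDegree hq,
        degree_eq_natDegree hp0]
      exact_mod_cast Nat.sub_add_cancel hle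
    have hlt : (C q.leadingCoeff * p - m).degree < p.degree := by
      rw [← hd1]
      refine degree_sub_lt_left (hd1.trans hd2.symm) (mul_ne_zero (C_ne_zero.2 hlq) hp0) ?_
      rw [hm]
      simp only [leadingCoeff_mul, leadingCoeff_C, leadingCoeff_X_pow]
      ring
    obtain ⟨r, hr, k, u, e⟩ := ih (C q.leadingCoeff * p - m) (by
      have h1 : p.degree ≤ n := by
        rw [degree_eq_natDegree hp0] at hp ⊢
        exact_mod_cast Nat.lt_succ_iff.1 (by exact_mod_cast hp)
      exact hlt.trans_le h1)
    refine ⟨r, hr, k + 1, u + C q.leadingCoeff ^ k * C p.leadingCoeff *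
      X ^ (p.natDegree - q.natDegree), ?_⟩
    rw [hm] at e
    linear_combination e

/-- Every finite set of polynomials lies in a finite set that is closed under differentiation,
deletion of the leading term, and division with remainder. -/
lemma exists_closed (Q : Finset B[X]) : ∃ Q' : Finset B[X], Q ⊆ Q' ∧ 0 ∈ Q' ∧
    (∀ p ∈ Q', derivative p ∈ Q') ∧ (∀ p ∈ Q', p.eraseLead ∈ Q') ∧
    ∀ p ∈ Q', ∀ q ∈ Q', q ≠ 0 → q.natDegree ≤ p.natDegree → ∃ r ∈ Q', r.degree < q.degree ∧
      ∃ (k : ℕ) (u : B[X]), C q.leadingCoeff ^ k * p = q * u + r := by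
  classical
  choose! rem hrem using fun (q : B[X]) (hq : q ≠ 0) (p : B[X]) => exists_pseudoRemainder p hq
  let sz : B[X] → ℕ := fun p => if p = 0 then 0 else p.natDegree + 1
  have hsz : ∀ p q : B[X], q ≠ 0 → p.degree < q.degree → sz p < sz q := by
    intro p q hq hpq
    by_cases hp : p = 0
    · simp [sz, hp, hq]
    · have := natDegree_lt_natDegree hp hpq
      simp [sz, hp, hq, this]
  -- the condition on the size selects the results that are smaller than both arguments
  obtain ⟨Q', hQ, hcl⟩ := exists_finset_closed sz
    (fun p q => ({derivative p, p.eraseLead, rem q p} : Finset B[X]).filter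
      (fun r => sz r < sz p ∧ sz r < sz q)) (fun p q r hr => (Finset.mem_filter.1 hr).2)
    (insert 0 Q)
  have h0 : (0 : B[X]) ∈ Q' := hQ (Finset.mem_insert_self _ _)
  refine ⟨Q', (Finset.subset_insert _ _).trans hQ, h0, fun p hp => ?_, fun p hp => ?_,
    fun p hp q hq hq0 hqp => ?_⟩
  · by_cases hp0 : p = 0
    · simpa [hp0] using h0
    · have := hsz _ p hp0 (degree_derivative_lt hp0)
      exact hcl p hp p hp (by simp [this])
  · by_cases hp0 : p = 0
    · simpa [hp0] using h0
    · have := hsz _ p hp0 (degree_eraseLead_lt hp0)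
      exact hcl p hp p hp (by simp [this])
  · obtain ⟨hd, hk⟩ := hrem q hq0 p
    refine ⟨rem q p, ?_, hd, hk⟩
    by_cases hp0 : p = 0
    · have h1 : q.natDegree = 0 := by simpa [hp0] using hqp
      have h2 : rem q p = 0 := by
        rw [degree_eq_natDegree hq0, h1] at hd
        simpa using hd
      rwa [h2]
    · have h1 := hsz _ q hq0 hd
      have h2 : sz q ≤ sz p := by simp [sz, hp0, hq0, hqp]
      exact hcl p hp q hq (by simp [h1, h1.trans_le h2])

end Closure

section Infinity

variable {R : Type*} [Field R] [LinearOrder R] [IsStrictOrderedRing R]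

lemma exists_half_coeff_le_eval (n : ℕ) (p : R[X]) (hn : p.natDegree ≤ n) (hp : 0 < p.coeff n) :
    ∃ M, ∀ x, M ≤ x → p.coeff n / 2 ≤ p.eval x := by
  induction n generalizing p with
  | zero =>
    refine ⟨0, fun x _ => ?_⟩
    rw [eq_C_of_natDegree_le_zero hn, eval_C, coeff_C_zero]
    linarith
  | succ n ih =>
    obtain ⟨M, hM⟩ := ih p.divX (by rw [natDegree_divX_eq_natDegree_tsub_one]; omega)
      (by rwa [coeff_divX])
    rw [coeff_divX] at hM
    set c := p.coeff (n + 1)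
    refine ⟨max M (1 + 2 * |p.coeff 0| / c), fun x hx => ?_⟩
    have h1 := hM x ((le_max_left _ _).trans hx)
    have h2 : 1 + 2 * |p.coeff 0| / c ≤ x := (le_max_right _ _).trans hx
    have h3 : 0 ≤ 2 * |p.coeff 0| / c := by positivity
    have h4 : p.eval x = p.divX.eval x * x + p.coeff 0 := by
      conv_lhs => rw [← divX_mul_X_add p]
      simp
    have h5 : c / 2 * (1 + 2 * |p.coeff 0| / c) ≤ p.divX.eval x * x :=
      mul_le_mul h1 h2 (by linarith) (by linarith)
    have h6 : c / 2 * (1 + 2 * |p.coeff 0| / c) = c / 2 + |p.coeff 0| := by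
      field_simp
    rw [h4]
    linarith [neg_abs_le (p.coeff 0)]

lemma exists_sign_eval_eq (p : R[X]) :
    ∃ M, ∀ x, M ≤ x → sign (p.eval x) = sign p.leadingCoeff := by
  rcases lt_trichotomy p.leadingCoeff 0 with h | h | h
  · obtain ⟨M, hM⟩ := exists_half_coeff_le_eval (-p).natDegree (-p) le_rfl (by
      rw [coeff_natDegree, leadingCoeff_neg]; linarith)
    refine ⟨M, fun x hx => ?_⟩
    have := hM x hx
    rw [coeff_natDegree, leadingCoeff_neg, eval_neg] at this
    rw [sign_neg h, sign_neg (by linarith)]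
  · exact ⟨0, fun x _ => by rw [h, leadingCoeff_eq_zero.1 h, eval_zero]⟩
  · obtain ⟨M, hM⟩ := exists_half_coeff_le_eval p.natDegree p le_rfl (by
      rwa [coeff_natDegree])
    refine ⟨M, fun x hx => ?_⟩
    have := hM x hx
    rw [coeff_natDegree] at this
    rw [sign_pos h, sign_pos (by linarith)]

/-- Beyond a common bound, the signs of finitely many polynomials are those of their leading
terms. -/
lemma exists_sign_bound {ι : Type*} (s : Finset ι) (p : ι → R[X]) :
    ∃ M, 0 < M ∧ ∀ i ∈ s, (∀ x, M ≤ x → sign ((p i).eval x) = sign (p i).leadingCoeff) ∧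
      ∀ x, x ≤ -M → sign ((p i).eval x) = sign ((-1) ^ (p i).natDegree * (p i).leadingCoeff) := by
  classical
  choose M hM using fun i => exists_sign_eval_eq (p i)
  choose M' hM' using fun i => exists_sign_eval_eq ((p i).comp (-X))
  obtain ⟨B, hB⟩ := (s.image M ∪ s.image M' ∪ {1}).exists_le
  refine ⟨B, lt_of_lt_of_le one_pos (hB 1 (by simp)), fun i hi => ⟨fun x hx => hM i x
    ((hB _ (by simp only [Finset.mem_union, Finset.mem_image]
               exact .inl (.inl ⟨i, hi, rfl⟩))).trans hx),
    fun x hx => ?_⟩⟩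
  have h1 : M' i ≤ B :=
    hB _ (by simp only [Finset.mem_union, Finset.mem_image]; exact .inl (.inr ⟨i, hi, rfl⟩))
  have h2 := hM' i (-x) (by linarith)
  rw [eval_comp, eval_neg, eval_X, neg_neg] at h2
  rw [h2, leadingCoeff_comp (by simp), leadingCoeff_neg, leadingCoeff_X, mul_comm]

end Infinity

section Univariate

variable {B : Type*} [CommRing B] [IsDomain B]
  {R₁ R₂ : Type*} [Field R₁] [LinearOrder R₁] [IsStrictOrderedRing R₁]
  [Field R₂] [LinearOrder R₂] [IsStrictOrderedRing R₂] {φ₁ : B →+* R₁} {φ₂ : B →+* R₂}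

lemma eq_zero_iff_of_sign_eq {a : R₁} {b : R₂} (h : sign a = sign b) : a = 0 ↔ b = 0 := by
  rw [← sign_eq_zero_iff, h, sign_eq_zero_iff]

lemma map_eraseLead_eq {R : Type*} [Field R] {φ : B →+* R} {q : B[X]}
    (h : φ q.leadingCoeff = 0) : q.eraseLead.map φ = q.map φ := by
  conv_rhs => rw [← eraseLead_add_monomial_natDegree_leadingCoeff q]
  rw [Polynomial.map_add, map_monomial, h, map_zero, add_zero]

/-- A polynomial may be replaced by one whose leading coefficient does not vanish under the given
homomorphisms. -/
lemma exists_leadingCoeff_ne_zero {Q : Finset B[X]}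
    (hsign : ∀ p ∈ Q, ∀ i, sign (φ₁ (p.coeff i)) = sign (φ₂ (p.coeff i)))
    (herase : ∀ p ∈ Q, p.eraseLead ∈ Q) (q : B[X]) (hq : q ∈ Q) (h0 : q.map φ₁ ≠ 0) :
    ∃ q' ∈ Q, q'.natDegree ≤ q.natDegree ∧ φ₁ q'.leadingCoeff ≠ 0 ∧
      q'.map φ₁ = q.map φ₁ ∧ q'.map φ₂ = q.map φ₂ := by
  induction hn : q.support.card using Nat.strong_induction_on generalizing q with
  | _ n ih =>
    by_cases hlc : φ₁ q.leadingCoeff = 0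
    · have hlc2 : φ₂ q.leadingCoeff = 0 :=
        (eq_zero_iff_of_sign_eq (hsign q hq q.natDegree)).1 hlc
      have hq0 : q ≠ 0 := by rintro rfl; simp at h0
      obtain ⟨q', h1, h2, h3, h4, h5⟩ := ih _ (hn ▸ eraseLead_support_card_lt hq0) q.eraseLead
        (herase q hq) (by rwa [map_eraseLead_eq hlc]) rfl
      exact ⟨q', h1, h2.trans ((eraseLead_natDegree_le _).trans (Nat.sub_le _ _)), h3,
        h4.trans (map_eraseLead_eq hlc), h5.trans (map_eraseLead_eq hlc2)⟩
    · exact ⟨q, hq, le_rfl, hlc, rfl, rfl⟩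

/-- Corresponding points for a finite family `s` of polynomials: every point of `L` is one of
the two outermost points `l`, `u` or a common root of the two images of some `q ∈ s`. -/
structure SignTable (s : Finset B[X]) (φ₁ : B →+* R₁) (φ₂ : B →+* R₂) (l u : R₁ × R₂)
    (L : Set (R₁ × R₂)) : Prop where
  finite : L.Finite
  iso : IsPartialIso L
  low : l ∈ L
  high : u ∈ L
  sign_eq : ∀ p ∈ s, ∀ x y, Compat L x y → sign ((p.map φ₁).eval x) = sign ((p.map φ₂).eval y)
  root : ∀ e ∈ L, e = l ∨ e = u ∨ ∃ q ∈ s, q.map φ₁ ≠ 0 ∧ (q.map φ₁).eval e.1 = 0 ∧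
    (q.map φ₂).eval e.2 = 0

/-- The induction step: a further polynomial `p` is added to a family that contains the
derivative of `p` and its remainders modulo the polynomials in the family. -/
lemma SignTable.insert [DecidableEq B[X]] (hR₁ : PolyIVT R₁) (hR₂ : PolyIVT R₂) {Q s : Finset B[X]}
    {l u : R₁ × R₂} {L : Set (R₁ × R₂)} (T : SignTable s φ₁ φ₂ l u L) {p : B[X]} (hp : p ∈ Q)
    (hsQ : s ⊆ Q) (hmax : ∀ q ∈ s, q.natDegree ≤ p.natDegree)
    (hdown : ∀ q ∈ Q, q.natDegree < p.natDegree → q ∈ s)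
    (hsign : ∀ p ∈ Q, ∀ i, sign (φ₁ (p.coeff i)) = sign (φ₂ (p.coeff i)))
    (hder : ∀ p ∈ Q, derivative p ∈ Q) (herase : ∀ p ∈ Q, p.eraseLead ∈ Q)
    (hrem : ∀ p ∈ Q, ∀ q ∈ Q, q ≠ 0 → q.natDegree ≤ p.natDegree → ∃ r ∈ Q,
      r.degree < q.degree ∧ ∃ (k : ℕ) (u : B[X]), C q.leadingCoeff ^ k * p = q * u + r)
    (hlow : ∀ x y, x ≤ l.1 → y ≤ l.2 → sign ((p.map φ₁).eval x) = sign ((p.map φ₂).eval y) ∧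
      (p.map φ₁ ≠ 0 → (p.map φ₁).eval x ≠ 0))
    (hhigh : ∀ x y, u.1 ≤ x → u.2 ≤ y → sign ((p.map φ₁).eval x) = sign ((p.map φ₂).eval y) ∧
      (p.map φ₁ ≠ 0 → (p.map φ₁).eval x ≠ 0)) :
    ∃ L', SignTable (Insert.insert p s) φ₁ φ₂ l u L' := by
  have hroot' : ∀ {L' : Set (R₁ × R₂)}, (∀ e ∈ L', e = l ∨ e = u ∨ ∃ q ∈ s, q.map φ₁ ≠ 0 ∧
      (q.map φ₁).eval e.1 = 0 ∧ (q.map φ₂).eval e.2 = 0) → ∀ e ∈ L', e = l ∨ e = u ∨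
      ∃ q ∈ Insert.insert p s, q.map φ₁ ≠ 0 ∧ (q.map φ₁).eval e.1 = 0 ∧
        (q.map φ₂).eval e.2 = 0 := by
    intro L' h e he
    rcases h e he with h | h | ⟨q, hq, h⟩
    · exact .inl h
    · exact .inr (.inl h)
    · exact .inr (.inr ⟨q, Finset.mem_insert_of_mem hq, h⟩)
  have hsame : (∀ x y, Compat L x y → sign ((p.map φ₁).eval x) = sign ((p.map φ₂).eval y)) →
      ∃ L', SignTable (Insert.insert p s) φ₁ φ₂ l u L' := fun h => ⟨L, T.finite, T.iso, T.low,
    T.high, fun q hq => (Finset.mem_insert.1 hq).elim (fun e => e ▸ h) (T.sign_eq q),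
    hroot' T.root⟩
  by_cases hlc : φ₁ p.leadingCoeff = 0
  · -- the leading coefficient vanishes, so that `p` agrees with a polynomial of lower degree
    have hlc2 : φ₂ p.leadingCoeff = 0 :=
      (eq_zero_iff_of_sign_eq (hsign p hp p.natDegree)).1 hlc
    apply hsame
    rw [← map_eraseLead_eq hlc, ← map_eraseLead_eq hlc2]
    by_cases hd : p.natDegree = 0
    · have h1 : p.eraseLead = 0 := by
        rw [eq_C_of_natDegree_eq_zero hd, eraseLead_C]
      simp [h1]
    · refine T.sign_eq _ (hdown _ (herase p hp) ?_)
      have := eraseLead_natDegree_le p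
      omega
  have hlc2 : φ₂ p.leadingCoeff ≠ 0 := fun h => hlc
    ((eq_zero_iff_of_sign_eq (hsign p hp p.natDegree)).2 h)
  have hp1 : p.map φ₁ ≠ 0 := by
    intro h
    apply hlc
    rw [leadingCoeff, ← coeff_map, h, coeff_zero]
  have hp2 : p.map φ₂ ≠ 0 := by
    intro h
    apply hlc2
    rw [leadingCoeff, ← coeff_map, h, coeff_zero]
  have hd1 : (p.map φ₁).natDegree = p.natDegree := natDegree_map_of_leadingCoeff_ne_zero φ₁ hlc
  have hd2 : (p.map φ₂).natDegree = p.natDegree := natDegree_map_of_leadingCoeff_ne_zero φ₂ hlc2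
  by_cases hd : p.natDegree = 0
  · apply hsame
    intro x y _
    rw [eq_C_of_natDegree_eq_zero hd, map_C, map_C, eval_C, eval_C]
    exact hsign p hp 0
  have hdata : SignData L (p.map φ₁) (p.map φ₂) := by
    refine ⟨T.finite, T.iso, ?_, ?_, ?_, ?_, ⟨l, T.low, fun x y hx hy => ?_⟩,
      ⟨u, T.high, fun x y hx hy => ?_⟩⟩
    · rw [derivative_map, derivative_map]
      refine T.sign_eq _ (hdown _ (hder p hp) (natDegree_derivative_lt hd))
    · intro e he
      rcases T.root e he with rfl | rfl | ⟨q, hq, hq1, hqe1, hqe2⟩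
      · exact (hlow _ _ le_rfl le_rfl).1
      · exact (hhigh _ _ le_rfl le_rfl).1
      · -- at a root of `q`, the sign of `p` is determined by its remainder modulo `q`
        obtain ⟨q', hq', hdeg, hlq, e1, e2⟩ :=
          exists_leadingCoeff_ne_zero hsign herase q (hsQ hq) hq1
        have hlq2 : φ₂ q'.leadingCoeff ≠ 0 := fun h => hlq
          ((eq_zero_iff_of_sign_eq (hsign q' hq' q'.natDegree)).2 h)
        have hq'0 : q' ≠ 0 := by rintro rfl; simp at hlq
        obtain ⟨r, hr, hrd, k, v, hv⟩ := hrem p hp q' hq' hq'0 (hdeg.trans (hmax q hq))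
        have hrs : r ∈ s := by
          refine hdown r hr ?_
          by_cases hr0 : r = 0
          · rw [hr0, natDegree_zero]; omega
          · exact (natDegree_lt_natDegree hr0 hrd).trans_le (hdeg.trans (hmax q hq))
        have ev1 := congrArg (fun f => eval e.1 (f.map φ₁)) hv
        have ev2 := congrArg (fun f => eval e.2 (f.map φ₂)) hv
        simp only [Polynomial.map_mul, Polynomial.map_add, Polynomial.map_pow, map_C, eval_mul,
          eval_add, eval_pow, eval_C, e1, e2, hqe1, hqe2, zero_mul, zero_add] at ev1 ev2
        have hs := T.sign_eq r hrs _ _ (T.iso e he)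
        rw [← ev1, ← ev2, sign_mul, sign_mul, sign_pow, sign_pow,
          show sign (φ₁ q'.leadingCoeff) = sign (φ₂ q'.leadingCoeff) from
            hsign q' hq' q'.natDegree] at hs
        refine mul_left_cancel₀ (pow_ne_zero k ?_) hs
        rwa [ne_eq, sign_eq_zero_iff]
    · intro h
      have := derivative_eq_zero.1 h
      omega
    · intro h
      have := derivative_eq_zero.1 h
      omega
    · obtain ⟨h1, h2⟩ := hlow x y hx hy
      exact ⟨h2 hp1, fun h => h2 hp1 ((eq_zero_iff_of_sign_eq h1).2 h), h1⟩
    · obtain ⟨h1, h2⟩ := hhigh x y hx hy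
      exact ⟨h2 hp1, fun h => h2 hp1 ((eq_zero_iff_of_sign_eq h1).2 h), h1⟩
  have hsub : L ⊆ insertRoots L (p.map φ₁) (p.map φ₂) := Set.subset_union_left
  refine ⟨insertRoots L (p.map φ₁) (p.map φ₂), hdata.finite_insertRoots,
    hdata.isPartialIso_insertRoots hR₁ hR₂, hsub T.low, hsub T.high, ?_, ?_⟩
  · intro q hq x y hxy
    rcases Finset.mem_insert.1 hq with rfl | hq
    · exact hdata.sign_eq hR₁ hR₂ hxy
    · exact T.sign_eq q hq x y (hxy.mono hsub)
  · rintro e (he | ⟨h1, h2, -⟩)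
    · exact hroot' T.root e he
    · exact .inr (.inr ⟨p, Finset.mem_insert_self _ _, hp1, h1, h2⟩)

/-- The signs that finitely many polynomials in one variable take simultaneously are determined
by the signs of finitely many elements of the ring of coefficients. -/
theorem exists_sign_determining (Q : Finset B[X]) : ∃ Q' : Finset B,
    ∀ {R₁ R₂ : Type} [Field R₁] [LinearOrder R₁] [IsStrictOrderedRing R₁]
      [Field R₂] [LinearOrder R₂] [IsStrictOrderedRing R₂] (_ : PolyIVT R₁) (_ : PolyIVT R₂)
      (φ₁ : B →+* R₁) (φ₂ : B →+* R₂), (∀ b ∈ Q', sign (φ₁ b) = sign (φ₂ b)) →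
      ∀ x : R₁, ∃ y : R₂, ∀ p ∈ Q, sign ((p.map φ₁).eval x) = sign ((p.map φ₂).eval y) := by
  classical
  obtain ⟨Q₁, hQ, -, hder, herase, hrem⟩ := exists_closed Q
  refine ⟨Q₁.biUnion fun p => p.coeffs, ?_⟩
  intro R₁ R₂ _ _ _ _ _ _ hR₁ hR₂ φ₁ φ₂ hb x
  have hsign : ∀ p ∈ Q₁, ∀ i, sign (φ₁ (p.coeff i)) = sign (φ₂ (p.coeff i)) := by
    intro p hp i
    by_cases hi : p.coeff i = 0
    · simp [hi]
    · exact hb _ (Finset.mem_biUnion.2 ⟨p, hp, coeff_mem_coeffs hi⟩)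
  have hdeg : ∀ p ∈ Q₁, (p.map φ₁).natDegree = (p.map φ₂).natDegree := by
    intro p hp
    have h1 : ∀ n, (p.map φ₁).coeff n = 0 ↔ (p.map φ₂).coeff n = 0 := fun n => by
      rw [coeff_map, coeff_map]
      exact eq_zero_iff_of_sign_eq (hsign p hp n)
    apply le_antisymm <;> rw [natDegree_le_iff_coeff_eq_zero] <;> intro n hn
    · rw [h1]; exact coeff_eq_zero_of_natDegree_lt hn
    · rw [← h1]; exact coeff_eq_zero_of_natDegree_lt hn
  have hlead : ∀ p ∈ Q₁, sign (p.map φ₁).leadingCoeff = sign (p.map φ₂).leadingCoeff := by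
    intro p hp
    rw [leadingCoeff, leadingCoeff, hdeg p hp, coeff_map, coeff_map]
    exact hsign p hp _
  obtain ⟨M₁, hM₁, hb₁⟩ := exists_sign_bound Q₁ fun p => p.map φ₁
  obtain ⟨M₂, hM₂, hb₂⟩ := exists_sign_bound Q₁ fun p => p.map φ₂
  have hne : ∀ {n : ℕ} {c : R₁}, c ≠ 0 → (-1) ^ n * c ≠ 0 := fun hc =>
    mul_ne_zero (pow_ne_zero _ (neg_ne_zero.2 one_ne_zero)) hc
  have hlow : ∀ p ∈ Q₁, ∀ x y, x ≤ -M₁ → y ≤ -M₂ →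
      sign ((p.map φ₁).eval x) = sign ((p.map φ₂).eval y) ∧
      (p.map φ₁ ≠ 0 → (p.map φ₁).eval x ≠ 0) := by
    intro p hp x y hx hy
    have h1 := (hb₁ p hp).2 x hx
    refine ⟨?_, fun h h' => ?_⟩
    · rw [h1, (hb₂ p hp).2 y hy, sign_mul, sign_mul, hlead p hp, hdeg p hp, sign_pow, sign_pow,
        Left.sign_neg, Left.sign_neg, sign_one, sign_one]
    · rw [h', sign_zero] at h1
      exact hne (leadingCoeff_ne_zero.2 h) (sign_eq_zero_iff.1 h1.symm)
  have hhigh : ∀ p ∈ Q₁, ∀ x y, M₁ ≤ x → M₂ ≤ y →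
      sign ((p.map φ₁).eval x) = sign ((p.map φ₂).eval y) ∧
      (p.map φ₁ ≠ 0 → (p.map φ₁).eval x ≠ 0) := by
    intro p hp x y hx hy
    have h1 := (hb₁ p hp).1 x hx
    refine ⟨?_, fun h h' => ?_⟩
    · rw [h1, (hb₂ p hp).1 y hy, hlead p hp]
    · rw [h', sign_zero] at h1
      exact leadingCoeff_ne_zero.2 h (sign_eq_zero_iff.1 h1.symm)
  -- the polynomials of `Q₁` are added to the table in the order of their degrees
  have main : ∀ s : Finset B[X], s ⊆ Q₁ →
      (∀ p ∈ s, ∀ q ∈ Q₁, q.natDegree < p.natDegree → q ∈ s) →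
      ∃ L, SignTable s φ₁ φ₂ (-M₁, -M₂) (M₁, M₂) L := by
    intro s
    induction s using Finset.induction_on_max_value (fun p : B[X] => p.natDegree) with
    | empty =>
      intro _ _
      refine ⟨{(-M₁, -M₂), (M₁, M₂)}, by simp, ?_, by simp, by simp, by simp, by simp⟩
      intro e he e' he'
      simp only [Set.mem_insert_iff, Set.mem_singleton_iff] at he he'
      have h1 : -M₁ < M₁ := by linarith
      have h2 : -M₂ < M₂ := by linarith
      rcases he with rfl | rfl <;> rcases he' with rfl | rfl <;>
        simp only [lt_self_iff_false, and_self, h1, h2, h1.not_gt, h2.not_gt]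
    | insert p s hps hmax ih =>
      intro hsub hdown
      obtain ⟨hp, hs⟩ := Finset.insert_subset_iff.1 hsub
      obtain ⟨L, T⟩ := ih hs fun q hq q' hq' hlt =>
        (Finset.mem_insert.1 (hdown q (Finset.mem_insert_of_mem hq) q' hq' hlt)).resolve_left (by
          rintro rfl
          exact absurd (hmax q hq) (not_le.2 hlt))
      exact T.insert hR₁ hR₂ hp hs hmax (fun q hq hlt =>
        (Finset.mem_insert.1 (hdown p (Finset.mem_insert_self _ _) q hq hlt)).resolve_left (by
          rintro rfl
          exact absurd hlt (lt_irrefl _))) hsign hder herase hrem (hlow p hp) (hhigh p hp)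
  obtain ⟨L, T⟩ := main Q₁ subset_rfl (fun _ _ q hq _ => hq)
  obtain ⟨y, hy⟩ := T.iso.exists_compat T.finite x
  exact ⟨y, fun p hp => T.sign_eq p (hQ hp) x y hy⟩

end Univariate

end Polynomial.SignTransfer

namespace MvPolynomial

open SignType

/-- Every finite system of sign conditions with real coefficients that is satisfiable in a real
closed extension field of `ℝ` is satisfiable in `ℝ`. -/
theorem exists_real_sign_eq {R : Type} [Field R] [LinearOrder R] [IsStrictOrderedRing R]
    (hR : PolyIVT R) (ι : ℝ →+* R) (n : ℕ) (Q : Finset (MvPolynomial (Fin n) ℝ)) (c : Fin n → R) :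
    ∃ a : Fin n → ℝ, ∀ h ∈ Q, sign (eval₂ ι c h) = sign (eval a h) := by
  classical
  induction n with
  | zero =>
    refine ⟨0, fun h _ => ?_⟩
    have hι : ∀ r, 0 ≤ r → 0 ≤ ι r := fun r hr => by
      rw [← Real.mul_self_sqrt hr, map_mul]; exact mul_self_nonneg _
    rw [eq_C_of_isEmpty h, eval₂_C, eval_C]
    generalize coeff 0 h = r
    rcases lt_trichotomy r 0 with hr | rfl | hr
    · rw [sign_neg hr, sign_neg]
      have h1 := hι (-r) (by linarith)
      rw [map_neg] at h1
      exact lt_of_le_of_ne (by linarith) (by rw [ne_eq, map_eq_zero]; exact hr.ne)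
    · simp
    · rw [sign_pos hr, sign_pos]
      exact lt_of_le_of_ne (hι r hr.le) (by rw [ne_eq, eq_comm, map_eq_zero]; exact hr.ne')
  | succ n ih =>
    -- the first variable is eliminated
    obtain ⟨Q', hQ'⟩ := Polynomial.SignTransfer.exists_sign_determining
      (Q.image (finSuccEquiv ℝ n))
    obtain ⟨a, ha⟩ := ih Q' (fun i => c i.succ)
    obtain ⟨y, hy⟩ := hQ' hR polyIVT_real (eval₂Hom ι fun i => c i.succ) (eval a) ha (c 0)
    refine ⟨Fin.cons y a, fun h hh => ?_⟩
    have h1 := hy _ (Finset.mem_image_of_mem _ hh)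
    rw [← eval_eq_eval_mv_eval'] at h1
    rw [← h1]
    congr 1
    have h2 : eval₂Hom ι c = (Polynomial.evalRingHom (c 0)).comp ((Polynomial.mapRingHom
        (eval₂Hom ι fun i : Fin n => c i.succ)).comp
          (finSuccEquiv ℝ n).toAlgHom.toRingHom) := by
      apply MvPolynomial.ringHom_ext
      · intro r
        simp [finSuccEquiv_apply]
      · intro i
        refine Fin.cases ?_ (fun i => ?_) i <;> simp [finSuccEquiv_X_zero, finSuccEquiv_X_succ]
    have h3 := congrArg (fun f => f h) h2
    simpa using h3

end MvPolynomial

/-! ### The representation theorem for archimedean quadratic modules -/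

/-- A quadratic module of a commutative ring: an additive submonoid that contains `1` and is
closed under multiplication with squares. -/
structure IsQuadraticModule {A : Type*} [CommRing A] (M : AddSubmonoid A) : Prop where
  one_mem : 1 ∈ M
  sq_mul_mem : ∀ (a : A), ∀ m ∈ M, a ^ 2 * m ∈ M

set_option linter.unusedSectionVars false

namespace IsQuadraticModule

section Algebra

variable {A : Type*} [CommRing A] [Algebra ℝ A] {M : AddSubmonoid A}

lemma sq_mem (hM : IsQuadraticModule M) (a : A) : a ^ 2 ∈ M := by
  simpa using hM.sq_mul_mem a 1 hM.one_mem

lemma smul_mem (hM : IsQuadraticModule M) {c : ℝ} (hc : 0 ≤ c) {m : A} (hm : m ∈ M) :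
    c • m ∈ M := by
  have := hM.sq_mul_mem (algebraMap ℝ A (Real.sqrt c)) m hm
  rwa [← map_pow, Real.sq_sqrt hc, ← Algebra.smul_def] at this

lemma smul_one_mem (hM : IsQuadraticModule M) {c : ℝ} (hc : 0 ≤ c) : c • (1 : A) ∈ M :=
  hM.smul_mem hc hM.one_mem

/-- Every element is a difference of two squares, so that a quadratic module with `-1` is
everything. -/
lemma mem_of_neg_one_mem (hM : IsQuadraticModule M) (h : (-1 : A) ∈ M) (f : A) : f ∈ M := by
  have := add_mem (hM.sq_mem ((1 / 2 : ℝ) • (f + 1))) (hM.sq_mul_mem ((1 / 2 : ℝ) • (f - 1)) _ h)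
  have e : ((1 / 2 : ℝ) • (f + 1)) ^ 2 + ((1 / 2 : ℝ) • (f - 1)) ^ 2 * -1 = f := by
    rw [smul_pow, smul_pow, smul_mul_assoc, ← smul_add,
      show (f + 1) ^ 2 + (f - 1) ^ 2 * -1 = (4 : ℝ) • f by
        rw [show (4 : ℝ) • f = 4 * f by rw [Algebra.smul_def, map_ofNat]]; ring, smul_smul]
    norm_num
  rwa [e] at this

/-- The linear functionals with value `1` at `1` that are nonnegative on `M`, as a set of
functions. -/
def states (M : AddSubmonoid A) : Set (A → ℝ) :=
  {L | (∀ x y, L (x + y) = L x + L y) ∧ (∀ (c : ℝ) x, L (c • x) = c * L x) ∧ L 1 = 1 ∧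
    ∀ m ∈ M, 0 ≤ L m}

lemma sub_eq {L : A → ℝ} (hL : L ∈ states M) (x y : A) : L (x - y) = L x - L y := by
  have := hL.1 (x - y) y
  rw [sub_add_cancel] at this
  linarith

/-- The states form a closed subset of a product of compact intervals, whose end points are the
bounds given by the archimedean property. -/
lemma isCompact_states (harch : ∀ a : A, ∃ r : ℝ, r • (1 : A) - a ∈ M) :
    IsCompact (states M) := by
  choose r hr using harch
  refine (isCompact_univ_pi fun a : A => isCompact_Icc (a := -r (-a)) (b := r a)).of_isClosed_subset
    ?_ ?_
  · have e : states M = (⋂ x, ⋂ y, {L : A → ℝ | L (x + y) = L x + L y}) ∩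
        ((⋂ c : ℝ, ⋂ x, {L : A → ℝ | L (c • x) = c * L x}) ∩ ({L : A → ℝ | L 1 = 1} ∩
          ⋂ m ∈ M, {L : A → ℝ | 0 ≤ L m})) := by
      ext L; simp [states]
    rw [e]
    refine (isClosed_iInter fun x => isClosed_iInter fun y => isClosed_eq (by fun_prop)
      (by fun_prop)).inter ((isClosed_iInter fun c => isClosed_iInter fun x => isClosed_eq
        (by fun_prop) (by fun_prop)).inter ((isClosed_eq (by fun_prop) (by fun_prop)).inter
          (isClosed_biInter fun m _ => isClosed_le (by fun_prop) (by fun_prop))))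
  · intro L hL a _
    have h1 := hL.2.2.2 _ (hr a)
    have h2 := hL.2.2.2 _ (hr (-a))
    rw [sub_eq hL, hL.2.1, hL.2.2.1] at h1 h2
    have h3 : L (-a) = -L a := by
      have := hL.2.1 (-1) a
      simpa using this
    rw [h3] at h2
    constructor <;> linarith

/-- The Cauchy-Schwarz inequality for a state and the positive functional `x ↦ L (x * m)`. -/
lemma cauchySchwarz (hM : IsQuadraticModule M) {L : A → ℝ} (hL : L ∈ states M) {m : A}
    (hm : m ∈ M) (x y : A) : L (x * y * m) ^ 2 ≤ L (x ^ 2 * m) * L (y ^ 2 * m) := by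
  have h : ∀ t : ℝ, 0 ≤ L (y ^ 2 * m) * (t * t) + 2 * L (x * y * m) * t + L (x ^ 2 * m) := by
    intro t
    have h1 := hL.2.2.2 _ (hM.sq_mul_mem (x + t • y) m hm)
    have e : (x + t • y) ^ 2 * m = x ^ 2 * m + ((2 * t) • (x * y * m) + (t * t) • (y ^ 2 * m)) := by
      simp only [Algebra.smul_def, map_mul, map_ofNat]
      ring
    rw [e, hL.1, hL.1, hL.2.1, hL.2.1] at h1
    linarith
  have := discrim_le_zero h
  rw [discrim] at this
  nlinarith

/-- If `s - a ^ 2` is in `M`, then multiplication with `s - a ^ 2` preserves the nonnegativity of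
states on `M`: the numbers `L (a ^ (2 * k) * m)` form a log-convex sequence that grows at most
like `s ^ k`. -/
lemma state_sq_mul_le (hM : IsQuadraticModule M)
    (harch : ∀ a : A, ∃ r : ℝ, r • (1 : A) - a ∈ M) {L : A → ℝ} (hL : L ∈ states M) {m : A}
    (hm : m ∈ M) {a : A} {s : ℝ} (hs : 0 < s) (ha : s • (1 : A) - a ^ 2 ∈ M) :
    L (a ^ 2 * m) ≤ s * L m := by
  obtain ⟨b, hb⟩ := harch m
  set u : ℕ → ℝ := fun k => L ((a ^ k) ^ 2 * m) with hu
  have hu0 : ∀ k, 0 ≤ u k := fun k => hL.2.2.2 _ (hM.sq_mul_mem _ m hm)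
  have hconv : ∀ k, u (k + 1) ^ 2 ≤ u k * u (k + 2) := by
    intro k
    have := hM.cauchySchwarz hL hm (a ^ k) (a ^ (k + 2))
    rwa [show a ^ k * a ^ (k + 2) * m = (a ^ (k + 1)) ^ 2 * m by ring] at this
  have hpow : ∀ k, L ((a ^ k) ^ 2) ≤ s ^ k := by
    intro k
    induction k with
    | zero => simp [hL.2.2.1]
    | succ k ih =>
      have h1 := hL.2.2.2 _ (hM.sq_mul_mem (a ^ k) _ ha)
      rw [show (a ^ k) ^ 2 * (s • (1 : A) - a ^ 2) = s • (a ^ k) ^ 2 - (a ^ (k + 1)) ^ 2 by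
        rw [mul_sub, mul_smul_comm, mul_one]; ring, sub_eq hL, hL.2.1] at h1
      have h2 := mul_le_mul_of_nonneg_left ih hs.le
      rw [pow_succ s k]
      linarith
  have hbound : ∀ k, u k ≤ |b| * s ^ k := by
    intro k
    have h1 := hL.2.2.2 _ (hM.sq_mul_mem (a ^ k) _ hb)
    rw [mul_sub, mul_smul_comm, mul_one, sub_eq hL, hL.2.1] at h1
    have h2 : 0 ≤ L ((a ^ k) ^ 2) := hL.2.2.2 _ (hM.sq_mem _)
    have h3 := mul_le_mul (le_abs_self b) (hpow k) h2 (abs_nonneg b)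
    simp only [hu]
    linarith
  -- otherwise `u` grows at least like the powers of `u 1 / u 0 > s`
  by_contra hlt
  push Not at hlt
  have e0 : u 0 = L m := by simp [hu]
  have e1 : u 1 = L (a ^ 2 * m) := by simp [hu]
  rw [← e0, ← e1] at hlt
  have hpos : 0 < u 0 := by
    rcases (hu0 0).eq_or_lt with h | h
    · have h1 := hconv 0
      rw [← h, zero_mul] at h1
      rw [← h, mul_zero] at hlt
      rw [zero_add] at h1
      nlinarith
    · exact h
  set q := u 1 / u 0 with hq
  have hqs : s < q := by rwa [hq, lt_div_iff₀ hpos]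
  have hgrow : ∀ k, 0 < u k ∧ q * u k ≤ u (k + 1) := by
    intro k
    induction k with
    | zero => exact ⟨hpos, by rw [hq, div_mul_cancel₀ _ hpos.ne']⟩
    | succ k ih =>
      have h1 : 0 < u (k + 1) := lt_of_lt_of_le (mul_pos (hs.trans hqs) ih.1) ih.2
      refine ⟨h1, ?_⟩
      have h2 := hconv k
      have h3 : q * u k * u (k + 1) ≤ u k * u (k + 2) := by nlinarith [ih.2]
      have h4 : u k * (q * u (k + 1)) ≤ u k * u (k + 2) := by linarith
      exact le_of_mul_le_mul_left h4 ih.1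
  have hexp : ∀ k, q ^ k * u 0 ≤ u k := by
    intro k
    induction k with
    | zero => simp
    | succ k ih =>
      have h1 := (hgrow k).2
      have h2 := mul_le_mul_of_nonneg_left ih (hs.trans hqs).le
      rw [pow_succ]
      linarith
  obtain ⟨k, hk⟩ := pow_unbounded_of_one_lt (|b| / u 0) ((one_lt_div hs).2 hqs)
  have h1 := (hexp k).trans (hbound k)
  rw [div_pow, div_lt_div_iff₀ hpos (pow_pos hs k)] at hk
  linarith

/-- An extreme state `L` is multiplicative: `L` is a convex combination of the states
`x ↦ L (a ^ 2 * x) / L (a ^ 2)` and `x ↦ L ((s - a ^ 2) * x) / L (s - a ^ 2)` for large `s`, and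
every element is a linear combination of squares. -/
lemma state_mul_of_extreme (hM : IsQuadraticModule M)
    (harch : ∀ a : A, ∃ r : ℝ, r • (1 : A) - a ∈ M) {L : A → ℝ} (hL : L ∈ states M)
    (hext : ∀ L₁ ∈ states M, ∀ L₂ ∈ states M, ∀ t : ℝ, 0 < t → t < 1 →
      (∀ x, L x = t * L₁ x + (1 - t) * L₂ x) → L₁ = L) (a x : A) :
    L (a * x) = L a * L x := by
  have key : ∀ a x : A, L (a ^ 2 * x) = L (a ^ 2) * L x := by
    intro a x
    obtain ⟨r, hr⟩ := harch (a ^ 2)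
    set s : ℝ := |r| + 1 with hs
    have hspos : 0 < s := by positivity
    have hsM : s • (1 : A) - a ^ 2 ∈ M := by
      have := add_mem hr (hM.smul_one_mem (c := s - r) (by linarith [le_abs_self r]))
      rwa [show r • (1 : A) - a ^ 2 + (s - r) • (1 : A) = s • (1 : A) - a ^ 2 by
        rw [sub_smul]; abel] at this
    have hlt : L (a ^ 2) < s := by
      have := hL.2.2.2 _ hr
      rw [sub_eq hL, hL.2.1, hL.2.2.1] at this
      linarith [le_abs_self r]
    rcases (hL.2.2.2 _ (hM.sq_mem a)).eq_or_lt with h0 | h0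
    · -- if `L (a ^ 2) = 0`, then `x ≤ b` and `-x ≤ b'` force `L (a ^ 2 * x) = 0`
      obtain ⟨b, hb⟩ := harch x
      obtain ⟨b', hb'⟩ := harch (-x)
      have h1 := hL.2.2.2 _ (hM.sq_mul_mem a _ hb)
      have h2 := hL.2.2.2 _ (hM.sq_mul_mem a _ hb')
      rw [mul_sub, mul_smul_comm, mul_one, sub_eq hL, hL.2.1, ← h0] at h1 h2
      have h3 : L (a ^ 2 * -x) = -L (a ^ 2 * x) := by
        have := hL.2.1 (-1) (a ^ 2 * x)
        simpa using this
      rw [h3] at h2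
      rw [← h0]
      linarith
    · have h1 := hext (fun x => L (a ^ 2 * x) / L (a ^ 2)) ⟨fun x y => by
          beta_reduce; rw [mul_add, hL.1, add_div], fun c x => by
          beta_reduce; rw [mul_smul_comm, hL.2.1, mul_div_assoc], by simp [h0.ne'],
          fun m hm => div_nonneg (hL.2.2.2 _ (hM.sq_mul_mem a m hm)) h0.le⟩
        (fun x => (s * L x - L (a ^ 2 * x)) / (s - L (a ^ 2))) ⟨fun x y => by
          beta_reduce; rw [mul_add, hL.1, hL.1, ← add_div]; ring, fun c x => by
          beta_reduce; rw [mul_smul_comm, hL.2.1, hL.2.1, ← mul_div_assoc]; ring, by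
          beta_reduce; rw [hL.2.2.1, mul_one, mul_one, div_self (by linarith)],
          fun m hm => div_nonneg (sub_nonneg.2 (hM.state_sq_mul_le harch hL hm hspos hsM))
            (by linarith)⟩ (L (a ^ 2) / s) (by positivity) (by rwa [div_lt_one hspos])
        (fun x => by
          have : s - L (a ^ 2) ≠ 0 := by linarith
          field_simp
          ring)
      have h2 := congrFun h1 x
      rw [div_eq_iff h0.ne'] at h2
      linarith
  have e1 : (4 : ℝ) • (a * x) = (a + 1) ^ 2 * x - (a - 1) ^ 2 * x := by
    rw [Algebra.smul_def, map_ofNat]; ring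
  have e2 : (4 : ℝ) • a = (a + 1) ^ 2 - (a - 1) ^ 2 := by
    rw [Algebra.smul_def, map_ofNat]; ring
  have h1 := congrArg L e1
  have h2 := congrArg L e2
  rw [sub_eq hL, hL.2.1, key, key] at h1
  rw [sub_eq hL, hL.2.1] at h2
  linear_combination (1 / 4) * h1 - (1 / 4) * L x * h2

/-- An element outside of an archimedean quadratic module is separated from it by a state: the
functional `t ↦ t` on `ℝ ∙ 1` extends to one that is nonnegative on the cone `M - ℝ≥0 ∙ f`, by
M. Riesz's theorem. -/
lemma exists_state (hM : IsQuadraticModule M)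
    (harch : ∀ a : A, ∃ r : ℝ, r • (1 : A) - a ∈ M) {f : A} (hf : f ∉ M) :
    ∃ L ∈ states M, L f ≤ 0 := by
  have hneg : ∀ c : ℝ, c < 0 → c • (1 : A) ∉ M := by
    intro c hc h
    refine hf (hM.mem_of_neg_one_mem ?_ f)
    have := hM.smul_mem (c := -c⁻¹) (by rw [neg_nonneg]; exact (inv_lt_zero.2 hc).le) h
    rwa [smul_smul, neg_mul, inv_mul_cancel₀ hc.ne, neg_one_smul] at this
  have h10 : (1 : A) ≠ 0 := by
    intro h
    have : Subsingleton A := subsingleton_of_zero_eq_one h.symm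
    exact hf (Subsingleton.elim 0 f ▸ zero_mem M)
  let S : PointedCone ℝ A :=
    { carrier := {x | ∃ m ∈ M, ∃ t : ℝ, 0 ≤ t ∧ x = m - t • f}
      zero_mem' := ⟨0, zero_mem M, 0, le_rfl, by simp⟩
      add_mem' := by
        rintro _ _ ⟨m, hm, t, ht, rfl⟩ ⟨m', hm', t', ht', rfl⟩
        exact ⟨m + m', add_mem hm hm', t + t', add_nonneg ht ht', by rw [add_smul]; abel⟩
      smul_mem' := by
        rintro ⟨c, hc⟩ _ ⟨m, hm, t, ht, rfl⟩
        refine ⟨c • m, hM.smul_mem hc hm, c * t, mul_nonneg hc ht, ?_⟩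
        rw [Nonneg.mk_smul, smul_sub, smul_smul] }
  have hMS : ∀ m ∈ M, m ∈ S := fun m hm => ⟨m, hm, 0, le_rfl, by simp⟩
  obtain ⟨g, hg1, hg2⟩ := riesz_extension S (LinearPMap.mkSpanSingleton (1 : A) (1 : ℝ) h10)
    (by
      rintro ⟨x, hx⟩ hxS
      obtain ⟨c, rfl⟩ := Submodule.mem_span_singleton.1 hx
      rw [LinearPMap.mkSpanSingleton'_apply, RingHom.id_apply, smul_eq_mul, mul_one]
      by_contra hc
      push Not at hc
      obtain ⟨m, hm, t, ht, e⟩ := hxS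
      change c • (1 : A) = m - t • f at e
      rcases ht.eq_or_lt with rfl | ht
      · rw [zero_smul, sub_zero] at e
        exact hneg c hc (e ▸ hm)
      · apply hf
        have h1 := hM.smul_mem (c := t⁻¹) (by positivity)
          (add_mem hm (hM.smul_one_mem (c := -c) (by linarith)))
        rwa [neg_smul, e, show m + -(m - t • f) = t • f by abel, smul_smul,
          inv_mul_cancel₀ ht.ne', one_smul] at h1)
    (by
      intro y
      obtain ⟨r, hr⟩ := harch (-y)
      refine ⟨⟨r • (1 : A), Submodule.mem_span_singleton.2 ⟨r, rfl⟩⟩, ?_⟩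
      rw [sub_neg_eq_add] at hr
      exact hMS _ hr)
  refine ⟨g, ⟨fun x y => map_add g x y, fun c x => by rw [map_smul, smul_eq_mul], ?_,
    fun m hm => hg2 m (hMS m hm)⟩, ?_⟩
  · exact (hg1 ⟨(1 : A), Submodule.mem_span_singleton_self _⟩).trans
      (LinearPMap.mkSpanSingleton'_apply_self _ _ _ _)
  · have h1 := hg2 (-f) ⟨0, zero_mem M, 1, zero_le_one, by simp⟩
    rw [map_neg] at h1
    linarith

/-- An element outside of an archimedean quadratic module is nonpositive at some multiplicative
state. -/
lemma exists_mul_state (hM : IsQuadraticModule M)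
    (harch : ∀ a : A, ∃ r : ℝ, r • (1 : A) - a ∈ M) {f : A} (hf : f ∉ M) :
    ∃ L ∈ states M, L f ≤ 0 ∧ ∀ a x, L (a * x) = L a * L x := by
  obtain ⟨L₀, hL₀, hL₀f⟩ := hM.exists_state harch hf
  have hcomp := isCompact_states harch
  -- the states that minimise `L f` form a face, whose extreme points are extreme states
  obtain ⟨L₁, hL₁, hmin⟩ := hcomp.exists_isMinOn ⟨L₀, hL₀⟩
    (f := fun L : A → ℝ => L f) (by fun_prop)
  have hmin' : ∀ L ∈ states M, L₁ f ≤ L f := fun L hL => hmin hL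
  have hface : IsCompact (states M ∩ {L | L f = L₁ f}) :=
    hcomp.inter_right (isClosed_eq (by fun_prop) (by fun_prop))
  obtain ⟨L, hL⟩ := hface.extremePoints_nonempty ⟨L₁, hL₁, rfl⟩
  obtain ⟨⟨hLs, hLf⟩, hext⟩ := mem_extremePoints.1 hL
  change L f = L₁ f at hLf
  refine ⟨L, hLs, hLf.trans_le ((hmin' L₀ hL₀).trans hL₀f), ?_⟩
  refine hM.state_mul_of_extreme harch hLs fun K₁ hK₁ K₂ hK₂ t ht0 ht1 h => ?_
  have h1 := hmin' K₁ hK₁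
  have h2 := hmin' K₂ hK₂
  have h3 := h f
  rw [hLf] at h3
  have e1 : K₁ f = L₁ f := by nlinarith
  have e2 : K₂ f = L₁ f := by nlinarith
  refine (hext K₁ ⟨hK₁, e1⟩ K₂ ⟨hK₂, e2⟩ ⟨t, 1 - t, ht0, by linarith, by ring, ?_⟩).1
  funext x
  simp [h x]

end Algebra

variable {σ : Type} {M : AddSubmonoid (MvPolynomial σ ℝ)}

/-- The representation theorem for archimedean quadratic modules of polynomials: a multiplicative
state is the evaluation at the point whose coordinates are its values at the variables. -/
theorem mem_of_pos (hM : IsQuadraticModule M)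
    (harch : ∀ a : MvPolynomial σ ℝ, ∃ r : ℝ, C r - a ∈ M) {f : MvPolynomial σ ℝ}
    (hf : ∀ z : σ → ℝ, (∀ m ∈ M, 0 ≤ eval z m) → 0 < eval z f) : f ∈ M := by
  by_contra hfM
  obtain ⟨L, hL, hLf, hmul⟩ := hM.exists_mul_state (by
    intro a
    obtain ⟨r, hr⟩ := harch a
    exact ⟨r, by rwa [← Algebra.algebraMap_eq_smul_one, MvPolynomial.algebraMap_eq]⟩) hfM
  have hev : ∀ p, L p = eval (fun i => L (X i)) p := by
    intro p
    induction p using MvPolynomial.induction_on with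
    | C a =>
      rw [eval_C, ← MvPolynomial.algebraMap_eq, Algebra.algebraMap_eq_smul_one, hL.2.1, hL.2.2.1,
        mul_one]
    | add p q hp hq => rw [hL.1, hp, hq, map_add]
    | mul_X p i hp => rw [hmul, hp, map_mul, eval_X]
  have := hf (fun i => L (X i)) (fun m hm => by rw [← hev]; exact hL.2.2.2 m hm)
  rw [← hev] at this
  linarith

/-- A quadratic module of polynomials is archimedean as soon as it contains `K - ∑ Xᵢ²` for some
`K`. -/
theorem archimedean_of_ball [Fintype σ] (hM : IsQuadraticModule M) {K : ℝ}
    (hK : C K - ∑ i, X i ^ 2 ∈ M) (a : MvPolynomial σ ℝ) : ∃ r : ℝ, C r - a ∈ M := by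
  have hC : ∀ {c : ℝ}, 0 ≤ c → C c ∈ M := fun hc => by
    have := hM.smul_one_mem hc
    rwa [← Algebra.algebraMap_eq_smul_one, MvPolynomial.algebraMap_eq] at this
  have hmulC : ∀ {c : ℝ} {m : MvPolynomial σ ℝ}, 0 ≤ c → m ∈ M → C c * m ∈ M := fun hc hm => by
    have := hM.smul_mem hc hm
    rwa [MvPolynomial.smul_eq_C_mul] at this
  -- the bounded elements form a subalgebra
  let H : MvPolynomial σ ℝ → Prop := fun a => ∃ r : ℝ, 0 < r ∧ C r - a ∈ M ∧ C r + a ∈ M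
  have hadd : ∀ a b, H a → H b → H (a + b) := by
    rintro a b ⟨r, hr, h1, h2⟩ ⟨s, hs, h3, h4⟩
    refine ⟨r + s, add_pos hr hs, ?_, ?_⟩
    · have := add_mem h1 h3
      rwa [show C r - a + (C s - b) = C (r + s) - (a + b) by rw [C_add]; ring] at this
    · have := add_mem h2 h4
      rwa [show C r + a + (C s + b) = C (r + s) + (a + b) by rw [C_add]; ring] at this
  have hneg : ∀ a, H a → H (-a) := by
    rintro a ⟨r, hr, h1, h2⟩
    exact ⟨r, hr, by rwa [sub_neg_eq_add], by rwa [← sub_eq_add_neg]⟩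
  have hsq : ∀ a, H a → H (a ^ 2) := by
    rintro a ⟨r, hr, h1, h2⟩
    refine ⟨r ^ 2, by positivity, ?_, add_mem (hC (by positivity)) (hM.sq_mem a)⟩
    have h3 := hmulC (c := (2 * r)⁻¹) (by positivity)
      (add_mem (hM.sq_mul_mem (C r + a) _ h1) (hM.sq_mul_mem (C r - a) _ h2))
    have e : (C r + a) ^ 2 * (C r - a) + (C r - a) ^ 2 * (C r + a) =
        C (2 * r) * (C (r ^ 2) - a ^ 2) := by
      simp only [C_mul, C_pow, map_ofNat]
      ring
    rwa [e, ← mul_assoc, ← C_mul, inv_mul_cancel₀ (by positivity), C_1, one_mul] at h3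
  have hscale : ∀ (c : ℝ) a, 0 < c → H a → H (C c * a) := by
    rintro c a hc ⟨r, hr, h1, h2⟩
    refine ⟨c * r, by positivity, ?_, ?_⟩
    · have := hmulC hc.le h1
      rwa [mul_sub, ← C_mul] at this
    · have := hmulC hc.le h2
      rwa [mul_add, ← C_mul] at this
  have hmul : ∀ a b, H a → H b → H (a * b) := by
    intro a b ha hb
    have h1 := hsq _ (hadd a b ha hb)
    have h2 := hneg _ (hsq _ (hadd a (-b) ha (hneg b hb)))
    have h3 := hscale (1 / 4) _ (by norm_num) (hadd _ _ h1 h2)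
    rwa [show (a + b) ^ 2 + -(a + -b) ^ 2 = C 4 * (a * b) by
      rw [map_ofNat]; ring, ← mul_assoc, ← C_mul, show (1 / 4 : ℝ) * 4 = 1 by norm_num, C_1,
      one_mul] at h3
  have hHC : ∀ c : ℝ, H (C c) := by
    intro c
    refine ⟨|c| + 1, by positivity, ?_, ?_⟩
    · rw [← C_sub]; exact hC (by linarith [le_abs_self c])
    · rw [← C_add]; exact hC (by linarith [neg_abs_le c])
  have hHX : ∀ i, H (X i) := by
    intro i
    have h1 : C K - X i ^ 2 ∈ M := by
      classical
      have h2 := add_mem hK (M.sum_mem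
        (t := Finset.univ.erase i) (f := fun j => X j ^ 2) fun j _ => hM.sq_mem (X j))
      rw [← Finset.add_sum_erase _ _ (Finset.mem_univ i)] at h2
      rwa [show C K - (X i ^ 2 + ∑ x ∈ Finset.univ.erase i, X x ^ 2) +
        ∑ x ∈ Finset.univ.erase i, X x ^ 2 = (C K - X i ^ 2 : MvPolynomial σ ℝ) by ring] at h2
    refine ⟨(|K| + 1) / 2, by positivity, ?_, ?_⟩
    · have := hmulC (c := 1 / 2) (by norm_num) (add_mem (add_mem h1 (hM.sq_mem (1 - X i)))
        (hC (c := |K| - K) (by linarith [le_abs_self K])))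
      convert this using 1
      rw [show (C K - X i ^ 2 + (1 - X i) ^ 2 + C (|K| - K) : MvPolynomial σ ℝ) =
        C (|K| + 1) - C 2 * X i by simp only [C_sub, C_add, C_1, map_ofNat]; ring, mul_sub,
        ← mul_assoc, ← C_mul, ← C_mul, show (1 / 2 : ℝ) * 2 = 1 by norm_num, C_1, one_mul,
        one_div_mul_eq_div]
    · have := hmulC (c := 1 / 2) (by norm_num) (add_mem (add_mem h1 (hM.sq_mem (1 + X i)))
        (hC (c := |K| - K) (by linarith [le_abs_self K])))
      convert this using 1
      rw [show (C K - X i ^ 2 + (1 + X i) ^ 2 + C (|K| - K) : MvPolynomial σ ℝ) =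
        C (|K| + 1) + C 2 * X i by simp only [C_sub, C_add, C_1, map_ofNat]; ring, mul_add,
        ← mul_assoc, ← C_mul, ← C_mul, show (1 / 2 : ℝ) * 2 = 1 by norm_num, C_1, one_mul,
        one_div_mul_eq_div]
  have hall : H a := by
    induction a using MvPolynomial.induction_on with
    | C c => exact hHC c
    | add p q hp hq => exact hadd p q hp hq
    | mul_X p i hp => exact hmul p (X i) hp (hHX i)
  obtain ⟨r, -, h, -⟩ := hall
  exact ⟨r, h⟩

end IsQuadraticModule

/-! ### The Positivstellensätze -/

/-- A preordering of a polynomial ring over `ℝ` that does not contain `-1` has a point at which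
finitely many prescribed elements are nonnegative. -/
theorem MvPolynomial.exists_point_of_preordering {σ : Type} [Finite σ]
    (T : Subsemiring (MvPolynomial σ ℝ)) (hsq : ∀ a, a ^ 2 ∈ T) (hneg : -1 ∉ T)
    (Q : Finset (MvPolynomial σ ℝ)) (hQ : ∀ h ∈ Q, h ∈ T) :
    ∃ z : σ → ℝ, ∀ h ∈ Q, 0 ≤ eval z h := by
  classical
  obtain ⟨n, ⟨e⟩⟩ := Finite.exists_equiv_fin σ
  obtain ⟨R, _, _, _, φ, hR, hφ⟩ := exists_realClosed_of_preordering T hsq hneg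
  obtain ⟨a, ha⟩ := exists_real_sign_eq hR (φ.comp C) n (Q.image (rename e))
    (fun i => φ (X (e.symm i)))
  refine ⟨fun i => a (e i), fun h hh => ?_⟩
  have h1 := ha _ (Finset.mem_image_of_mem _ hh)
  have h2 : eval₂ (φ.comp C) (fun i => φ (X (e.symm i))) (rename e h) = φ h := by
    rw [eval₂_rename]
    have h3 : eval₂Hom (φ.comp C) (fun i => φ (X i)) = φ :=
      MvPolynomial.ringHom_ext (by simp) (by simp)
    have h4 := congrArg (fun f => f h) h3
    simpa [Function.comp_def] using h4
  rw [h2, eval_rename] at h1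
  have h3 := hφ h (hQ h hh)
  change 0 ≤ eval (a ∘ e) h
  by_contra hc
  rw [sign_neg (not_le.1 hc), sign_eq_neg_one_iff] at h1
  exact absurd h1 (not_lt.2 h3)

/-- The polynomials with a certificate of arbitrary degree. -/
def certificates {σ : Type} (P : Positivstellensatz) (G : PolySystem σ) :
    AddSubmonoid (MvPolynomial σ ℝ) :=
  AddSubmonoid.closure ({t | ∃ f, ∃ m ∈ P.multipliers G, t = f ^ 2 * m} ∪
    {t | ∃ f, ∃ g ∈ G.eqs, t = f * g})

section Certificates

variable {σ : Type} {P : Positivstellensatz} {G : PolySystem σ}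

lemma sosLevel_mono {d d' : ℕ} (h : d ≤ d') : sosLevel P G d ≤ sosLevel P G d' := by
  refine AddSubmonoid.closure_mono ?_
  rintro t (⟨f, m, hm, e, hd⟩ | ⟨f, g, hg, e, hd⟩)
  · exact .inl ⟨f, m, hm, e, hd.trans h⟩
  · exact .inr ⟨f, g, hg, e, hd.trans h⟩

lemma sosLevel_le_certificates (d : ℕ) : sosLevel P G d ≤ certificates P G := by
  refine AddSubmonoid.closure_mono ?_
  rintro t (⟨f, m, hm, e, -⟩ | ⟨f, g, hg, e, -⟩)
  · exact .inl ⟨f, m, hm, e⟩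
  · exact .inr ⟨f, g, hg, e⟩

lemma exists_mem_sosLevel {p : MvPolynomial σ ℝ} (hp : p ∈ certificates P G) :
    ∃ d, p ∈ sosLevel P G d := by
  induction hp using AddSubmonoid.closure_induction with
  | zero => exact ⟨0, zero_mem _⟩
  | add x y _ _ hx hy =>
    obtain ⟨d, hd⟩ := hx
    obtain ⟨d', hd'⟩ := hy
    exact ⟨max d d', add_mem (sosLevel_mono (le_max_left _ _) hd)
      (sosLevel_mono (le_max_right _ _) hd')⟩
  | mem x hx =>
    refine ⟨x.totalDegree, AddSubmonoid.subset_closure ?_⟩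
    rcases hx with ⟨f, m, hm, e⟩ | ⟨f, g, hg, e⟩
    · exact .inl ⟨f, m, hm, e, le_rfl⟩
    · exact .inr ⟨f, g, hg, e, le_rfl⟩

lemma one_mem_multipliers : 1 ∈ P.multipliers G := by
  cases P
  · exact .inl rfl
  · exact ⟨[], List.nil_sublist _, rfl⟩

lemma mem_multipliers_of_mem_ineqs {g : MvPolynomial σ ℝ} (hg : g ∈ G.ineqs) :
    g ∈ P.multipliers G := by
  cases P
  · exact .inr hg
  · exact ⟨[g], List.singleton_sublist.2 hg, by simp⟩

lemma eval_multiplier_nonneg {m : MvPolynomial σ ℝ} (hm : m ∈ P.multipliers G) {z : σ → ℝ}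
    (hz : z ∈ G.region) : 0 ≤ eval z m := by
  cases P with
  | putinar =>
    rcases hm with rfl | hm
    · simp
    · exact hz.1 m hm
  | schmudgen =>
    obtain ⟨l, hl, rfl⟩ := hm
    rw [map_list_prod]
    refine List.prod_nonneg fun a ha => ?_
    obtain ⟨g, hg, rfl⟩ := List.mem_map.1 ha
    exact hz.1 g (hl.subset hg)

lemma eval_nonneg_of_mem_certificates {p : MvPolynomial σ ℝ} (hp : p ∈ certificates P G)
    {z : σ → ℝ} (hz : z ∈ G.region) : 0 ≤ eval z p := by
  induction hp using AddSubmonoid.closure_induction with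
  | zero => simp
  | add x y _ _ hx hy => rw [map_add]; exact add_nonneg hx hy
  | mem x hx =>
    rcases hx with ⟨f, m, hm, rfl⟩ | ⟨f, g, hg, rfl⟩
    · rw [map_mul, map_pow]
      exact mul_nonneg (sq_nonneg _) (eval_multiplier_nonneg hm hz)
    · rw [map_mul, hz.2 g hg, mul_zero]

lemma sq_mul_mem_certificates {f m : MvPolynomial σ ℝ} (hm : m ∈ P.multipliers G) :
    f ^ 2 * m ∈ certificates P G :=
  AddSubmonoid.subset_closure (.inl ⟨f, m, hm, rfl⟩)

lemma mul_mem_certificates_of_mem_eqs {f g : MvPolynomial σ ℝ} (hg : g ∈ G.eqs) :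
    f * g ∈ certificates P G :=
  AddSubmonoid.subset_closure (.inr ⟨f, g, hg, rfl⟩)

lemma multiplier_mem_certificates {m : MvPolynomial σ ℝ} (hm : m ∈ P.multipliers G) :
    m ∈ certificates P G := by
  simpa using sq_mul_mem_certificates (f := 1) hm

lemma isQuadraticModule_certificates : IsQuadraticModule (certificates P G) where
  one_mem := multiplier_mem_certificates one_mem_multipliers
  sq_mul_mem a p hp := by
    induction hp using AddSubmonoid.closure_induction with
    | zero => simp
    | add x y _ _ hx hy => rw [mul_add]; exact add_mem hx hy
    | mem x hx =>
      rcases hx with ⟨f, m, hm, rfl⟩ | ⟨f, g, hg, rfl⟩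
      · rw [← mul_assoc, ← mul_pow]
        exact sq_mul_mem_certificates hm
      · rw [← mul_assoc]
        exact mul_mem_certificates_of_mem_eqs hg

lemma mem_region_of_nonneg {z : σ → ℝ} (h : ∀ p ∈ certificates P G, 0 ≤ eval z p) :
    z ∈ G.region := by
  refine ⟨fun g hg => h g (multiplier_mem_certificates (mem_multipliers_of_mem_ineqs hg)),
    fun g hg => ?_⟩
  have h1 := h _ (mul_mem_certificates_of_mem_eqs (f := 1) hg)
  have h2 := h _ (mul_mem_certificates_of_mem_eqs (f := -1) hg)
  simp only [one_mul, neg_mul, map_neg] at h1 h2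
  linarith

/-- The products of distinct constraints are closed under multiplication up to squares. -/
lemma exists_sq_mul_prod_eq {l l₁ l₂ : List (MvPolynomial σ ℝ)} (h₁ : l₁.Sublist l)
    (h₂ : l₂.Sublist l) : ∃ (q : MvPolynomial σ ℝ) (l₃ : List (MvPolynomial σ ℝ)), l₃.Sublist l ∧
      l₁.prod * l₂.prod = q ^ 2 * l₃.prod := by
  induction l generalizing l₁ l₂ with
  | nil =>
    rw [List.sublist_nil] at h₁ h₂
    exact ⟨1, [], List.nil_sublist _, by simp [h₁, h₂]⟩
  | cons a l ih =>
    cases h₁ with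
    | cons _ h₁ =>
      cases h₂ with
      | cons _ h₂ =>
        obtain ⟨q, l₃, h₃, e⟩ := ih h₁ h₂
        exact ⟨q, l₃, h₃.cons _, e⟩
      | cons_cons _ h₂ =>
        obtain ⟨q, l₃, h₃, e⟩ := ih h₁ h₂
        exact ⟨q, a :: l₃, h₃.cons_cons _, by
          rw [List.prod_cons, List.prod_cons]; linear_combination a * e⟩
    | cons_cons _ h₁ =>
      cases h₂ with
      | cons _ h₂ =>
        obtain ⟨q, l₃, h₃, e⟩ := ih h₁ h₂
        exact ⟨q, a :: l₃, h₃.cons_cons _, by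
          rw [List.prod_cons, List.prod_cons]; linear_combination a * e⟩
      | cons_cons _ h₂ =>
        obtain ⟨q, l₃, h₃, e⟩ := ih h₁ h₂
        exact ⟨a * q, l₃, h₃.cons _, by
          rw [List.prod_cons, List.prod_cons]; linear_combination a ^ 2 * e⟩

lemma mul_mem_certificates_schmudgen {p q : MvPolynomial σ ℝ}
    (hp : p ∈ certificates .schmudgen G) (hq : q ∈ certificates .schmudgen G) :
    p * q ∈ certificates .schmudgen G := by
  induction hp using AddSubmonoid.closure_induction with
  | zero => simp
  | add x y _ _ hx hy => rw [add_mul]; exact add_mem hx hy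
  | mem x hx =>
    induction hq using AddSubmonoid.closure_induction with
    | zero => simp
    | add x y _ _ hx hy => rw [mul_add]; exact add_mem hx hy
    | mem y hy =>
      rcases hx with ⟨f, m, hm, rfl⟩ | ⟨f, g, hg, rfl⟩
      · rcases hy with ⟨f', m', hm', rfl⟩ | ⟨f', g', hg', rfl⟩
        · obtain ⟨l, hl, rfl⟩ := hm
          obtain ⟨l', hl', rfl⟩ := hm'
          obtain ⟨u, l₃, h₃, e⟩ := exists_sq_mul_prod_eq hl hl'
          have := sq_mul_mem_certificates (P := .schmudgen) (G := G) (f := f * f' * u)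
            (m := l₃.prod) ⟨l₃, h₃, rfl⟩
          rwa [show f ^ 2 * l.prod * (f' ^ 2 * l'.prod) = (f * f' * u) ^ 2 * l₃.prod by
            linear_combination f ^ 2 * f' ^ 2 * e]
        · rw [← mul_assoc]
          exact mul_mem_certificates_of_mem_eqs hg'
      · rw [mul_right_comm]
        exact mul_mem_certificates_of_mem_eqs hg

/-- Stengle's Positivstellensatz: a polynomial that is positive on the region is a quotient
`(1 + a) / b` with `a` and `b` in the preordering. -/
theorem exists_mul_eq_one_add [Finite σ] {p : MvPolynomial σ ℝ}
    (hp : ∀ z ∈ G.region, 0 < eval z p) : ∃ a ∈ certificates .schmudgen G,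
      ∃ b ∈ certificates .schmudgen G, p * b = 1 + a := by
  classical
  set M := certificates .schmudgen G with hM
  have hQM : IsQuadraticModule M := isQuadraticModule_certificates
  -- the preordering generated by `M` and `-p`; it contains `-1` iff `p` is such a quotient
  let T : Subsemiring (MvPolynomial σ ℝ) :=
    { carrier := {x | ∃ a ∈ M, ∃ b ∈ M, x = a - p * b}
      zero_mem' := ⟨0, zero_mem M, 0, zero_mem M, by simp⟩
      one_mem' := ⟨1, hQM.one_mem, 0, zero_mem M, by simp⟩
      add_mem' := by
        rintro _ _ ⟨a, ha, b, hb, rfl⟩ ⟨a', ha', b', hb', rfl⟩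
        exact ⟨a + a', add_mem ha ha', b + b', add_mem hb hb', by ring⟩
      mul_mem' := by
        rintro _ _ ⟨a, ha, b, hb, rfl⟩ ⟨a', ha', b', hb', rfl⟩
        exact ⟨a * a' + p ^ 2 * (b * b'), add_mem (mul_mem_certificates_schmudgen ha ha')
          (hQM.sq_mul_mem p _ (mul_mem_certificates_schmudgen hb hb')), a * b' + a' * b,
          add_mem (mul_mem_certificates_schmudgen ha hb')
            (mul_mem_certificates_schmudgen ha' hb), by ring⟩ }
  have hMT : ∀ x ∈ M, x ∈ T := fun x hx => ⟨x, hx, 0, zero_mem M, by simp⟩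
  by_cases hneg : (-1 : MvPolynomial σ ℝ) ∈ T
  · obtain ⟨a, ha, b, hb, e⟩ := hneg
    exact ⟨a, ha, b, hb, by linear_combination e⟩
  · exfalso
    obtain ⟨z, hz⟩ := MvPolynomial.exists_point_of_preordering T
      (fun a => hMT _ (hQM.sq_mem a)) hneg
      (insert (-p) (G.ineqs.toFinset ∪ G.eqs.toFinset ∪ G.eqs.toFinset.image Neg.neg)) (by
        intro h hh
        simp only [Finset.mem_insert, Finset.mem_union, List.mem_toFinset, Finset.mem_image] at hh
        rcases hh with rfl | (hh | hh) | ⟨g, hg, rfl⟩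
        · exact ⟨0, zero_mem M, 1, hQM.one_mem, by ring⟩
        · exact hMT _ (multiplier_mem_certificates (mem_multipliers_of_mem_ineqs hh))
        · refine hMT _ ?_
          have := mul_mem_certificates_of_mem_eqs (P := .schmudgen) (f := 1) hh
          rwa [one_mul] at this
        · refine hMT _ ?_
          have := mul_mem_certificates_of_mem_eqs (P := .schmudgen) (f := -1) hg
          rwa [neg_one_mul] at this)
    simp only [Finset.mem_insert, Finset.mem_union, List.mem_toFinset, Finset.mem_image] at hz
    have hreg : z ∈ G.region := by
      refine ⟨fun g hg => hz g (.inr (.inl (.inl hg))), fun g hg => ?_⟩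
      have h1 := hz g (.inr (.inl (.inr hg)))
      have h2 := hz (-g) (.inr (.inr ⟨g, hg, rfl⟩))
      rw [map_neg] at h2
      linarith
    have h1 := hp z hreg
    have h2 := hz (-p) (.inl rfl)
    rw [map_neg] at h2
    linarith

/-- The preordering of a bounded region is archimedean. If `p = ρ - ∑ Xᵢ²` is positive on the
region, then `(1 + a) * p` is in the preordering for some element `a` of it; the denominator
`1 + a` is removed by means of the bound `a ≤ c` that holds in the quadratic module generated
by `p`. -/
theorem exists_ball_mem_certificates [Fintype σ] (hG : Bornology.IsBounded G.region) :
    ∃ K : ℝ, C K - ∑ i, X i ^ 2 ∈ certificates .schmudgen G := by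
  have hQM : IsQuadraticModule (certificates .schmudgen G) := isQuadraticModule_certificates
  obtain ⟨R, hR⟩ := hG.subset_closedBall 0
  set ρ : ℝ := Fintype.card σ * R ^ 2 + 1 with hρ
  have hρ0 : 0 ≤ ρ := by positivity
  set p : MvPolynomial σ ℝ := C ρ - ∑ i, X i ^ 2 with hp
  have hpos : ∀ z ∈ G.region, 0 < eval z p := by
    intro z hz
    have h1 : ‖z‖ ≤ R := by simpa using hR hz
    have h2 : ∀ i, z i ^ 2 ≤ R ^ 2 := fun i => by
      have h3 : |z i| ≤ R := (norm_le_pi_norm z i).trans h1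
      rw [← sq_abs]
      exact pow_le_pow_left₀ (abs_nonneg _) h3 2
    have h3 : ∑ i, z i ^ 2 ≤ Fintype.card σ * R ^ 2 := by
      refine (Finset.sum_le_sum fun i _ => h2 i).trans ?_
      simp
    simp only [hp, map_sub, eval_C, map_sum, map_pow, eval_X]
    linarith
  obtain ⟨a, ha, b, hb, e⟩ := exists_mul_eq_one_add hpos
  have hap : (1 + a) * p ∈ certificates .schmudgen G := by
    have := hQM.sq_mul_mem p b hb
    rwa [show p ^ 2 * b = (1 + a) * p by linear_combination p * e] at this
  -- the module generated by `p` is archimedean and becomes part of the preordering if it is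
  -- multiplied with `1 + a`
  have hM₁ : ∀ x ∈ certificates .putinar ⟨[p], []⟩, (1 + a) * x ∈ certificates .schmudgen G := by
    intro x hx
    induction hx using AddSubmonoid.closure_induction with
    | zero => simp
    | add x y _ _ hx hy => rw [mul_add]; exact add_mem hx hy
    | mem x hx =>
      rcases hx with ⟨f, m, hm, rfl⟩ | ⟨f, g, hg, -⟩
      · rcases hm with rfl | hm
        · rw [mul_one, mul_comm]
          exact hQM.sq_mul_mem f _ (add_mem hQM.one_mem ha)
        · rw [List.mem_singleton.1 hm, mul_left_comm]
          exact hQM.sq_mul_mem f _ hap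
      · exact absurd hg List.not_mem_nil
  obtain ⟨c, hc⟩ := (isQuadraticModule_certificates (P := .putinar)
    (G := ⟨[p], []⟩)).archimedean_of_ball (K := ρ)
      (multiplier_mem_certificates (.inr (List.mem_singleton.2 hp.symm))) a
  have h1 := hM₁ _ hc
  -- completing the square in `(1 + a) * (c - a)`
  have h2 : C (c + c ^ 2 / 4) - a ∈ certificates .schmudgen G := by
    have := add_mem h1 (hQM.sq_mem (a - C (c / 2)))
    rwa [show (1 + a) * (C c - a) + (a - C (c / 2)) ^ 2 = C (c + c ^ 2 / 4) - a by
      rw [show c + c ^ 2 / 4 = c / 2 + c / 2 + c / 2 * (c / 2) by ring,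
        show (C c : MvPolynomial σ ℝ) = C (c / 2) + C (c / 2) by rw [← C_add, add_halves]]
      simp only [C_add, C_mul]
      ring] at this
  refine ⟨ρ + ρ * (c + c ^ 2 / 4), ?_⟩
  -- `(1 + a) * p + (∑ Xᵢ²) * a = p + ρ * a`, where `a` is replaced by its upper bound
  have h3 : (∑ i, X i ^ 2) * a ∈ certificates .schmudgen G :=
    mul_mem_certificates_schmudgen (AddSubmonoid.sum_mem _ fun i _ => hQM.sq_mem (X i)) ha
  have h4 : C ρ * (C (c + c ^ 2 / 4) - a) ∈ certificates .schmudgen G := by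
    have := hQM.smul_mem hρ0 h2
    rwa [MvPolynomial.smul_eq_C_mul] at this
  have := add_mem (add_mem hap h3) h4
  rwa [show (1 + a) * p + (∑ i, X i ^ 2) * a + C ρ * (C (c + c ^ 2 / 4) - a) =
    C (ρ + ρ * (c + c ^ 2 / 4)) - ∑ i, X i ^ 2 by
      rw [hp, show (C (ρ + ρ * (c + c ^ 2 / 4)) : MvPolynomial σ ℝ) =
      C ρ + C ρ * C (c + c ^ 2 / 4) by rw [← C_mul, ← C_add]]; ring] at this

/-- The Positivstellensätze of Schmüdgen and Putinar. -/
theorem exists_mem_sosLevel_of_pos [Fintype σ] (P : Positivstellensatz) (G : PolySystem σ)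
    (hG : Bornology.IsBounded G.region) (hP : P = .putinar → G.IsArchimedean)
    {p : MvPolynomial σ ℝ} (hp : ∀ z ∈ G.region, 0 < eval z p) : ∃ d, p ∈ sosLevel P G d := by
  apply exists_mem_sosLevel
  have hball : ∃ K : ℝ, C K - ∑ i, X i ^ 2 ∈ certificates P G := by
    cases P with
    | putinar =>
      obtain ⟨K, -, d, hd⟩ := hP rfl
      exact ⟨K, sosLevel_le_certificates d hd⟩
    | schmudgen => exact exists_ball_mem_certificates hG
  obtain ⟨K, hK⟩ := hball
  exact isQuadraticModule_certificates.mem_of_pos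
    (isQuadraticModule_certificates.archimedean_of_ball hK)
    fun z hz => hp z (mem_region_of_nonneg hz)

end Certificates

/-! ### Linear matrix inequalities -/

/-- The solution set of a linear matrix inequality. -/
def IsSpectrahedron {W : Type} [AddCommGroup W] [Module ℝ W] (B : Set W) : Prop :=
  ∃ (ι : Type) (_ : Fintype ι) (L : W →ᵃ[ℝ] Matrix ι ι ℝ), B = {w | (L w).PosSemidef}

/-- A block diagonal matrix is positive semidefinite iff its blocks are. -/
theorem Matrix.posSemidef_fromBlocks_diagonal_iff {ι κ : Type} [Fintype ι] [Fintype κ]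
    (A : Matrix ι ι ℝ) (D : Matrix κ κ ℝ) :
    (Matrix.fromBlocks A 0 0 D).PosSemidef ↔ A.PosSemidef ∧ D.PosSemidef := by
  constructor
  · intro h
    exact ⟨h.submatrix Sum.inl, h.submatrix Sum.inr⟩
  · rintro ⟨hA, hD⟩
    refine .of_dotProduct_mulVec_nonneg (.fromBlocks hA.1 (by simp) hD.1) fun x => ?_
    have h1 := hA.dotProduct_mulVec_nonneg (x ∘ Sum.inl)
    have h2 := hD.dotProduct_mulVec_nonneg (x ∘ Sum.inr)
    rw [Matrix.fromBlocks_mulVec, dotProduct, Fintype.sum_sum_type]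
    simp only [dotProduct] at h1 h2
    simpa using add_nonneg h1 h2

namespace IsSpectrahedron

variable {W W' : Type} [AddCommGroup W] [Module ℝ W] [AddCommGroup W'] [Module ℝ W']

theorem univ : IsSpectrahedron (Set.univ : Set W) :=
  ⟨Empty, inferInstance, 0, by
    ext w
    simpa using (Matrix.PosSemidef.zero : (0 : Matrix Empty Empty ℝ).PosSemidef)⟩

theorem inter {A B : Set W} (hA : IsSpectrahedron A) (hB : IsSpectrahedron B) :
    IsSpectrahedron (A ∩ B) := by
  obtain ⟨ι, _, L, rfl⟩ := hA
  obtain ⟨κ, _, L', rfl⟩ := hB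
  let Φ : Matrix ι ι ℝ × Matrix κ κ ℝ →ₗ[ℝ] Matrix (ι ⊕ κ) (ι ⊕ κ) ℝ :=
    { toFun := fun p => Matrix.fromBlocks p.1 0 0 p.2
      map_add' := fun p q => by simp [Matrix.fromBlocks_add]
      map_smul' := fun c p => by simp [Matrix.fromBlocks_smul] }
  refine ⟨ι ⊕ κ, inferInstance, Φ.toAffineMap.comp (L.prod L'), ?_⟩
  ext w
  exact (Matrix.posSemidef_fromBlocks_diagonal_iff _ _).symm

theorem preimage {A : Set W} (hA : IsSpectrahedron A) (φ : W' →ᵃ[ℝ] W) :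
    IsSpectrahedron (φ ⁻¹' A) := by
  obtain ⟨ι, _, L, rfl⟩ := hA
  exact ⟨ι, inferInstance, L.comp φ, rfl⟩

theorem posSemidef (ι : Type) [Fintype ι] :
    IsSpectrahedron {Q : Matrix ι ι ℝ | Q.PosSemidef} :=
  ⟨ι, inferInstance, AffineMap.id ℝ _, rfl⟩

/-- Finitely many affine equations form a linear matrix inequality: `x = 0` iff the diagonal matrix
with the entries `±xᵢ` is positive semidefinite. -/
theorem zero_pi (m : ℕ) : IsSpectrahedron ({0} : Set (Fin m → ℝ)) := by
  let Φ : (Fin m → ℝ) →ₗ[ℝ] Matrix (Fin m ⊕ Fin m) (Fin m ⊕ Fin m) ℝ :=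
    { toFun := fun p => Matrix.diagonal (Sum.elim p (-p))
      map_add' := fun p q => by
        rw [Matrix.diagonal_add]; congr 1; ext i; cases i <;> simp [add_comm]
      map_smul' := fun c p => by
        rw [RingHom.id_apply, ← Matrix.diagonal_smul]; congr 1; ext i; cases i <;> simp }
  refine ⟨_, inferInstance, Φ.toAffineMap, ?_⟩
  ext w
  have : (Φ w).PosSemidef ↔ ∀ i, 0 ≤ Sum.elim w (-w) i := Matrix.posSemidef_diagonal_iff
  simp only [Set.mem_singleton_iff, Set.mem_ofPred_eq, LinearMap.coe_toAffineMap, this]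
  constructor
  · rintro rfl i
    cases i <;> simp
  · intro h
    funext i
    have h1 := h (.inl i)
    have h2 := h (.inr i)
    simp only [Sum.elim_inl, Sum.elim_inr, Pi.neg_apply] at h1 h2
    exact le_antisymm (neg_nonneg.mp h2) h1

/-- The zero set of an affine map from a finite-dimensional space, with values in a space of any
dimension, is the solution set of a linear matrix inequality. -/
theorem zero_set [FiniteDimensional ℝ W] {F : Type} [AddCommGroup F] [Module ℝ F]
    (ψ : W →ᵃ[ℝ] F) : IsSpectrahedron {w | ψ w = 0} := by
  -- all values of `ψ` lie in the finite-dimensional space `R`, where coordinates are available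
  let R : Submodule ℝ F := LinearMap.range ψ.linear ⊔ Submodule.span ℝ {ψ 0}
  have hR : ∀ w, ψ w ∈ R := fun w => by
    have : ψ w = ψ.linear w + ψ 0 := by
      have := ψ.map_vadd 0 w
      simpa using this
    rw [this]
    exact add_mem (Submodule.mem_sup_left ⟨w, rfl⟩)
      (Submodule.mem_sup_right (Submodule.mem_span_singleton_self _))
  have : FiniteDimensional ℝ R := inferInstance
  obtain ⟨π, hπ⟩ := LinearMap.exists_leftInverse_of_injective R.subtype (by simp)
  let e := (Module.finBasis ℝ R).equivFun
  have h := (zero_pi (Module.finrank ℝ R)).preimage ((e.toLinearMap ∘ₗ π).toAffineMap.comp ψ)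
  convert h using 1
  ext w
  have h1 : π (ψ w) = ⟨ψ w, hR w⟩ := congrArg (fun f => f ⟨ψ w, hR w⟩) hπ
  simp only [Set.mem_ofPred_eq, Set.mem_preimage, Set.mem_singleton_iff, AffineMap.coe_comp,
    Function.comp_apply, LinearMap.coe_toAffineMap, LinearMap.coe_comp, LinearEquiv.coe_coe, h1]
  rw [LinearEquiv.map_eq_zero_iff, ← Subtype.coe_inj]
  rfl

end IsSpectrahedron

/-- The set of the points of `E` that some solution of a linear matrix inequality in `E × W`, with
`W` of finite dimension, lies over. This is `IsSDPRepresentable` without coordinates. -/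
def IsSpectrahedralShadow {E : Type} [AddCommGroup E] [Module ℝ E] (A : Set E) : Prop :=
  ∃ (W : Type) (_ : AddCommGroup W) (_ : Module ℝ W) (_ : FiniteDimensional ℝ W)
    (B : Set (E × W)), IsSpectrahedron B ∧ ∀ x, x ∈ A ↔ ∃ w, (x, w) ∈ B

namespace IsSpectrahedralShadow

variable {E : Type} [AddCommGroup E] [Module ℝ E]

theorem univ : IsSpectrahedralShadow (Set.univ : Set E) :=
  ⟨PUnit, inferInstance, inferInstance, inferInstance, Set.univ, .univ, by simp⟩

theorem inter {A A' : Set E} (hA : IsSpectrahedralShadow A) (hA' : IsSpectrahedralShadow A') :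
    IsSpectrahedralShadow (A ∩ A') := by
  obtain ⟨W, _, _, _, B, hB, h⟩ := hA
  obtain ⟨W', _, _, _, B', hB', h'⟩ := hA'
  refine ⟨W × W', inferInstance, inferInstance, inferInstance, _,
    (hB.preimage (LinearMap.prodMap LinearMap.id (LinearMap.fst ℝ W W')).toAffineMap).inter
      (hB'.preimage (LinearMap.prodMap LinearMap.id (LinearMap.snd ℝ W W')).toAffineMap),
    fun x => ?_⟩
  simp only [Set.mem_inter_iff, h, h']
  exact ⟨fun ⟨⟨w, hw⟩, w', hw'⟩ => ⟨(w, w'), hw, hw'⟩,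
    fun ⟨⟨w, w'⟩, hw, hw'⟩ => ⟨⟨w, hw⟩, w', hw'⟩⟩

theorem forall_fin {n : ℕ} {A : Fin n → Set E} (h : ∀ k, IsSpectrahedralShadow (A k)) :
    IsSpectrahedralShadow {x | ∀ k, x ∈ A k} := by
  induction n with
  | zero => simpa using (univ (E := E))
  | succ n ih =>
    convert (h 0).inter (ih fun k => h k.succ) using 1
    ext x
    simp [Fin.forall_fin_succ]

theorem isSDPRepresentable {A : Set E} (hA : IsSpectrahedralShadow A) :
    IsSDPRepresentable A := by
  classical
  obtain ⟨W, _, _, _, _, ⟨ι, _, L, rfl⟩, h⟩ := hA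
  let e := (Module.finBasis ℝ W).equivFun
  let ε := Fintype.equivFin ι
  refine ⟨_, _, ((Matrix.reindexLinearEquiv ℝ ℝ ε ε).toLinearMap.toAffineMap.comp L).comp
    (LinearMap.prodMap LinearMap.id e.symm.toLinearMap).toAffineMap, ?_⟩
  ext x
  rw [h, Set.mem_ofPred_eq, e.symm.surjective.exists]
  refine exists_congr fun y => ?_
  exact (Matrix.posSemidef_submatrix_equiv ε.symm).symm

end IsSpectrahedralShadow

/-- The linear images of spectrahedra in finite-dimensional spaces. Unlike `IsSDPRepresentable`,
this places a set in a space of infinite dimension, such as a polynomial ring. -/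
def IsSpectrahedralImage {F : Type} [AddCommGroup F] [Module ℝ F] (S : Set F) : Prop :=
  ∃ (W : Type) (_ : AddCommGroup W) (_ : Module ℝ W) (_ : FiniteDimensional ℝ W)
    (B : Set W) (T : W →ₗ[ℝ] F), IsSpectrahedron B ∧ S = T '' B

namespace IsSpectrahedralImage

variable {F : Type} [AddCommGroup F] [Module ℝ F]

theorem preimage {S : Set F} (hS : IsSpectrahedralImage S) {E : Type} [AddCommGroup E] [Module ℝ E]
    [FiniteDimensional ℝ E] (φ : E →ᵃ[ℝ] F) : IsSpectrahedralShadow (φ ⁻¹' S) := by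
  obtain ⟨W, _, _, _, B, T, hB, rfl⟩ := hS
  refine ⟨W, inferInstance, inferInstance, inferInstance, _,
    (hB.preimage (LinearMap.snd ℝ E W).toAffineMap).inter
      (IsSpectrahedron.zero_set ((T ∘ₗ LinearMap.snd ℝ E W).toAffineMap -
        φ.comp (LinearMap.fst ℝ E W).toAffineMap)), fun x => ?_⟩
  simp [sub_eq_zero]

theorem bot : IsSpectrahedralImage ((⊥ : AddSubmonoid F) : Set F) :=
  ⟨PUnit, inferInstance, inferInstance, inferInstance, Set.univ, 0, .univ, by simp⟩

theorem sup {S S' : AddSubmonoid F} (hS : IsSpectrahedralImage (S : Set F))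
    (hS' : IsSpectrahedralImage (S' : Set F)) :
    IsSpectrahedralImage ((S ⊔ S' : AddSubmonoid F) : Set F) := by
  obtain ⟨W, _, _, _, B, T, hB, h⟩ := hS
  obtain ⟨W', _, _, _, B', T', hB', h'⟩ := hS'
  refine ⟨W × W', inferInstance, inferInstance, inferInstance, _, T.coprod T',
    (hB.preimage (LinearMap.fst ℝ W W').toAffineMap).inter
      (hB'.preimage (LinearMap.snd ℝ W W').toAffineMap), ?_⟩
  ext x
  simp only [SetLike.mem_coe, AddSubmonoid.mem_sup]
  simp only [← SetLike.mem_coe, h, h']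
  constructor
  · rintro ⟨_, ⟨w, hw, rfl⟩, _, ⟨w', hw', rfl⟩, rfl⟩
    exact ⟨(w, w'), ⟨hw, hw'⟩, by simp⟩
  · rintro ⟨⟨w, w'⟩, ⟨hw, hw'⟩, rfl⟩
    exact ⟨_, ⟨w, hw, rfl⟩, _, ⟨w', hw', rfl⟩, by simp⟩

theorem closure_biUnion {α : Type} {s : Set α} (hs : s.Finite) {A : α → Set F}
    (h : ∀ m, IsSpectrahedralImage (AddSubmonoid.closure (A m) : Set F)) :
    IsSpectrahedralImage (AddSubmonoid.closure (⋃ m ∈ s, A m) : Set F) := by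
  induction s, hs using Set.Finite.induction_on with
  | empty => simpa using (bot (F := F))
  | insert _ _ ih =>
    rw [Set.biUnion_insert, AddSubmonoid.closure_union]
    exact (h _).sup ih

end IsSpectrahedralImage

/-! ### The truncated certificates as images of spectrahedra -/

/-- The Gram matrix method: the sums of squares of elements of a finite-dimensional space `U`, times
`m`, are the linear image of a cone of positive semidefinite matrices. -/
theorem IsSpectrahedralImage.closure_sq_mul {σ : Type} (U : Submodule ℝ (MvPolynomial σ ℝ))
    [FiniteDimensional ℝ U] (m : MvPolynomial σ ℝ) :
    IsSpectrahedralImage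
      (AddSubmonoid.closure {t | ∃ f ∈ U, t = f ^ 2 * m} : Set (MvPolynomial σ ℝ)) := by
  let b := Module.finBasis ℝ U
  let ι := Fin (Module.finrank ℝ U)
  let T : Matrix ι ι ℝ →ₗ[ℝ] MvPolynomial σ ℝ :=
    { toFun := fun Q => ∑ i, ∑ j, Q i j • ((b i : MvPolynomial σ ℝ) * b j * m)
      map_add' := fun Q Q' => by simp [add_smul, Finset.sum_add_distrib]
      map_smul' := fun c Q => by simp [mul_smul, Finset.smul_sum] }
  have hT : ∀ v : ι → ℝ, T (Matrix.vecMulVec v (star v)) =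
      (∑ i, v i • (b i : MvPolynomial σ ℝ)) ^ 2 * m := fun v => by
    rw [sq, Finset.sum_mul_sum, Finset.sum_mul]
    simp only [T, LinearMap.coe_mk, AddHom.coe_mk, Finset.sum_mul, Matrix.vecMulVec_apply,
      star_trivial, smul_mul_assoc, mul_smul_comm, mul_smul]
    exact Finset.sum_congr rfl fun i _ => Finset.sum_congr rfl fun j _ => smul_comm _ _ _
  refine ⟨Matrix ι ι ℝ, inferInstance, inferInstance, inferInstance, _, T,
    IsSpectrahedron.posSemidef ι, Set.Subset.antisymm (fun t ht => ?_) ?_⟩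
  · induction ht using AddSubmonoid.closure_induction with
    | mem t ht =>
      obtain ⟨f, hf, rfl⟩ := ht
      refine ⟨_, Matrix.posSemidef_vecMulVec_self_star (b.repr ⟨f, hf⟩), ?_⟩
      rw [hT]
      congr 2
      have := congrArg U.subtype (b.sum_repr ⟨f, hf⟩)
      rwa [map_sum] at this
    | zero => exact ⟨0, Matrix.PosSemidef.zero, map_zero _⟩
    | add x y _ _ hx hy =>
      obtain ⟨Q, hQ, rfl⟩ := hx
      obtain ⟨Q', hQ', rfl⟩ := hy
      exact ⟨Q + Q', hQ.add hQ', map_add _ _ _⟩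
  · rintro _ ⟨Q, hQ, rfl⟩
    obtain ⟨r, v, rfl⟩ := Matrix.posSemidef_iff_eq_sum_vecMulVec.mp hQ
    rw [SetLike.mem_coe, map_sum]
    refine sum_mem fun i _ => AddSubmonoid.subset_closure ⟨_, ?_, hT _⟩
    exact sum_mem fun j _ => U.smul_mem _ (b j).2

/-- The multiples `f ^ 2 * m` of degree at most `d` arise from the `f` in a space of finite
dimension: there are no cancellations, so that `f` has degree at most `(d - deg m) / 2`, unless the
product vanishes. -/
theorem MvPolynomial.exists_submodule_sq_mul {σ : Type} [Finite σ] (m : MvPolynomial σ ℝ) (d : ℕ) :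
    ∃ U : Submodule ℝ (MvPolynomial σ ℝ), FiniteDimensional ℝ U ∧
      {t | ∃ f, t = f ^ 2 * m ∧ t.totalDegree ≤ d} = {t | ∃ f ∈ U, t = f ^ 2 * m} := by
  by_cases hm : m = 0 ∨ d < m.totalDegree
  · refine ⟨⊥, inferInstance, ?_⟩
    ext t
    simp only [Set.mem_ofPred_eq, Submodule.mem_bot, exists_eq_left]
    constructor
    · rintro ⟨f, rfl, hf⟩
      rcases hm with rfl | hm
      · simp
      by_cases hf0 : f = 0
      · simp [hf0]
      have hm0 : m ≠ 0 := by rintro rfl; simp at hm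
      rw [totalDegree_mul_of_isDomain (pow_ne_zero _ hf0) hm0] at hf
      omega
    · rintro rfl
      exact ⟨0, rfl, by simp⟩
  · push Not at hm
    refine ⟨restrictTotalDegree σ ℝ ((d - m.totalDegree) / 2), inferInstance, ?_⟩
    ext t
    simp only [Set.mem_ofPred_eq, mem_restrictTotalDegree]
    constructor
    · rintro ⟨f, rfl, hf⟩
      refine ⟨f, ?_, rfl⟩
      by_cases hf0 : f = 0
      · simp [hf0]
      rw [totalDegree_mul_of_isDomain (pow_ne_zero _ hf0) hm.1, sq,
        totalDegree_mul_of_isDomain hf0 hf0] at hf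
      omega
    · rintro ⟨f, hf, rfl⟩
      refine ⟨f, rfl, (totalDegree_mul _ _).trans ?_⟩
      have := totalDegree_pow f 2
      omega

theorem IsSpectrahedralImage.closure_mul {σ : Type} [Finite σ] (g : MvPolynomial σ ℝ) (d : ℕ) :
    IsSpectrahedralImage (AddSubmonoid.closure
      {t | ∃ f, t = f * g ∧ t.totalDegree ≤ d} : Set (MvPolynomial σ ℝ)) := by
  let V : Submodule ℝ (MvPolynomial σ ℝ) :=
    restrictTotalDegree σ ℝ d ⊓ (Ideal.span {g}).restrictScalars ℝ
  have : FiniteDimensional ℝ V := Submodule.finiteDimensional_inf_left _ _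
  have hV : {t | ∃ f, t = f * g ∧ t.totalDegree ≤ d} = (V.toAddSubmonoid : Set _) := by
    ext t
    simp only [V, Set.mem_ofPred_eq, Submodule.coe_toAddSubmonoid, SetLike.mem_coe,
      Submodule.mem_inf, mem_restrictTotalDegree, Submodule.restrictScalars_mem,
      Ideal.mem_span_singleton']
    exact ⟨fun ⟨f, h, hd⟩ => ⟨hd, f, h.symm⟩, fun ⟨hd, f, h⟩ => ⟨f, h.symm, hd⟩⟩
  rw [hV, AddSubmonoid.closure_eq]
  exact ⟨V, inferInstance, inferInstance, inferInstance, Set.univ, V.subtype, .univ, by simp⟩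

theorem Positivstellensatz.finite_multipliers {σ : Type} (P : Positivstellensatz)
    (G : PolySystem σ) : (P.multipliers G).Finite := by
  cases P with
  | putinar => exact (G.ineqs.finite_toSet).insert 1
  | schmudgen =>
    refine ((G.ineqs.sublists.finite_toSet).image List.prod).subset ?_
    rintro m ⟨l, hl, rfl⟩
    exact ⟨l, by simpa using hl, rfl⟩

theorem isSpectrahedralImage_sosLevel {σ : Type} [Finite σ] (P : Positivstellensatz)
    (G : PolySystem σ) (d : ℕ) :
    IsSpectrahedralImage (sosLevel P G d : Set (MvPolynomial σ ℝ)) := by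
  have h : sosLevel P G d =
      AddSubmonoid.closure (⋃ m ∈ P.multipliers G, {t | ∃ f, t = f ^ 2 * m ∧ t.totalDegree ≤ d}) ⊔
      AddSubmonoid.closure (⋃ g ∈ {g | g ∈ G.eqs}, {t | ∃ f, t = f * g ∧ t.totalDegree ≤ d}) := by
    rw [← AddSubmonoid.closure_union, sosLevel]
    congr 1
    ext t
    simp only [Set.mem_union, Set.mem_iUnion, Set.mem_ofPred_eq, exists_prop]
    refine or_congr ?_ ?_ <;>
      exact ⟨fun ⟨f, m, hm, h⟩ => ⟨m, hm, f, h⟩, fun ⟨m, hm, f, h⟩ => ⟨f, m, hm, h⟩⟩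
  rw [h]
  refine .sup (.closure_biUnion (P.finite_multipliers G) fun m => ?_)
    (.closure_biUnion (List.finite_toSet _) fun g => .closure_mul g d)
  obtain ⟨U, _, hU⟩ := MvPolynomial.exists_submodule_sq_mul m d
  rw [hU]
  exact .closure_sq_mul U m

/-! ### The semidefinite programs of a sequential model -/

namespace SequentialModel

variable {N : ℕ} [NeZero N] (M : SequentialModel N)

@[simp]
theorem Candidate.V_last {n : ℕ} (x : M.Candidate n) : x.V (Fin.last N) = 0 := by
  simp [Candidate.V]

@[simp]
theorem Candidate.V_castSucc {n : ℕ} (x : M.Candidate n) (k : Fin N) :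
    x.V k.castSucc = (x.2 k : MvPolynomial _ ℝ) := by
  simp [Candidate.V]

/-- The `k`-th value function as a linear function of the candidate. -/
def linearV (n : ℕ) (k : Fin (N + 1)) :
    M.Candidate n →ₗ[ℝ] MvPolynomial (Fin (M.dimS k) ⊕ Fin M.dimΛ) ℝ where
  toFun x := x.V k
  map_add' x y := by
    refine Fin.lastCases ?_ (fun k => ?_) k <;> simp
  map_smul' c x := by
    refine Fin.lastCases ?_ (fun k => ?_) k <;> simp

theorem isSDPRepresentable_feasibleSOS (P : Positivstellensatz) (n d : ℕ) :
    IsSDPRepresentable (M.feasibleSOS P n d) := by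
  refine IsSpectrahedralShadow.isSDPRepresentable (.inter (.forall_fin fun k => ?_) ?_)
  · exact (isSpectrahedralImage_sosLevel P (M.stepSystem k) d).preimage
      (((rename (Sum.elim (M.stateVar k) (M.paramVar k))).toLinearMap ∘ₗ
        M.linearV n k.castSucc).toAffineMap - AffineMap.const ℝ _ (rename Sum.inl (M.r k)) -
      ((bind₁ (Sum.elim (fun i => rename Sum.inl (M.f k i))
        (fun j => X (M.paramVar k j)))).toLinearMap ∘ₗ M.linearV n k.succ).toAffineMap)
  · exact (isSpectrahedralImage_sosLevel P (M.stepSystem 0) d).preimage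
      ((Algebra.linearMap ℝ (MvPolynomial (M.StepVar 0) ℝ) ∘ₗ LinearMap.fst ℝ _ _).toAffineMap -
      ((bind₁ (Sum.elim (fun i => C (M.s₁ i))
        (fun j => X (M.paramVar 0 j)))).toLinearMap ∘ₗ
          M.linearV n (0 : Fin N).castSucc).toAffineMap)

end SequentialModel

/-! ### Basic closed semialgebraic sets and polynomial approximation -/

namespace PolySystem

variable {σ τ : Type}

theorem isClosed_region (G : PolySystem σ) : IsClosed G.region := by
  have h : G.region = (⋂ g ∈ {g | g ∈ G.ineqs}, {z | 0 ≤ eval z g}) ∩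
      ⋂ g ∈ {g | g ∈ G.eqs}, {z | eval z g = 0} := by
    ext z
    simp [region]
  rw [h]
  exact (isClosed_biInter fun g _ => isClosed_le continuous_const g.continuous_eval).inter
    (isClosed_biInter fun g _ => isClosed_eq g.continuous_eval continuous_const)

@[simp]
theorem mem_region_append {G G' : PolySystem σ} {z : σ → ℝ} :
    z ∈ (G.append G').region ↔ z ∈ G.region ∧ z ∈ G'.region := by
  simp only [region, append, Set.mem_ofPred_eq, List.mem_append, or_imp, forall_and]
  tauto

@[simp]
theorem mem_region_rename {φ : σ → τ} {G : PolySystem σ} {z : τ → ℝ} :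
    z ∈ (G.rename φ).region ↔ z ∘ φ ∈ G.region := by
  simp [region, rename, eval_rename]

end PolySystem

/-- The Weierstrass approximation theorem in several variables. -/
theorem MvPolynomial.exists_near_of_isCompact {σ : Type} {K : Set (σ → ℝ)} (hK : IsCompact K)
    {f : (σ → ℝ) → ℝ} (hf : Continuous f) {ε : ℝ} (hε : 0 < ε) :
    ∃ p : MvPolynomial σ ℝ, ∀ z ∈ K, |eval z p - f z| < ε := by
  let φ : MvPolynomial σ ℝ →ₐ[ℝ] C(σ → ℝ, ℝ) := aeval fun i => ⟨fun z => z i, continuous_apply i⟩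
  have hφ : ∀ p z, φ p z = eval z p := fun p z => by
    induction p using MvPolynomial.induction_on with
    | C a => simp [φ]
    | add p q hp hq => rw [map_add, map_add, ContinuousMap.add_apply, hp, hq]
    | mul_X p i hp => rw [map_mul, map_mul, ContinuousMap.mul_apply, hp]; simp [φ]
  have hsep : φ.range.SeparatesPoints := by
    intro z w hzw
    obtain ⟨i, hi⟩ := Function.ne_iff.mp hzw
    exact ⟨φ (X i), ⟨_, ⟨X i, rfl⟩, rfl⟩, by simpa [hφ] using hi⟩
  obtain ⟨_, ⟨p, rfl⟩, hp⟩ :=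
    ContinuousMap.exists_mem_subalgebra_near_continuous_of_isCompact_of_separatesPoints hsep
      ⟨f, hf⟩ hK hε
  refine ⟨p, fun z hz => ?_⟩
  rw [← hφ]
  exact hp z hz

theorem MvPolynomial.eval_bind₁_eq {σ τ : Type} (z : σ → ℝ) (φ : τ → MvPolynomial σ ℝ)
    (q : MvPolynomial τ ℝ) : eval z (bind₁ φ q) = eval (fun i => eval z (φ i)) q := by
  rw [← coe_aeval_eq_eval, ← coe_aeval_eq_eval, RingHom.coe_coe, RingHom.coe_coe, aeval_bind₁]

/-! ### Dynamic programming -/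

/-- A policy `F` determines an evolution from a given initial state. -/
theorem Fin.exists_orbit {N : ℕ} {α : Fin (N + 1) → Type} (a : α 0)
    (F : ∀ k : Fin N, α k.castSucc → α k.succ) :
    ∃ s : ∀ k, α k, s 0 = a ∧ ∀ k : Fin N, s k.succ = F k (s k.castSucc) :=
  ⟨Fin.induction a F, rfl, fun _ => rfl⟩

theorem Fin.sum_sub_succ {N : ℕ} (u : Fin (N + 1) → ℝ) :
    ∑ k : Fin N, (u k.castSucc - u k.succ) = u 0 - u (Fin.last N) := by
  have h1 := Fin.sum_univ_castSucc u
  have h2 := Fin.sum_univ_succ u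
  rw [Finset.sum_sub_distrib]
  linarith

namespace SequentialModel

variable {N : ℕ} [NeZero N] {M : SequentialModel N}

theorem WellPosed.isCompact_S (hM : M.WellPosed) (k : Fin (N + 1)) : IsCompact (M.S k).region :=
  Metric.isCompact_of_isClosed_isBounded (M.S k).isClosed_region (hM.bounded_S k)

theorem WellPosed.isCompact_H (hM : M.WellPosed) (k : Fin N) : IsCompact (M.H k).region :=
  Metric.isCompact_of_isClosed_isBounded (M.H k).isClosed_region (hM.bounded_H k)

theorem WellPosed.isCompact_Λ (hM : M.WellPosed) : IsCompact M.Λ.region :=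
  Metric.isCompact_of_isClosed_isBounded M.Λ.isClosed_region hM.bounded_Λ

theorem continuous_step (k : Fin N) : Continuous
    fun z : (Fin (M.dimS k.castSucc) → ℝ) × (Fin (M.dimH k) → ℝ) × (Fin M.dimΛ → ℝ) =>
      M.step k z.1 z.2.1 z.2.2 := by
  refine continuous_pi fun i => (M.f k i).continuous_eval.comp (continuous_pi fun j => ?_)
  rcases j with j | j | j <;> simp only [Sum.elim_inl, Sum.elim_inr] <;> fun_prop

theorem continuous_reward (k : Fin N) : Continuous
    fun z : (Fin (M.dimS k.castSucc) → ℝ) × (Fin (M.dimH k) → ℝ) × (Fin M.dimΛ → ℝ) =>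
      M.reward k z.1 z.2.1 z.2.2 := by
  refine (M.r k).continuous_eval.comp (continuous_pi fun j => ?_)
  rcases j with j | j | j <;> simp only [Sum.elim_inl, Sum.elim_inr] <;> fun_prop

variable (M) in
/-- The optimal value functions, given by Bellman's backward recursion: the largest reward that can
be collected from step `k` on, as a function of the state and the evolution parameters. -/
def value : ∀ k : Fin (N + 1), (Fin (M.dimS k) → ℝ) → (Fin M.dimΛ → ℝ) → ℝ :=
  Fin.reverseInduction (fun _ _ => 0) fun k W s l =>
    sSup ((fun h => M.reward k s h l + W (M.step k s h l) l) '' (M.H k).region)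

@[simp]
theorem value_last : M.value (Fin.last N) = fun _ _ => 0 := by
  simp [value]

theorem value_castSucc (k : Fin N) (s : Fin (M.dimS k.castSucc) → ℝ) (l : Fin M.dimΛ → ℝ) :
    M.value k.castSucc s l =
      sSup ((fun h => M.reward k s h l + M.value k.succ (M.step k s h l) l) '' (M.H k).region) := by
  simp [value]

theorem WellPosed.continuous_value (hM : M.WellPosed) (k : Fin (N + 1)) :
    Continuous fun z : (Fin (M.dimS k) → ℝ) × (Fin M.dimΛ → ℝ) => M.value k z.1 z.2 := by
  induction k using Fin.reverseInduction with
  | last => simpa using continuous_const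
  | cast k ih =>
    simp only [value_castSucc]
    refine (hM.isCompact_H k).continuous_sSup (f := fun (z : _ × _) h =>
      M.reward k z.1 h z.2 + M.value k.succ (M.step k z.1 h z.2) z.2) ?_
    have hpair : Continuous fun z : ((Fin (M.dimS k.castSucc) → ℝ) × (Fin M.dimΛ → ℝ)) ×
        (Fin (M.dimH k) → ℝ) => (z.1.1, z.2, z.1.2) := by fun_prop
    exact ((continuous_reward k).comp hpair).add
      (ih.comp (((continuous_step k).comp hpair).prodMk (by fun_prop)))

theorem WellPosed.isCompact_image_value (hM : M.WellPosed) (k : Fin N)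
    (s : Fin (M.dimS k.castSucc) → ℝ) (l : Fin M.dimΛ → ℝ) :
    IsCompact ((fun h => M.reward k s h l + M.value k.succ (M.step k s h l) l) ''
      (M.H k).region) := by
  refine (hM.isCompact_H k).image ?_
  have hpair : Continuous fun h : Fin (M.dimH k) → ℝ => (s, h, l) := by fun_prop
  exact ((continuous_reward k).comp hpair).add
    ((hM.continuous_value k.succ).comp (((continuous_step k).comp hpair).prodMk continuous_const))

theorem WellPosed.le_value (hM : M.WellPosed) (k : Fin N) (s : Fin (M.dimS k.castSucc) → ℝ)
    {h : Fin (M.dimH k) → ℝ} (hh : h ∈ (M.H k).region) (l : Fin M.dimΛ → ℝ) :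
    M.reward k s h l + M.value k.succ (M.step k s h l) l ≤ M.value k.castSucc s l := by
  rw [value_castSucc]
  exact le_csSup (hM.isCompact_image_value k s l).bddAbove ⟨h, hh, rfl⟩

theorem WellPosed.exists_eq_value (hM : M.WellPosed) (k : Fin N)
    (s : Fin (M.dimS k.castSucc) → ℝ) (l : Fin M.dimΛ → ℝ) :
    ∃ h ∈ (M.H k).region,
      M.reward k s h l + M.value k.succ (M.step k s h l) l = M.value k.castSucc s l := by
  rw [value_castSucc]
  exact (hM.isCompact_image_value k s l).sSup_mem ((hM.nonempty_H k).image _)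

/-- The reward of an evolution is at most the value of the initial state; a policy that attains the
supremum of Bellman's recursion in every step, with maximizing parameters, collects this value. -/
theorem WellPosed.exists_isGreatest (hM : M.WellPosed) : ∃ R, IsGreatest M.totalRewards R ∧
    ∀ l ∈ M.Λ.region, M.value (0 : Fin N).castSucc M.s₁ l ≤ R := by
  obtain ⟨l, hl, hmax⟩ := hM.isCompact_Λ.exists_isMaxOn hM.nonempty_Λ
    (f := fun l => M.value (0 : Fin N).castSucc M.s₁ l)
    ((hM.continuous_value (0 : Fin N).castSucc).comp
      (continuous_const.prodMk continuous_id)).continuousOn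
  refine ⟨_, ⟨?_, ?_⟩, hmax⟩
  · -- `π` is an optimal policy
    choose π hπ using fun k s => hM.exists_eq_value k s l
    obtain ⟨s, hs0, hs⟩ := Fin.exists_orbit (α := fun k => Fin (M.dimS k) → ℝ) M.s₁
      fun k s => M.step k s (π k s) l
    refine ⟨l, hl, fun k => π k (s k.castSucc), fun k => (hπ k _).1, s, hs0, hs, ?_⟩
    have h1 := Fin.sum_sub_succ fun k => M.value k (s k) l
    rw [value_last, sub_zero, hs0] at h1
    refine Eq.trans h1.symm (Finset.sum_congr rfl fun k _ => ?_)
    rw [← (hπ k _).2, hs k]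
    ring
  · rintro _ ⟨l', hl', h, hh, s, hs0, hs, rfl⟩
    refine le_trans ?_ (hmax hl')
    have h1 := Fin.sum_sub_succ fun k => M.value k (s k) l'
    have h2 : s 0 = M.s₁ := hs0
    rw [value_last, sub_zero, h2] at h1
    refine le_trans (Finset.sum_le_sum fun k _ => ?_) h1.le
    rw [hs k]
    linarith [hM.le_value k (s k.castSucc) (hh k) l']

theorem WellPosed.isGreatest_nuStar (hM : M.WellPosed) : IsGreatest M.totalRewards M.nuStar := by
  obtain ⟨R, hR, -⟩ := hM.exists_isGreatest
  rwa [nuStar, hR.csSup_eq]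

theorem WellPosed.value_le_nuStar (hM : M.WellPosed) {l : Fin M.dimΛ → ℝ}
    (hl : l ∈ M.Λ.region) : M.value (0 : Fin N).castSucc M.s₁ l ≤ M.nuStar := by
  obtain ⟨R, hR, h⟩ := hM.exists_isGreatest
  rw [nuStar, hR.csSup_eq]
  exact h l hl

/-- The inequalities of a feasible candidate telescope along an optimal evolution. -/
theorem WellPosed.nuStar_le_of_mem_feasible (hM : M.WellPosed) {n : ℕ} {x : M.Candidate n}
    (hx : x ∈ M.feasible n) : M.nuStar ≤ x.1 := by
  obtain ⟨l, hl, h, hh, s, hs0, hs, hR⟩ := hM.isGreatest_nuStar.1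
  have hmem : ∀ k, s k ∈ (M.S k).region := by
    refine Fin.induction ?_ fun k ih => ?_
    · have h2 : s 0 = M.s₁ := hs0
      rw [h2]
      exact hM.initial_mem
    · rw [hs k]
      exact hM.step_mem k _ ih _ (hh k) _ hl
  rw [hR]
  have h1 := Fin.sum_sub_succ fun k => eval (Sum.elim (s k) l) (x.V k)
  have h2 : s 0 = M.s₁ := hs0
  rw [Candidate.V_last, map_zero, sub_zero, h2] at h1
  refine le_trans (Finset.sum_le_sum fun k _ => ?_) (h1.le.trans (hx.2 l hl))
  have := hx.1 k (s k.castSucc) (hmem _) (h k) (hh k) l hl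
  rw [← hs k] at this
  linarith

/-! ### The relaxations -/

/-- The candidates of degree `n` that satisfy the dynamic programming inequalities pointwise, up to
an error `ε`. For `ε < 0`, the inequalities hold strictly. -/
def almostFeasible (M : SequentialModel N) (n : ℕ) (ε : ℝ) : Set (M.Candidate n) :=
  {x | (∀ k : Fin N, ∀ s ∈ (M.S k.castSucc).region, ∀ h ∈ (M.H k).region, ∀ l ∈ M.Λ.region,
      M.reward k s h l + eval (Sum.elim (M.step k s h l) l) (x.V k.succ) ≤
        eval (Sum.elim s l) (x.V k.castSucc) + ε) ∧
    ∀ l ∈ M.Λ.region, eval (Sum.elim M.s₁ l) (x.V (0 : Fin N).castSucc) ≤ x.1 + ε}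

theorem almostFeasible_zero (n : ℕ) : M.almostFeasible n 0 = M.feasible n := by
  simp [almostFeasible, feasible]

/-- Constants that decrease along the time steps turn an error `ε` into a margin `ε`. -/
theorem exists_mem_almostFeasible_neg {n : ℕ} {ε : ℝ} {x : M.Candidate n}
    (hx : x ∈ M.almostFeasible n ε) :
    ∃ y ∈ M.almostFeasible n (-ε), y.1 = x.1 + 2 * ε * (N + 1) := by
  let y : M.Candidate n := (x.1 + 2 * ε * (N + 1), fun k =>
    x.2 k + ⟨C (2 * ε * (N - k)), by
      rw [mem_restrictTotalDegree, totalDegree_C]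
      exact Nat.zero_le n⟩)
  have hy : ∀ (k : Fin (N + 1)) (v : _ → ℝ),
      eval v (y.V k) = eval v (x.V k) + 2 * ε * (N - k) := by
    refine Fin.lastCases ?_ fun k => ?_
    · simp
    · intro v
      simp [y]
  refine ⟨y, ⟨fun k s hs h hh l hl => ?_, fun l hl => ?_⟩, rfl⟩
  · have := hx.1 k s hs h hh l hl
    rw [hy, hy, Fin.val_succ, Fin.val_castSucc]
    push_cast
    linarith
  · have := hx.2 l hl
    have h0 : ((((0 : Fin N).castSucc : Fin (N + 1)) : ℕ) : ℝ) = 0 := by simp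
    rw [hy, h0]
    change _ ≤ x.1 + 2 * ε * (N + 1) + -ε
    linarith

/-- Polynomial approximations of the optimal value functions. -/
theorem WellPosed.exists_mem_almostFeasible (hM : M.WellPosed) {ε : ℝ} (hε : 0 < ε) :
    ∃ n, ∃ x ∈ M.almostFeasible n ε, x.1 = M.nuStar := by
  have happrox : ∀ k : Fin N, ∃ p : MvPolynomial (Fin (M.dimS k.castSucc) ⊕ Fin M.dimΛ) ℝ,
      ∀ s ∈ (M.S k.castSucc).region, ∀ l ∈ M.Λ.region,
        |eval (Sum.elim s l) p - M.value k.castSucc s l| < ε / 2 := fun k => by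
    let e : (Fin (M.dimS k.castSucc) → ℝ) × (Fin M.dimΛ → ℝ) →
        (Fin (M.dimS k.castSucc) ⊕ Fin M.dimΛ → ℝ) := fun z => Sum.elim z.1 z.2
    have he : Continuous e := continuous_pi fun i => by
      cases i <;> simp only [e, Sum.elim_inl, Sum.elim_inr] <;> fun_prop
    have hf : Continuous fun v : Fin (M.dimS k.castSucc) ⊕ Fin M.dimΛ → ℝ =>
        M.value k.castSucc (v ∘ Sum.inl) (v ∘ Sum.inr) :=
      (hM.continuous_value k.castSucc).comp
        (f := fun v : Fin (M.dimS k.castSucc) ⊕ Fin M.dimΛ → ℝ => (v ∘ Sum.inl, v ∘ Sum.inr))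
        (by fun_prop)
    obtain ⟨p, hp⟩ := exists_near_of_isCompact
      (((hM.isCompact_S k.castSucc).prod hM.isCompact_Λ).image he) hf (half_pos hε)
    exact ⟨p, fun s hs l hl => hp _ ⟨(s, l), ⟨hs, hl⟩, rfl⟩⟩
  choose p hp using happrox
  let n := Finset.univ.sup fun k => (p k).totalDegree
  let x : M.Candidate n := (M.nuStar, fun k => ⟨p k, by
    rw [mem_restrictTotalDegree]
    exact Finset.le_sup (f := fun k => (p k).totalDegree) (Finset.mem_univ k)⟩)
  have hx : ∀ k, ∀ s ∈ (M.S k).region, ∀ l ∈ M.Λ.region,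
      |eval (Sum.elim s l) (x.V k) - M.value k s l| < ε / 2 := by
    refine Fin.lastCases ?_ fun k => ?_
    · intro s _ l _
      simpa using hε
    · intro s hs l hl
      rw [Candidate.V_castSucc]
      exact hp k s hs l hl
  refine ⟨n, x, ⟨fun k s hs h hh l hl => ?_, fun l hl => ?_⟩, rfl⟩
  · have h1 := abs_lt.mp (hx _ s hs l hl)
    have h2 := abs_lt.mp (hx _ _ (hM.step_mem k s hs h hh l hl) l hl)
    linarith [hM.le_value k s hh l]
  · have h1 := abs_lt.mp (hx _ _ hM.initial_mem l hl)
    change _ ≤ M.nuStar + ε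
    linarith [hM.value_le_nuStar hl]

/-- The slack of step `k`, at a point where the last variables need not be the next state. -/
theorem eval_stepSlack {n : ℕ} (x : M.Candidate n) (k : Fin N) (z : M.StepVar k → ℝ) :
    eval z (x.stepSlack k) =
      eval (Sum.elim (z ∘ M.stateVar k) (z ∘ M.paramVar k)) (x.V k.castSucc) -
      M.reward k (z ∘ M.stateVar k) (z ∘ M.actionVar k) (z ∘ M.paramVar k) -
      eval (Sum.elim (M.step k (z ∘ M.stateVar k) (z ∘ M.actionVar k) (z ∘ M.paramVar k))
        (z ∘ M.paramVar k)) (x.V k.succ) := by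
  have hz : z ∘ Sum.inl = Sum.elim (z ∘ M.stateVar k)
      (Sum.elim (z ∘ M.actionVar k) (z ∘ M.paramVar k)) := by
    funext i
    rcases i with i | i | i <;> rfl
  rw [Candidate.stepSlack, map_sub, map_sub, eval_rename, eval_rename, eval_bind₁_eq, hz]
  congr 2
  · congr 1
    congr 1
    funext i
    rcases i with i | i <;> rfl
  · congr 1
    funext i
    rcases i with i | i
    · simp only [Sum.elim_inl, eval_rename, hz]
      rfl
    · simp

theorem eval_initialSlack {n : ℕ} (x : M.Candidate n) (z : M.StepVar 0 → ℝ) :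
    eval z x.initialSlack =
      x.1 - eval (Sum.elim M.s₁ (z ∘ M.paramVar 0)) (x.V (0 : Fin N).castSucc) := by
  rw [Candidate.initialSlack, map_sub, eval_bind₁_eq, eval_C]
  congr 2
  congr 1
  funext i
  rcases i with i | i
  · exact eval_C _
  · exact eval_X _

theorem mem_region_stepSystem {k : Fin N} {z : M.StepVar k → ℝ} :
    z ∈ (M.stepSystem k).region ↔ z ∘ M.stateVar k ∈ (M.S k.castSucc).region ∧
      z ∘ M.actionVar k ∈ (M.H k).region ∧ z ∘ M.paramVar k ∈ M.Λ.region ∧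
      z ∘ M.nextVar k ∈ (M.S k.succ).region ∧ z ∈ (M.motionSystem k).region := by
  simp [stepSystem, and_assoc]

theorem WellPosed.exists_mem_region (hM : M.WellPosed) (k : Fin N)
    {s : Fin (M.dimS k.castSucc) → ℝ} (hs : s ∈ (M.S k.castSucc).region)
    {h : Fin (M.dimH k) → ℝ} (hh : h ∈ (M.H k).region) {l : Fin M.dimΛ → ℝ}
    (hl : l ∈ M.Λ.region) : ∃ z ∈ (M.stepSystem k).region,
      z ∘ M.stateVar k = s ∧ z ∘ M.actionVar k = h ∧ z ∘ M.paramVar k = l := by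
  refine ⟨Sum.elim (Sum.elim s (Sum.elim h l)) (M.step k s h l), ?_, rfl, rfl, rfl⟩
  refine mem_region_stepSystem.mpr ⟨hs, hh, hl, hM.step_mem k s hs h hh l hl,
    by simp [motionSystem], ?_⟩
  intro g hg
  obtain ⟨i, rfl⟩ := (List.mem_ofFn' _ _).mp hg
  rw [map_sub, eval_X, eval_rename, Sum.elim_comp_inl]
  exact sub_self _

theorem WellPosed.isBounded_region_stepSystem (hM : M.WellPosed) (k : Fin N) :
    Bornology.IsBounded (M.stepSystem k).region := by
  rw [← Bornology.forall_isBounded_image_eval_iff]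
  rintro ((i | i | i) | i)
  · refine ((hM.bounded_S k.castSucc).image_eval i).subset ?_
    rintro _ ⟨z, hz, rfl⟩
    exact ⟨_, (mem_region_stepSystem.mp hz).1, rfl⟩
  · refine ((hM.bounded_H k).image_eval i).subset ?_
    rintro _ ⟨z, hz, rfl⟩
    exact ⟨_, (mem_region_stepSystem.mp hz).2.1, rfl⟩
  · refine (hM.bounded_Λ.image_eval i).subset ?_
    rintro _ ⟨z, hz, rfl⟩
    exact ⟨_, (mem_region_stepSystem.mp hz).2.2.1, rfl⟩
  · refine ((hM.bounded_S k.succ).image_eval i).subset ?_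
    rintro _ ⟨z, hz, rfl⟩
    exact ⟨_, (mem_region_stepSystem.mp hz).2.2.2.1, rfl⟩

theorem WellPosed.feasibleSOS_subset (hM : M.WellPosed) (P : Positivstellensatz) (n d : ℕ) :
    M.feasibleSOS P n d ⊆ M.feasible n := by
  rintro x ⟨hx, hx'⟩
  constructor
  · intro k s hs h hh l hl
    obtain ⟨z, hz, rfl, rfl, rfl⟩ := hM.exists_mem_region k hs hh hl
    have := eval_nonneg_of_mem_certificates (sosLevel_le_certificates _ (hx k)) hz
    rw [eval_stepSlack] at this
    linarith
  · intro l hl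
    obtain ⟨h, hh⟩ := hM.nonempty_H 0
    obtain ⟨z, hz, -, -, rfl⟩ := hM.exists_mem_region 0 hM.initial_mem hh hl
    have := eval_nonneg_of_mem_certificates (sosLevel_le_certificates _ hx') hz
    rw [eval_initialSlack] at this
    linarith

/-- Strict inequalities have certificates. -/
theorem WellPosed.exists_mem_feasibleSOS (hM : M.WellPosed) {P : Positivstellensatz}
    (hP : P = .putinar → ∀ j : Fin N, (M.stepSystem j).IsArchimedean) {n : ℕ} {ε : ℝ} (hε : 0 < ε)
    {x : M.Candidate n} (hx : x ∈ M.almostFeasible n (-ε)) : ∃ d, x ∈ M.feasibleSOS P n d := by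
  have h1 : ∀ k, ∃ d, x.stepSlack k ∈ sosLevel P (M.stepSystem k) d := fun k => by
    refine exists_mem_sosLevel_of_pos P _ (hM.isBounded_region_stepSystem k) (fun h => hP h k)
      fun z hz => ?_
    obtain ⟨hs, hh, hl, -⟩ := mem_region_stepSystem.mp hz
    rw [eval_stepSlack]
    linarith [hx.1 k _ hs _ hh _ hl]
  have h2 : ∃ d, x.initialSlack ∈ sosLevel P (M.stepSystem 0) d := by
    refine exists_mem_sosLevel_of_pos P _ (hM.isBounded_region_stepSystem 0) (fun h => hP h 0)
      fun z hz => ?_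
    rw [eval_initialSlack]
    linarith [hx.2 _ (mem_region_stepSystem.mp hz).2.2.1]
  choose d hd using h1
  obtain ⟨d', hd'⟩ := h2
  exact ⟨max d' (Finset.univ.sup d), fun k => sosLevel_mono
    ((Finset.le_sup (Finset.mem_univ k)).trans (le_max_right _ _)) (hd k),
    sosLevel_mono (le_max_left _ _) hd'⟩

/-- A candidate that is certified at some level remains so for larger degrees and levels. -/
theorem nuSOS_le {P : Positivstellensatz} {n d n' d' : ℕ} (hn : n ≤ n') (hd : d ≤ d')
    {x : M.Candidate n} (hx : x ∈ M.feasibleSOS P n d) : M.nuSOS P n' d' ≤ (x.1 : EReal) := by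
  let y : M.Candidate n' := (x.1, fun k => ⟨x.2 k, by
    have := (x.2 k).2
    rw [mem_restrictTotalDegree] at this ⊢
    exact this.trans hn⟩)
  have hV : ∀ k, y.V k = x.V k := Fin.lastCases (by simp) fun k => by simp [y]
  have hy : y ∈ M.feasibleSOS P n' d' := by
    refine ⟨fun k => ?_, ?_⟩
    · have h : y.stepSlack k = x.stepSlack k := by
        rw [Candidate.stepSlack, Candidate.stepSlack, hV, hV]
      rw [h]
      exact sosLevel_mono hd (hx.1 k)
    · have h : y.initialSlack = x.initialSlack := by
        rw [Candidate.initialSlack, Candidate.initialSlack, hV]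
      rw [h]
      exact sosLevel_mono hd hx.2
  exact iInf₂_le (f := fun x _ => ((x : M.Candidate n').1 : EReal)) y hy

theorem WellPosed.nuStar_le_nuDeg (hM : M.WellPosed) (n : ℕ) : (M.nuStar : EReal) ≤ M.nuDeg n :=
  le_iInf₂ fun _ hx => EReal.coe_le_coe_iff.mpr (hM.nuStar_le_of_mem_feasible hx)

theorem WellPosed.nuDeg_le_nuSOS (hM : M.WellPosed) (P : Positivstellensatz) (n d : ℕ) :
    M.nuDeg n ≤ M.nuSOS P n d :=
  biInf_mono fun _ hx => hM.feasibleSOS_subset P n d hx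

/-- An almost feasible candidate with objective `ν` bounds the relaxations by any `r > ν`, provided
that its error is small in comparison with `r - ν`. -/
theorem WellPosed.exists_nuSOS_le (hM : M.WellPosed) {P : Positivstellensatz}
    (hP : P = .putinar → ∀ j : Fin N, (M.stepSystem j).IsArchimedean) {ν r : ℝ} (hr : ν < r)
    {n : ℕ} {x : M.Candidate n} (hν : x.1 = ν)
    (hx : x ∈ M.almostFeasible n ((r - ν) / (2 * (N + 1)))) :
    ∃ d, ∀ n' d', n ≤ n' → d ≤ d' → M.nuSOS P n' d' ≤ (r : EReal) := by
  obtain ⟨y, hy, hy1⟩ := exists_mem_almostFeasible_neg hx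
  obtain ⟨d, hd⟩ := hM.exists_mem_feasibleSOS hP
    (div_pos (sub_pos.mpr hr) (by positivity)) hy
  refine ⟨d, fun n' d' hn hd' => ?_⟩
  have h : y.1 = r := by
    rw [hy1, hν]
    field_simp
    ring
  rw [← h]
  exact nuSOS_le hn hd' hd

theorem almostFeasible_mono {n : ℕ} {ε ε' : ℝ} (h : ε ≤ ε') :
    M.almostFeasible n ε ⊆ M.almostFeasible n ε' :=
  fun _ hx => ⟨fun k s hs h' hh l hl => (hx.1 k s hs h' hh l hl).trans (by gcongr),
    fun l hl => (hx.2 l hl).trans (by gcongr)⟩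

theorem WellPosed.tendsto_nuSOS_nuDeg (hM : M.WellPosed) {P : Positivstellensatz}
    (hP : P = .putinar → ∀ j : Fin N, (M.stepSystem j).IsArchimedean) (n : ℕ) :
    Tendsto (fun d => M.nuSOS P n d) atTop (𝓝 (M.nuDeg n)) := by
  rw [tendsto_order]
  refine ⟨fun a ha => .of_forall fun d => ha.trans_le (hM.nuDeg_le_nuSOS P n d), fun b hb => ?_⟩
  simp only [nuDeg, iInf_lt_iff] at hb
  obtain ⟨x, hx, hxb⟩ := hb
  obtain ⟨r, hxr, hrb⟩ := EReal.lt_iff_exists_real_btwn.mp hxb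
  rw [← almostFeasible_zero] at hx
  have hr := EReal.coe_lt_coe_iff.mp hxr
  obtain ⟨d, hd⟩ := hM.exists_nuSOS_le hP hr rfl
    (almostFeasible_mono (div_nonneg (sub_pos.mpr hr).le (by positivity)) hx)
  filter_upwards [eventually_ge_atTop d] with d' hd'
  exact (hd n d' le_rfl hd').trans_lt hrb

theorem WellPosed.tendsto_nuSOS_nuStar (hM : M.WellPosed) {P : Positivstellensatz}
    (hP : P = .putinar → ∀ j : Fin N, (M.stepSystem j).IsArchimedean) :
    Tendsto (fun n => M.nuSOS P n n) atTop (𝓝 (M.nuStar : EReal)) := by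
  rw [tendsto_order]
  refine ⟨fun a ha => .of_forall fun n => ha.trans_le ((hM.nuStar_le_nuDeg n).trans
    (hM.nuDeg_le_nuSOS P n n)), fun b hb => ?_⟩
  obtain ⟨r, hr, hrb⟩ := EReal.lt_iff_exists_real_btwn.mp hb
  have hr' := EReal.coe_lt_coe_iff.mp hr
  obtain ⟨n, x, hx, hx1⟩ := hM.exists_mem_almostFeasible
    (div_pos (sub_pos.mpr hr') (by positivity : (0 : ℝ) < 2 * (N + 1)))
  obtain ⟨d, hd⟩ := hM.exists_nuSOS_le hP hr' hx1 hx
  filter_upwards [eventually_ge_atTop n, eventually_ge_atTop d] with m hn hd'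
  exact (hd m m hn hd').trans_lt hrb

theorem WellPosed.tendsto_nuDeg (hM : M.WellPosed) {P : Positivstellensatz}
    (hP : P = .putinar → ∀ j : Fin N, (M.stepSystem j).IsArchimedean) :
    Tendsto M.nuDeg atTop (𝓝 (M.nuStar : EReal)) :=
  tendsto_of_tendsto_of_tendsto_of_le_of_le tendsto_const_nhds (hM.tendsto_nuSOS_nuStar hP)
    hM.nuStar_le_nuDeg fun n => hM.nuDeg_le_nuSOS P n n

end SequentialModel

end

theorem mainTheorem2 {N : ℕ} [NeZero N] (M : SequentialModel N) (hM : M.WellPosed) :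
    IsGreatest M.totalRewards M.nuStar ∧
    (∀ (P : Positivstellensatz) (n k : ℕ),
      IsSDPRepresentable (M.feasibleSOS P n k) ∧
      (M.nuStar : EReal) ≤ M.nuDeg n ∧ M.nuDeg n ≤ M.nuSOS P n k) ∧
    (∀ P : Positivstellensatz,
      (P = .putinar → ∀ j : Fin N, (M.stepSystem j).IsArchimedean) →
      (∀ n : ℕ, Tendsto (fun k => M.nuSOS P n k) atTop (𝓝 (M.nuDeg n))) ∧
      Tendsto M.nuDeg atTop (𝓝 (M.nuStar : EReal)) ∧
      Tendsto (fun n => M.nuSOS P n n) atTop (𝓝 (M.nuStar : EReal))) :=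
  ⟨hM.isGreatest_nuStar,
    fun P n k => ⟨M.isSDPRepresentable_feasibleSOS P n k, hM.nuStar_le_nuDeg n,
      hM.nuDeg_le_nuSOS P n k⟩,
    fun _ hP => ⟨hM.tendsto_nuSOS_nuDeg hP, hM.tendsto_nuDeg hP, hM.tendsto_nuSOS_nuStar hP⟩⟩
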